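/- A \emph{knot diagram} is a smooth immersion $k:\mathbb R/\mathbb Z\to\mathbb R^2$ (up to orientation-preserving reparametrization) whose only multiple points are finitely many transversal double points, with a choice of an overpassing and an underpassing strand at each double point. The sign of a crossing is the sign of $\det(\text{velocity of the overpass},\text{velocity of the underpass})$. The \emph{Gauss diagram} $G_k$ is the parametrizing circle with one signed arrow for each crossing, from the overpass to the underpass, carrying the sign of the crossing. The \emph{weirdness} $W_3(k)$ is the sum, over all sets of three arrows of $G_k$ that look like three diameters of the circle with heads and tails alternating along the circle, of the product of the three signs. An \emph{$\Omega_3$-move} with changing disk $C$ transforms a knot diagram $k$ into a knot diagram $l$ which is the same outside $C$. Inside $C$ each of the two diagrams consists of three pairwise crossing strands, which form a triangle: the \emph{top} strand passes over both others, the \emph{middle} strand over the bottom strand only, and the \emph{bottom} strand over none. The move pushes one of the strands across the crossing of the other two; that is, up to orientation-preserving diffeomorphisms from $C$ to the unit disk that agree on $\partial C$, it replaces the three strands $y=x$, $y=-x$, $y=\tfrac12(1-x^2)$ by $y=x$, $y=-x$, $y=-\tfrac12(1-x^2)$ with the same ends, directions and heights. The cyclic order in which the three strands are passed along the knot orients the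 triangle. Let $n$ be the number of edges of the triangle on which this orientation coincides with the orientation of the knot, and put $q=(-1)^n$. The move is \emph{positively directed} (in Arnold's sense) if $q=-1$ before and $q=+1$ after the move. The part of $k$ exterior to $C$ consists of three strands. Let $a$ be the one that connects the top with the middle strand inside $C$, and $b$ the one that connects the middle with the bottom strand. Erase the part of $k$ inside $C$ and the third exterior strand, and make $a$ and $b$ into the components $\hat a,\hat b$ of a two-component link diagram by connecting the two ends of each of them with a strand inside $C$, in such a way that the strand that closes $b$ does not pass over the strand that closes $a$ (the components may have corners; all crossings are transversal double points away from the corners). The \emph{local linking number} $llk(k,C)$ is the linking number of this link, that is, the sum of the signs of the crossings where $\hat b$ crosses over $\hat a$. \textbf{Proposition.} Let $k\mapsto l$ be a positively directed $\Omega_3$-move in the changing disk $C$. Then a link diagram as above exists, and for every such link diagram its linking number $llk(k,C)$ satisfies $$W_3(l)-W_3(k)=llk(k,C).$$ -/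

import Mathlib

open Set
open scoped ContDiff

noncomputable section

/-! ### Plane curves and diagrams -/

/-- The oriented Euclidean plane. -/
abbrev Plane : Type := EuclideanSpace ℝ (Fin 2)

/-- The determinant of the pair `(u, v)`; it is positive iff `(u, v)` is a positive basis. -/
def planeDet (u v : Plane) : ℝ := u 0 * v 1 - u 1 * v 0

/-- A family of closed plane curves, each parametrized by the oriented circle `ℝ / ℤ`. -/
structure ClosedCurves (ι : Type) where
  curve : ι → ℝ → Plane
  periodic : ∀ i, Function.Periodic (curve i) 1

namespace ClosedCurves

variable {ι : Type}

/-- The points of the parametrizing circles, one circle for each component. -/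
abbrev Pt (ι : Type) : Type := ι × UnitAddCircle

/-- The point with parameter `t` on the circle of the component `i`. -/
def pt (i : ι) (t : ℝ) : Pt ι := (i, (t : UnitAddCircle))

/-- The point of the plane to which a point of the parametrizing circles is mapped. -/
def eval (L : ClosedCurves ι) (p : Pt ι) : Plane := (L.periodic p.1).lift p.2

theorem eval_pt (L : ClosedCurves ι) (i : ι) (t : ℝ) : L.eval (pt i t) = L.curve i t :=
  (L.periodic i).lift_coe t

theorem periodic_deriv (L : ClosedCurves ι) (i : ι) :
    Function.Periodic (deriv (L.curve i)) 1 := by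
  intro t
  rw [← deriv_comp_add_const]
  congr 1
  funext s
  exact L.periodic i s

/-- The velocity vector at a point of the parametrizing circles. -/
def velocity (L : ClosedCurves ι) (p : Pt ι) : Plane := (L.periodic_deriv p.1).lift p.2

theorem velocity_pt (L : ClosedCurves ι) (i : ι) (t : ℝ) :
    L.velocity (pt i t) = deriv (L.curve i) t :=
  (L.periodic_deriv i).lift_coe t

/-- `p` and `q` are the two (distinct) preimages of a multiple point. -/
def Crosses (L : ClosedCurves ι) (p q : Pt ι) : Prop := p ≠ q ∧ L.eval p = L.eval q

/-- The component `i` is a smooth immersion near the parameter `t`. -/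
def RegularAt (L : ClosedCurves ι) (i : ι) (t : ℝ) : Prop :=
  ContDiffAt ℝ ∞ (L.curve i) t ∧ deriv (L.curve i) t ≠ 0

/-- The restriction of the component `i` to the closed interval `[s, t]` is a smooth immersion
(one-sided derivatives are used at the ends). -/
def RegularOn (L : ClosedCurves ι) (i : ι) (s t : ℝ) : Prop :=
  ContDiffOn ℝ ∞ (L.curve i) (Icc s t) ∧
    ∀ u ∈ Icc s t, derivWithin (L.curve i) (Icc s t) u ≠ 0

end ClosedCurves

open ClosedCurves

/-- An oriented link diagram with components indexed by `ι`: piecewise smooth immersed closed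
curves whose only multiple points are finitely many transversal double points, none of them at a
corner, together with the set `overpass` of the preimages of crossing points on the overpassing
strands. -/
structure LinkDiagram (ι : Type) extends ClosedCurves ι where
  piecewise_regular : ∀ i t, ∃ δ > 0,
    toClosedCurves.RegularOn i (t - δ) t ∧ toClosedCurves.RegularOn i t (t + δ)
  regular_of_crosses : ∀ i t q, toClosedCurves.Crosses (pt i t) q → toClosedCurves.RegularAt i t
  transversal : ∀ p q, toClosedCurves.Crosses p q →
    planeDet (toClosedCurves.velocity p) (toClosedCurves.velocity q) ≠ 0
  no_triple : ∀ p q r, toClosedCurves.Crosses p q → toClosedCurves.Crosses q r → p = r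
  finite_crossings :
    {x : Pt ι × Pt ι | toClosedCurves.Crosses x.1 x.2}.Finite
  overpass : Set (Pt ι)
  crosses_of_mem_overpass : ∀ p ∈ overpass, ∃ q, toClosedCurves.Crosses p q
  overpass_iff : ∀ p q, toClosedCurves.Crosses p q → (p ∈ overpass ↔ q ∉ overpass)

/-- An oriented knot diagram: a diagram with one component, which is a smooth immersion. -/
structure KnotDiagram extends LinkDiagram Unit where
  regular : ∀ t, toClosedCurves.RegularAt () t

/-- The parametrization of a knot diagram. -/
def KnotDiagram.path (k : KnotDiagram) (t : ℝ) : Plane := k.curve () t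

/-- The point with parameter `t` on the parametrizing circle of `k` is the preimage of a crossing,
on the overpassing strand. -/
def KnotDiagram.IsOver (k : KnotDiagram) (t : ℝ) : Prop := pt () t ∈ k.overpass

/-! ### Gauss diagrams, linking numbers and the weirdness -/

/-- A Gauss diagram on the circles indexed by `ι`: finitely many signed arrows, each given by the
pair of its tail and its head. -/
structure GaussDiagram (ι : Type) where
  arrows : Finset (Pt ι × Pt ι)
  sign : Pt ι × Pt ι → ℤ

/-- The Gauss diagram of a link diagram: one arrow for each crossing, which points from the
overpass to the underpass and has the sign of the crossing. -/
def LinkDiagram.gaussDiagram {ι : Type} (L : LinkDiagram ι) : GaussDiagram ι where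
  arrows := (L.finite_crossings.subset
    (t := {x : Pt ι × Pt ι | L.Crosses x.1 x.2 ∧ x.1 ∈ L.overpass}) (fun _ hx => hx.1)).toFinset
  sign x := SignType.sign (planeDet (L.velocity x.1) (L.velocity x.2))

open Classical in
/-- The linking number of the components `i` and `j` of a link diagram, computed from the component
`i`: the sum of the signs of the crossings where the component `i` crosses over the
component `j`. -/
def LinkDiagram.linkingNumber {ι : Type} (L : LinkDiagram ι) (i j : ι) : ℤ :=
  ∑ x ∈ L.gaussDiagram.arrows with x.1.1 = i ∧ x.2.1 = j, L.gaussDiagram.sign x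

/-- The arrows in `S` form the arrow diagram `w₃`: three diameters of the circle, directed so that
no two heads are adjacent. The ends of the arrows are met in the cyclic order `r 0, …, r 5`. -/
def IsW3 (S : Finset (Pt Unit × Pt Unit)) : Prop :=
  ∃ r : Fin 6 → ℝ, StrictMono r ∧ r 5 < r 0 + 1 ∧
    (S : Set (Pt Unit × Pt Unit)) =
      {(pt () (r 0), pt () (r 3)), (pt () (r 2), pt () (r 5)), (pt () (r 4), pt () (r 1))}

open Classical in
/-- The sum of the signs of the subdiagrams of the form `w₃`, where the sign of a subdiagram is the
product of the signs of its arrows. -/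
def GaussDiagram.w3 (G : GaussDiagram Unit) : ℤ :=
  ∑ S ∈ G.arrows.powerset with IsW3 S, ∏ x ∈ S, G.sign x

/-- The weirdness `W₃` of a knot diagram. -/
def KnotDiagram.weirdness (k : KnotDiagram) : ℤ := k.gaussDiagram.w3

/-! ### Moves of type `Ω₃` -/

/-- An orientation-preserving diffeomorphism (of neighbourhoods) that takes the set `C` to the
closed unit disk. -/
structure DiskChart (C : Set Plane) where
  toHomeo : OpenPartialHomeomorph Plane Plane
  subset_source : C ⊆ toHomeo.source
  image_eq : toHomeo '' C = Metric.closedBall 0 1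
  smooth : ContDiffOn ℝ ∞ toHomeo toHomeo.source
  smooth_symm : ContDiffOn ℝ ∞ toHomeo.symm toHomeo.target
  orientation : ∀ p ∈ toHomeo.source, 0 < (fderiv ℝ toHomeo p).det

/-- The standard picture of three strands in the unit disk: two diameters, and an arc that joins
the points `(-1, 0)` and `(1, 0)` and passes above (`ε = 1`) or below (`ε = -1`) the point where
the diameters cross. Passing from one picture to the other is the `Ω₃`-move. -/
def standardStrand (ε : ℝ) : Fin 3 → Set Plane :=
  ![{p ∈ Metric.closedBall 0 1 | p 1 = p 0},
    {p ∈ Metric.closedBall 0 1 | p 1 = -p 0},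
    {p ∈ Metric.closedBall 0 1 | p 1 = ε * (1 - p 0 ^ 2) / 2}]

/-- The part of the knot diagram `k` in the disk `C` looks like the standard picture of three
strands, of which one (the top strand) has two overcrossings, one (the middle strand) has one, and
one (the bottom strand) has none. The strands inside `C` are numbered in the cyclic order in which
they are passed when one moves along `k`. -/
structure ThreeStrands (k : KnotDiagram) (C : Set Plane) (ε : ℝ) where
  chart : DiskChart C
  /-- The parameters where the strands in `C` start. -/
  start : Fin 3 → ℝ
  /-- The parameters where the strands in `C` end. -/
  finish : Fin 3 → ℝ
  start_lt_finish : ∀ i, start i < finish i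
  finish_zero_lt : finish 0 < start 1
  finish_one_lt : finish 1 < start 2
  finish_two_lt : finish 2 < start 0 + 1
  /-- The strand of the standard picture to which a strand corresponds. -/
  model : Equiv.Perm (Fin 3)
  image_strand : ∀ i, k.path '' Icc (start i) (finish i) =
    C ∩ chart.toHomeo ⁻¹' standardStrand ε (model i)
  notMem_exterior : ∀ i, ∀ t ∈ Ioo (finish i) (![start 1, start 2, start 0 + 1] i), k.path t ∉ C
  /-- The height of a strand: `0` for bottom, `1` for middle, `2` for top. -/
  height : Equiv.Perm (Fin 3)
  over_iff_height : ∀ i j, i ≠ j → ∀ s ∈ Icc (start i) (finish i), ∀ t ∈ Icc (start j) (finish j),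
    k.path s = k.path t → (k.IsOver s ↔ height j < height i)

namespace ThreeStrands

variable {k : KnotDiagram} {C : Set Plane} {ε : ℝ}

/-- The `i`-th strand inside `C`, as a set of parameters. -/
def inside (T : ThreeStrands k C ε) (i : Fin 3) : Set ℝ := Icc (T.start i) (T.finish i)

/-- The parameter where the `i`-th exterior strand ends. This strand starts at `T.finish i` and
connects the strands `i` and `i + 1` inside `C`. -/
def nextStart (T : ThreeStrands k C ε) : Fin 3 → ℝ := ![T.start 1, T.start 2, T.start 0 + 1]

/-- The cyclic order of the strands orients the vanishing triangle: its `i`-th edge leads from the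
crossing with the strand `i - 1` to the crossing with the strand `i + 1`. This says that this
orientation of the `i`-th edge is the one that it has as a part of the knot diagram. -/
def EdgeCoincides (T : ThreeStrands k C ε) (i : Fin 3) : Prop :=
  ∃ s ∈ T.inside i, ∃ t ∈ T.inside i, s < t ∧
    k.path s ∈ k.path '' T.inside (i - 1) ∧ k.path t ∈ k.path '' T.inside (i + 1)

open Classical in
/-- Arnold's sign `q = (-1) ^ n` of the vanishing triangle, where `n` is the number of edges on
which the two orientations coincide. -/
def q (T : ThreeStrands k C ε) : ℤ := (-1) ^ (Finset.univ.filter T.EdgeCoincides).card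

end ThreeStrands

/-- An `Ω₃`-move from `k` to `l` with changing disk `C`: the two diagrams agree outside `C`, and
inside `C` the one is replaced by the other as in the standard pictures, by diffeomorphisms to the
disk which agree on the boundary of `C`. Since a diagram determines its parametrization only up to
an orientation-preserving diffeomorphism of the circle, such a diffeomorphism `φ` (lifted to `ℝ`)
is part of the data. -/
structure Omega3Move (k l : KnotDiagram) (C : Set Plane) where
  before : ThreeStrands k C 1
  after : ThreeStrands l C (-1)
  chart_eq : ∀ p ∈ frontier C, before.chart.toHomeo p = after.chart.toHomeo p
  model_eq : after.model = before.model
  height_eq : after.height = before.height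
  φ : ℝ → ℝ
  φ_smooth : ContDiff ℝ ∞ φ
  φ_deriv_pos : ∀ t, 0 < deriv φ t
  φ_add_one : ∀ t, φ (t + 1) = φ t + 1
  φ_start : ∀ i, φ (before.start i) = after.start i
  φ_finish : ∀ i, φ (before.finish i) = after.finish i
  path_exterior : ∀ i, ∀ t ∈ Icc (before.finish i) (before.nextStart i), l.path (φ t) = k.path t
  over_exterior : ∀ i, ∀ t ∈ Icc (before.finish i) (before.nextStart i),
    (l.IsOver (φ t) ↔ k.IsOver t)

/-- The move is in positive direction (in the sense of Arnold). -/
def Omega3Move.IsPositive {k l : KnotDiagram} {C : Set Plane} (m : Omega3Move k l C) : Prop :=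
  m.before.q = -1 ∧ m.after.q = 1

/-! ### The local link -/

/-- The names of two of the exterior strands. -/
inductive ExteriorStrand
  | a
  | b

namespace ThreeStrands

variable {k : KnotDiagram} {C : Set Plane} {ε : ℝ}

/-- The number of an exterior strand: `a` connects the top and the middle strand inside `C`,
and `b` connects the middle and the bottom strand. -/
def IsNumberOf (T : ThreeStrands k C ε) : ExteriorStrand → Fin 3 → Prop
  | .a, i => ({T.height i, T.height (i + 1)} : Set (Fin 3)) = {2, 1}
  | .b, i => ({T.height i, T.height (i + 1)} : Set (Fin 3)) = {1, 0}

/-- The affine parametrization of the `i`-th exterior strand by `[0, 1/2]`. -/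
def exteriorParam (T : ThreeStrands k C ε) (i : Fin 3) (u : ℝ) : ℝ :=
  AffineMap.lineMap (T.finish i) (T.nextStart i) (2 * u)

/-- `L` is a two-component link diagram that is obtained as follows. Erase the part of `k` inside
`C` and the exterior strand other than `a` and `b`. Connect the ends of `a` by a strand inside `C`,
and the ends of `b` as well, in such a way that the strand that closes `b` does not pass over the
strand that closes `a`. The first half of each component is the exterior strand, the second half is
the strand inside `C`. -/
structure IsLocalLink (T : ThreeStrands k C ε) (L : LinkDiagram ExteriorStrand) : Prop where
  exterior : ∀ c i, T.IsNumberOf c i → ∀ u ∈ Icc (0 : ℝ) (1 / 2),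
    L.curve c u = k.path (T.exteriorParam i u)
  over_exterior : ∀ c i, T.IsNumberOf c i → ∀ u ∈ Icc (0 : ℝ) (1 / 2),
    (∃ p, L.Crosses (pt c u) p) → (pt c u ∈ L.overpass ↔ k.IsOver (T.exteriorParam i u))
  closing : ∀ c, ∀ u ∈ Ioo (1 / 2 : ℝ) 1, L.curve c u ∈ interior C
  closing_not_over : ∀ u ∈ Ioo (1 / 2 : ℝ) 1, ∀ v ∈ Ioo (1 / 2 : ℝ) 1,
    L.curve .b u = L.curve .a v → pt ExteriorStrand.b u ∉ L.overpass

end ThreeStrands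

end

/-! Call an ordered pair of arrows `x`, `y` related if their ends occur in the cyclic order tail of
`x`, tail of `y`, head of `x`, head of `y` (`Follows`). A copy of `w₃` is then a set of three arrows
related in a cycle (`isW3_iff`), so the weirdness is a sum over cyclic triples. The move gives a
sign-preserving bijection between the arrows of the two Gauss diagrams (`arrows_eq`,
`sign_arrowMap`). On the circle it only exchanges the two arrow ends on each of the three strands
inside `C`. A triple can therefore change its type only if it contains two of the three inner arrows
top→middle, middle→bottom, top→bottom. The arrow top→bottom shares a strand with the tail of the
first and with the head of the second, which would make two tails or two heads adjacent; hence it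
never occurs in a cyclic triple together with another inner arrow (`not_follows_top_bot`,
`not_isCyclicTriple_inside`). What remains is the pair top→middle, middle→bottom with one exterior
arrow. Such a triple is cyclic exactly if the exterior arrow leads from `b` to `a` and the two ends
on the middle strand come in one particular order (`isCyclicTriple_iff_of_isExterior`). The move
reverses this order, so each arrow from `b` to `a` contributes to exactly one of the two
weirdnesses, and `weirdness_sub` follows: the difference is a sign times the sum of the signs of
these arrows. That sign is the product of the signs of two crossings and of one edge of the
triangle. In the standard picture it becomes the product of all three edge signs, which is
determined by Arnold's `q` and equals 1 for a positive move (`edgeSign_mul_sign`). In a local link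
the closing strands stay in the interior of `C` and the exterior strands outside it, and closing `b`
is not over closing `a`. So the crossings of `b` over `a` are exactly the arrows just counted
(`IsLocalLink.linkingNumber_eq`). A local link is obtained by closing both strands with straight
chords in the chart, with `a` on top (`localLink`). -/

noncomputable section

open ClosedCurves

/-! ### Cyclic orders and the arrow diagram `w₃` -/

/-- The elements `a, b, c, d` of a line that is closed up to a circle are met in this cyclic
order. -/
def CyclicLt {α : Type*} [LT α] (a b c d : α) : Prop :=
  (a < b ∧ b < c ∧ c < d) ∨ (b < c ∧ c < d ∧ d < a) ∨ (c < d ∧ d < a ∧ a < b) ∨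
    (d < a ∧ a < b ∧ b < c)

/-- The weak version of `CyclicLt`. -/
def CyclicLe {α : Type*} [LE α] (a b c d : α) : Prop :=
  (a ≤ b ∧ b ≤ c ∧ c ≤ d) ∨ (b ≤ c ∧ c ≤ d ∧ d ≤ a) ∨ (c ≤ d ∧ d ≤ a ∧ a ≤ b) ∨
    (d ≤ a ∧ a ≤ b ∧ b ≤ c)

instance (a b c d : Fin 6) : Decidable (CyclicLt a b c d) := by
  unfold CyclicLt; infer_instance

instance (a b c d : Fin 6) : Decidable (CyclicLe a b c d) := by
  unfold CyclicLe; infer_instance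

namespace ClosedCurves

/-- The parameter in `[a, a + 1)` of a point of the parametrizing circles. -/
def rep {ι : Type} (a : ℝ) (p : Pt ι) : ℝ := AddCircle.equivIco 1 a p.2

variable {ι : Type}

theorem rep_mem (a : ℝ) (p : Pt ι) : rep a p ∈ Ico a (a + 1) := (AddCircle.equivIco 1 a p.2).2

theorem pt_rep (a : ℝ) (p : Pt ι) : pt p.1 (rep a p) = p :=
  Prod.ext rfl (AddCircle.coe_equivIco (p := (1 : ℝ)) (a := a) (y := p.2))

theorem pt_rep_unit (a : ℝ) (p : Pt Unit) : pt () (rep a p) = p := pt_rep a p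

theorem rep_pt {a t : ℝ} (i : ι) (ht : t ∈ Ico a (a + 1)) : rep a (pt i t) = t :=
  AddCircle.equivIco_coe_of_mem (p := (1 : ℝ)) (a := a) ht

theorem pt_add_one (i : ι) (t : ℝ) : pt i (t + 1) = pt i t :=
  Prod.ext rfl (AddCircle.coe_add_period (1 : ℝ) t)

theorem pt_eq_iff {i j : ι} {s t : ℝ} : pt i s = pt j t ↔ i = j ∧ ∃ n : ℤ, s = t + n := by
  unfold pt
  rw [Prod.mk.injEq]
  refine and_congr_right fun _ => ?_
  rw [← sub_eq_zero, ← AddCircle.coe_sub, AddCircle.coe_eq_zero_iff]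
  refine exists_congr fun n => ?_
  rw [zsmul_one]
  constructor <;> intro h <;> linarith

theorem pt_eq_iff_of_mem {i j : ι} {a s t : ℝ} (hs : s ∈ Ico a (a + 1)) (ht : t ∈ Ico a (a + 1)) :
    pt i s = pt j t ↔ i = j ∧ s = t := by
  unfold pt
  rw [Prod.mk.injEq, AddCircle.coe_eq_coe_iff_of_mem_Ico (p := (1 : ℝ)) hs ht]

theorem exists_rep_pt_eq_add (a : ℝ) (i : ι) (t : ℝ) : ∃ n : ℤ, rep a (pt i t) = t + n :=
  (pt_eq_iff.1 (pt_rep a (pt i t))).2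

theorem rep_injective (a : ℝ) : Function.Injective (rep a : Pt Unit → ℝ) := fun p q h => by
  rw [← pt_rep_unit a p, ← pt_rep_unit a q, h]

/-- Four points within one turn, moved into a window of length one, keep their order except for at
most one wrap. The place of the wrap selects the disjunct of `CyclicLt`. -/
theorem cyclicLt_rep (s : ℝ) (i : ι) {a b c d : ℝ} (hab : a < b) (hbc : b < c) (hcd : c < d)
    (hda : d < a + 1) :
    CyclicLt (rep s (pt i a)) (rep s (pt i b)) (rep s (pt i c)) (rep s (pt i d)) := by
  have key : ∀ x y : ℝ, ∀ n m : ℤ, x < y → y < x + 1 → x + n ∈ Ico s (s + 1) →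
      y + m ∈ Ico s (s + 1) → m ≤ n ∧ n ≤ m + 1 := by
    intro x y n m h1 h2 h3 h4
    constructor
    · have : (m : ℝ) < n + 1 := by linarith [h3.1, h4.2]
      exact Int.lt_add_one_iff.1 (by exact_mod_cast this)
    · have : (n : ℝ) < m + 1 + 1 := by linarith [h3.2, h4.1]
      exact Int.lt_add_one_iff.1 (by exact_mod_cast this)
  obtain ⟨na, ea⟩ := exists_rep_pt_eq_add s i a
  obtain ⟨nb, eb⟩ := exists_rep_pt_eq_add s i b
  obtain ⟨nc, ec⟩ := exists_rep_pt_eq_add s i c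
  obtain ⟨nd, ed⟩ := exists_rep_pt_eq_add s i d
  have ha := ea ▸ rep_mem s (pt i a)
  have hb := eb ▸ rep_mem s (pt i b)
  have hc := ec ▸ rep_mem s (pt i c)
  have hd := ed ▸ rep_mem s (pt i d)
  rw [ea, eb, ec, ed]
  have k1 := key a b na nb hab (by linarith) ha hb
  have k2 := key b c nb nc hbc (by linarith) hb hc
  have k3 := key c d nc nd hcd (by linarith) hc hd
  have k4 := key a d na nd (by linarith) hda ha hd
  -- The integer shifts are weakly decreasing and drop by at most one in total.
  have e : (nb = na ∧ nc = na ∧ nd = na) ∨ (nb = na ∧ nc = na ∧ na = nd + 1) ∨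
      (nb = na ∧ na = nc + 1 ∧ nd = nc) ∨ (na = nb + 1 ∧ nc = nb ∧ nd = nb) := by omega
  unfold CyclicLt
  rcases e with ⟨rfl, rfl, rfl⟩ | ⟨rfl, rfl, rfl⟩ | ⟨rfl, rfl, rfl⟩ | ⟨rfl, rfl, rfl⟩
  · exact Or.inl ⟨by linarith, by linarith, by linarith⟩
  · refine Or.inr (Or.inr (Or.inr ⟨?_, by linarith, by linarith⟩))
    push_cast at *; linarith
  · refine Or.inr (Or.inr (Or.inl ⟨by linarith, ?_, by linarith⟩))
    push_cast at *; linarith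
  · refine Or.inr (Or.inl ⟨by linarith, by linarith, ?_⟩)
    push_cast at *; linarith

/-- The arrows `x` and `y` intersect, and the ends are met in the cyclic order tail of `x`, tail of
`y`, head of `x`, head of `y`. -/
def Follows (a : ℝ) (x y : Pt Unit × Pt Unit) : Prop :=
  CyclicLt (rep a x.1) (rep a y.1) (rep a x.2) (rep a y.2)

end ClosedCurves

/-- The set `S` consists of three elements that are cyclically related. -/
def IsCyclicTriple {α : Type*} (R : α → α → Prop) (S : Set α) : Prop :=
  ∃ x y z, S = {x, y, z} ∧ R x y ∧ R y z ∧ R z x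

/-- The map `f` cuts the circle open at `a₁` instead of `s`. Three cyclic conditions on pairs then
fix the order of all six ends. -/
theorem exists_shifts_of_cyclicLt {s a₁ a₂ b₁ b₂ c₁ c₂ : ℝ} (ha₁ : a₁ ∈ Ico s (s + 1))
    (ha₂ : a₂ ∈ Ico s (s + 1)) (hb₁ : b₁ ∈ Ico s (s + 1)) (hb₂ : b₂ ∈ Ico s (s + 1))
    (hc₁ : c₁ ∈ Ico s (s + 1)) (hc₂ : c₂ ∈ Ico s (s + 1)) (hab : CyclicLt a₁ b₁ a₂ b₂)
    (hbc : CyclicLt b₁ c₁ b₂ c₂) (hca : CyclicLt c₁ a₁ c₂ a₂) {f : ℝ → ℝ}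
    (hf : ∀ x, f x = if x < a₁ then x + 1 else x) :
    a₁ < f c₂ ∧ f c₂ < f b₁ ∧ f b₁ < f a₂ ∧ f a₂ < f c₁ ∧ f c₁ < f b₂ ∧ f b₂ < a₁ + 1 := by
  simp only [hf]
  obtain ⟨h1, h2⟩ := ha₁
  obtain ⟨h3, h4⟩ := ha₂
  obtain ⟨h5, h6⟩ := hb₁
  obtain ⟨h7, h8⟩ := hb₂
  obtain ⟨h9, h10⟩ := hc₁
  obtain ⟨h11, h12⟩ := hc₂
  unfold CyclicLt at *
  grind

namespace ClosedCurves

theorem isW3_iff (a : ℝ) (S : Finset (Pt Unit × Pt Unit)) :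
    IsW3 S ↔ IsCyclicTriple (Follows a) (S : Set (Pt Unit × Pt Unit)) := by
  constructor
  · rintro ⟨r, hr, h5, hS⟩
    have h01 : r 0 < r 1 := hr (by decide)
    have h12 : r 1 < r 2 := hr (by decide)
    have h23 : r 2 < r 3 := hr (by decide)
    have h34 : r 3 < r 4 := hr (by decide)
    have h45 : r 4 < r 5 := hr (by decide)
    refine ⟨_, _, _, hS, ?_, ?_, ?_⟩
    · exact cyclicLt_rep a () (by linarith) (by linarith) (by linarith) (by linarith)
    -- Ends beyond the cut are replaced by their translates by one, so that the four parameters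
    -- increase.
    · have := cyclicLt_rep a () (a := r 2) (b := r 4) (c := r 5) (d := r 1 + 1) (by linarith)
        (by linarith) (by linarith) (by linarith)
      rwa [pt_add_one] at this
    · have := cyclicLt_rep a () (a := r 4) (b := r 0 + 1) (c := r 1 + 1) (d := r 3 + 1)
        (by linarith) (by linarith) (by linarith) (by linarith)
      rwa [pt_add_one, pt_add_one, pt_add_one] at this
  · rintro ⟨x, y, z, hS, hxy, hyz, hzx⟩
    obtain ⟨f, hf⟩ : ∃ f : ℝ → ℝ, ∀ t, f t = if t < rep a x.1 then t + 1 else t := ⟨_, fun _ => rfl⟩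
    have key := exists_shifts_of_cyclicLt (rep_mem a x.1) (rep_mem a x.2) (rep_mem a y.1)
      (rep_mem a y.2) (rep_mem a z.1) (rep_mem a z.2) hxy hyz hzx hf
    have hpt : ∀ p : Pt Unit, pt () (f (rep a p)) = p := by
      intro p
      rw [hf]
      split_ifs
      · rw [pt_add_one, pt_rep_unit]
      · rw [pt_rep_unit]
    refine ⟨![rep a x.1, f (rep a z.2), f (rep a y.1), f (rep a x.2), f (rep a z.1),
      f (rep a y.2)], ?_, ?_, ?_⟩
    · rw [Fin.strictMono_iff_lt_succ]
      intro i
      fin_cases i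
      exacts [key.1, key.2.1, key.2.2.1, key.2.2.2.1, key.2.2.2.2.1]
    · exact key.2.2.2.2.2
    · rw [hS]
      change _ = ({(pt () (rep a x.1), pt () (f (rep a x.2))),
        (pt () (f (rep a y.1)), pt () (f (rep a y.2))),
        (pt () (f (rep a z.1)), pt () (f (rep a z.2)))} : Set _)
      simp only [hpt, pt_rep_unit]

end ClosedCurves

/-! ### Sums over cyclic triples -/

open Classical in
/-- The sum of the products of signs over all cyclically related triples. -/
def cyclicTripleSum {α : Type*} (A : Finset α) (R : α → α → Prop) (s : α → ℤ) : ℤ :=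
  ∑ S ∈ A.powerset with IsCyclicTriple R ((S : Finset α) : Set α), ∏ x ∈ S, s x

theorem GaussDiagram.w3_eq (G : GaussDiagram Unit) (a : ℝ) :
    G.w3 = cyclicTripleSum G.arrows (Follows a) G.sign := by
  classical
  unfold GaussDiagram.w3 cyclicTripleSum
  simp only [Finset.sum_filter, isW3_iff a]

/-- Pulling back along the bijection of arrows lets both weirdnesses be sums over the same subsets,
which can be subtracted term by term. -/
theorem cyclicTripleSum_image {α β : Type*} [DecidableEq β] {A : Finset α} {f : α → β}
    (hf : Set.InjOn f A) (R : β → β → Prop) (s : β → ℤ) :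
    cyclicTripleSum (A.image f) R s =
      cyclicTripleSum A (fun x y => R (f x) (f y)) (fun x => s (f x)) := by
  classical
  unfold cyclicTripleSum
  simp only [Finset.sum_filter]
  rw [Finset.powerset_image, Finset.sum_image]
  · refine Finset.sum_congr rfl fun S hS => ?_
    have hS' : (S : Set α) ⊆ A := by exact_mod_cast Finset.mem_powerset.1 hS
    rw [Finset.prod_image (hf.mono hS')]
    congr 1
    rw [Finset.coe_image, eq_iff_iff]
    constructor
    · rintro ⟨x, y, z, h, h1, h2, h3⟩
      obtain ⟨x, hx, rfl⟩ : x ∈ f '' S := h ▸ by simp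
      obtain ⟨y, hy, rfl⟩ : y ∈ f '' S := h ▸ by simp
      obtain ⟨z, hz, rfl⟩ : z ∈ f '' S := h ▸ by simp
      refine ⟨x, y, z, ?_, h1, h2, h3⟩
      rw [← image_singleton, ← image_insert_eq, ← image_insert_eq] at h
      exact (hf.image_eq_image_iff hS' (by
        intro w hw; rcases hw with rfl | rfl | rfl <;> exact hS' ‹_›)).1 (by simpa [image_insert_eq] using h)
    · rintro ⟨x, y, z, h, h1, h2, h3⟩
      exact ⟨f x, f y, f z, by rw [h]; simp [image_insert_eq], h1, h2, h3⟩
  · intro S hS T hT h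
    have hS' : (S : Set α) ⊆ A := by exact_mod_cast Finset.mem_powerset.1 hS
    have hT' : (T : Set α) ⊆ A := by exact_mod_cast Finset.mem_powerset.1 hT
    have h' : f '' S = f '' T := by
      have := congrArg (fun U : Finset β => (U : Set β)) h
      simpa using this
    exact_mod_cast (hf.image_eq_image_iff hS' hT').1 h'

/-- The combinatorial core: all triples without the pair `e₁`, `e₂` cancel, and a triple with this
pair is given by its third element. The constant `c` records which of the two relations makes these
triples cyclic. -/
theorem cyclicTripleSum_sub {α : Type*} [DecidableEq α] {A B : Finset α} {R R' : α → α → Prop}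
    (s : α → ℤ) {e₁ e₂ : α} {c : ℤ} (h₁ : e₁ ∈ A) (h₂ : e₂ ∈ A) (hne : e₁ ≠ e₂)
    (hR : ∀ x, ¬ R x x) (hR' : ∀ x, ¬ R' x x)
    (hRR : ∀ S ⊆ A, ¬ (e₁ ∈ S ∧ e₂ ∈ S) →
      (IsCyclicTriple R' (S : Set α) ↔ IsCyclicTriple R (S : Set α)))
    (hB : B ⊆ A) (hB₁ : e₁ ∉ B) (hB₂ : e₂ ∉ B)
    (hc : ∀ x ∈ B, c = 1 ∧ IsCyclicTriple R' {e₁, e₂, x} ∧ ¬ IsCyclicTriple R {e₁, e₂, x} ∨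
      c = -1 ∧ ¬ IsCyclicTriple R' {e₁, e₂, x} ∧ IsCyclicTriple R {e₁, e₂, x})
    (hx : ∀ x ∈ A, x ∉ B → ¬ IsCyclicTriple R' {e₁, e₂, x} ∧ ¬ IsCyclicTriple R {e₁, e₂, x}) :
    cyclicTripleSum A R' s - cyclicTripleSum A R s = c * (s e₁ * s e₂) * ∑ x ∈ B, s x := by
  classical
  unfold cyclicTripleSum
  simp only [Finset.sum_filter]
  rw [← Finset.sum_sub_distrib]
  -- Irreflexivity makes the three members of a cyclic triple distinct.
  have hcard : ∀ {Q : α → α → Prop} {S : Set α}, (∀ x, ¬ Q x x) → IsCyclicTriple Q S → e₁ ∈ S →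
      e₂ ∈ S → ∃ x, x ≠ e₁ ∧ x ≠ e₂ ∧ S = {e₁, e₂, x} := by
    rintro Q S hQ ⟨x, y, z, rfl, h1, h2, h3⟩ m1 m2
    have n1 : x ≠ y := by rintro rfl; exact hQ _ h1
    have n2 : y ≠ z := by rintro rfl; exact hQ _ h2
    have n3 : z ≠ x := by rintro rfl; exact hQ _ h3
    simp only [mem_insert_iff, mem_singleton_iff] at m1 m2
    rcases m1 with rfl | rfl | rfl <;> rcases m2 with rfl | rfl | rfl <;>
      first
      | exact absurd rfl hne
      | exact ⟨z, n3, n2.symm, rfl⟩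
      | exact ⟨y, n1.symm, n2, by grind⟩
      | exact ⟨z, n2.symm, n3, by grind⟩
      | exact ⟨x, n1, n3.symm, by grind⟩
      | exact ⟨y, n2, n1.symm, by grind⟩
      | exact ⟨x, n3.symm, n1, by grind⟩
  have hinj : Set.InjOn (fun x => ({e₁, e₂, x} : Finset α)) B := by
    intro x hxB y hyB h
    have : x ∈ ({e₁, e₂, y} : Finset α) := by
      have h : ({e₁, e₂, x} : Finset α) = {e₁, e₂, y} := h
      rw [← h]; simp
    simp only [Finset.mem_insert, Finset.mem_singleton] at this
    rcases this with rfl | rfl | rfl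
    exacts [absurd hxB hB₁, absurd hxB hB₂, rfl]
  rw [← Finset.sum_subset (s₁ := B.image fun x => ({e₁, e₂, x} : Finset α)), Finset.sum_image hinj,
    Finset.mul_sum]
  · refine Finset.sum_congr rfl fun x hxB => ?_
    have n1 : e₁ ≠ x := by rintro rfl; exact hB₁ hxB
    have n2 : e₂ ≠ x := by rintro rfl; exact hB₂ hxB
    have e : ∏ y ∈ ({e₁, e₂, x} : Finset α), s y = s e₁ * (s e₂ * s x) := by
      rw [Finset.prod_insert (by simp [hne, n1]), Finset.prod_insert (by simp [n2]),
        Finset.prod_singleton]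
    rw [e]
    push_cast
    rcases hc x hxB with ⟨rfl, h1, h2⟩ | ⟨rfl, h1, h2⟩
    · rw [if_pos h1, if_neg h2]; ring
    · rw [if_neg h1, if_pos h2]; ring
  · intro S hS
    obtain ⟨x, hxB, rfl⟩ := Finset.mem_image.1 hS
    rw [Finset.mem_powerset]
    intro y hy
    simp only [Finset.mem_insert, Finset.mem_singleton] at hy
    rcases hy with rfl | rfl | rfl
    exacts [h₁, h₂, hB hxB]
  · intro S hS hSB
    have hSA := Finset.mem_powerset.1 hS
    by_cases h12 : e₁ ∈ S ∧ e₂ ∈ S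
    · have key : ¬ IsCyclicTriple R' (S : Set α) ∧ ¬ IsCyclicTriple R (S : Set α) := by
        by_contra hcon
        obtain ⟨x, n1, n2, hSx⟩ : ∃ x, x ≠ e₁ ∧ x ≠ e₂ ∧ (S : Set α) = {e₁, e₂, x} := by
          by_cases h : IsCyclicTriple R' (S : Set α)
          · exact hcard hR' h h12.1 h12.2
          · exact hcard hR (by tauto) h12.1 h12.2
        have hSx' : S = {e₁, e₂, x} := by
          apply Finset.coe_injective; simpa using hSx
        have hxA : x ∈ A := hSA (by rw [hSx']; simp)
        by_cases hxB : x ∈ B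
        · exact hSB (Finset.mem_image.2 ⟨x, hxB, hSx'.symm⟩)
        · rw [hSx] at hcon
          exact hcon (hx x hxA hxB)
      rw [if_neg key.1, if_neg key.2, sub_self]
    · simp only [hRR S hSA h12, sub_self]

/-! ### Linear algebra of the plane -/

/-- This is what makes the signs of crossings independent of an orientation-preserving chart. -/
theorem planeDet_map (D : Plane →L[ℝ] Plane) (v w : Plane) :
    planeDet (D v) (D w) = D.det * planeDet v w := by
  have hdet : D.det = D (EuclideanSpace.single 0 1) 0 * D (EuclideanSpace.single 1 1) 1 -
      D (EuclideanSpace.single 1 1) 0 * D (EuclideanSpace.single 0 1) 1 := by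
    rw [ContinuousLinearMap.det, ← LinearMap.det_toMatrix (EuclideanSpace.basisFun (Fin 2) ℝ).toBasis,
      Matrix.det_fin_two]
    simp [LinearMap.toMatrix_apply]
  have hv : ∀ v : Plane, v = v 0 • EuclideanSpace.single (0 : Fin 2) (1 : ℝ) +
      v 1 • EuclideanSpace.single (1 : Fin 2) (1 : ℝ) := by
    intro v; ext i; fin_cases i <;> simp
  have hD : ∀ (v : Plane) (i : Fin 2), D v i =
      v 0 * D (EuclideanSpace.single 0 1) i + v 1 * D (EuclideanSpace.single 1 1) i := by
    intro v i
    conv_lhs => rw [hv v]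
    simp
  unfold planeDet
  rw [hdet, hD v 0, hD v 1, hD w 0, hD w 1]
  ring

theorem planeDet_smul_smul (a b : ℝ) (v w : Plane) :
    planeDet (a • v) (b • w) = a * b * planeDet v w := by
  simp [planeDet]; ring

theorem plane_ext {p q : Plane} (h0 : p 0 = q 0) (h1 : p 1 = q 1) : p = q := by
  ext i; fin_cases i <;> assumption

theorem plane_norm_sq (p : Plane) : ‖p‖ ^ 2 = p 0 ^ 2 + p 1 ^ 2 := by
  rw [EuclideanSpace.norm_sq_eq, Fin.sum_univ_two]; simp

theorem plane_mem_closedBall {p : Plane} :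
    p ∈ Metric.closedBall (0 : Plane) 1 ↔ p 0 ^ 2 + p 1 ^ 2 ≤ 1 := by
  rw [mem_closedBall_zero_iff, ← plane_norm_sq, sq_le_one_iff₀ (norm_nonneg p)]

theorem plane_mem_ball {p : Plane} : p ∈ Metric.ball (0 : Plane) 1 ↔ p 0 ^ 2 + p 1 ^ 2 < 1 := by
  rw [mem_ball_zero_iff, ← plane_norm_sq, sq_lt_one_iff₀ (norm_nonneg p)]

/-! ### Knot diagrams -/

namespace KnotDiagram

variable (k : KnotDiagram)

theorem path_add_one (t : ℝ) : k.path (t + 1) = k.path t := k.periodic () t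

theorem hasDerivAt_path (t : ℝ) : HasDerivAt k.path (deriv k.path t) t :=
  ((k.regular t).1.differentiableAt (by simp)).hasDerivAt

theorem deriv_path_ne_zero (t : ℝ) : deriv k.path t ≠ 0 := (k.regular t).2

theorem velocity_eq (t : ℝ) : k.velocity (pt () t) = deriv k.path t := velocity_pt _ _ _

theorem eval_eq (t : ℝ) : k.eval (pt () t) = k.path t := eval_pt _ _ _

theorem crosses_iff {s t : ℝ} :
    k.Crosses (pt () s) (pt () t) ↔ pt () s ≠ pt () t ∧ k.path s = k.path t := by
  rw [Crosses, eval_eq, eval_eq]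

end KnotDiagram

theorem ClosedCurves.Crosses.symm {ι : Type} {L : ClosedCurves ι} {p q : Pt ι} (h : L.Crosses p q) :
    L.Crosses q p := ⟨h.1.symm, h.2.symm⟩

theorem LinkDiagram.mem_arrows {ι : Type} (L : LinkDiagram ι) (x : Pt ι × Pt ι) :
    x ∈ L.gaussDiagram.arrows ↔ L.Crosses x.1 x.2 ∧ x.1 ∈ L.overpass := by
  simp [LinkDiagram.gaussDiagram]

/-! ### Disk charts -/

namespace DiskChart

variable {C : Set Plane} (χ : DiskChart C)

theorem mem_closedBall {p : Plane} (hp : p ∈ C) : χ.toHomeo p ∈ Metric.closedBall (0 : Plane) 1 :=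
  χ.image_eq ▸ mem_image_of_mem _ hp

theorem mem_iff {p : Plane} (hp : p ∈ χ.toHomeo.source) :
    p ∈ C ↔ χ.toHomeo p ∈ Metric.closedBall (0 : Plane) 1 := by
  refine ⟨χ.mem_closedBall, fun h => ?_⟩
  rw [← χ.image_eq] at h
  obtain ⟨c, hc, e⟩ := h
  rwa [← χ.toHomeo.injOn (χ.subset_source hc) hp e]

theorem closedBall_subset_target : Metric.closedBall (0 : Plane) 1 ⊆ χ.toHomeo.target := by
  rw [← χ.image_eq]
  rintro _ ⟨c, hc, rfl⟩
  exact χ.toHomeo.map_source (χ.subset_source hc)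

theorem symm_mem {p : Plane} (hp : p ∈ Metric.closedBall (0 : Plane) 1) : χ.toHomeo.symm p ∈ C := by
  rw [χ.mem_iff (χ.toHomeo.map_target (χ.closedBall_subset_target hp)),
    χ.toHomeo.right_inv (χ.closedBall_subset_target hp)]
  exact hp

/-- The chart is a homeomorphism between open sets, so it matches the interiors of `C` and of the
closed disk. -/
theorem mem_interior_iff {p : Plane} (hp : p ∈ C) :
    p ∈ interior C ↔ χ.toHomeo p ∈ Metric.ball (0 : Plane) 1 := by
  constructor
  · intro h
    have hsub : χ.toHomeo '' interior C ⊆ interior (Metric.closedBall (0 : Plane) 1) := by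
      apply interior_maximal
      · rw [← χ.image_eq]; exact image_mono interior_subset
      · exact χ.toHomeo.isOpen_image_of_subset_source isOpen_interior
          (interior_subset.trans χ.subset_source)
    rw [interior_closedBall _ one_ne_zero] at hsub
    exact hsub (mem_image_of_mem _ h)
  · intro h
    refine mem_interior.2 ⟨χ.toHomeo.source ∩ χ.toHomeo ⁻¹' Metric.ball 0 1, ?_,
      χ.toHomeo.isOpen_inter_preimage Metric.isOpen_ball, χ.subset_source hp, h⟩
    intro q hq
    exact (χ.mem_iff hq.1).2 (Metric.ball_subset_closedBall hq.2)

theorem mem_frontier {p : Plane} (hp : p ∈ C) (h : χ.toHomeo p ∉ Metric.ball (0 : Plane) 1) :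
    p ∈ frontier C :=
  ⟨subset_closure hp, fun hi => h ((χ.mem_interior_iff hp).1 hi)⟩

theorem injOn : Set.InjOn χ.toHomeo C := χ.toHomeo.injOn.mono χ.subset_source

theorem contDiffAt {p : Plane} (hp : p ∈ χ.toHomeo.source) : ContDiffAt ℝ ∞ χ.toHomeo p :=
  χ.smooth.contDiffAt (χ.toHomeo.open_source.mem_nhds hp)

theorem hasFDerivAt {p : Plane} (hp : p ∈ χ.toHomeo.source) :
    HasFDerivAt χ.toHomeo (fderiv ℝ χ.toHomeo p) p :=
  ((χ.contDiffAt hp).differentiableAt (by simp)).hasFDerivAt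

theorem contDiffAt_symm {p : Plane} (hp : p ∈ χ.toHomeo.target) :
    ContDiffAt ℝ ∞ χ.toHomeo.symm p :=
  χ.smooth_symm.contDiffAt (χ.toHomeo.open_target.mem_nhds hp)

theorem hasFDerivAt_symm {p : Plane} (hp : p ∈ χ.toHomeo.target) :
    HasFDerivAt χ.toHomeo.symm (fderiv ℝ χ.toHomeo.symm p) p :=
  ((χ.contDiffAt_symm hp).differentiableAt (by simp)).hasFDerivAt

theorem fderiv_fderiv_symm {p : Plane} (hp : p ∈ χ.toHomeo.target) (v : Plane) :
    fderiv ℝ χ.toHomeo (χ.toHomeo.symm p) (fderiv ℝ χ.toHomeo.symm p v) = v := by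
  have h := (χ.hasFDerivAt (χ.toHomeo.map_target hp)).comp p (χ.hasFDerivAt_symm hp)
  have h' : HasFDerivAt (χ.toHomeo ∘ χ.toHomeo.symm) (ContinuousLinearMap.id ℝ Plane) p :=
    (hasFDerivAt_id p).congr_of_eventuallyEq
      (Filter.eventually_of_mem (χ.toHomeo.open_target.mem_nhds hp) fun q hq =>
        χ.toHomeo.right_inv hq)
  exact congrArg (fun D : Plane →L[ℝ] Plane => D v) (h.unique h')

theorem sign_planeDet_fderiv {p : Plane} (hp : p ∈ χ.toHomeo.source) (v w : Plane) :
    SignType.sign (planeDet (fderiv ℝ χ.toHomeo p v) (fderiv ℝ χ.toHomeo p w)) =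
      SignType.sign (planeDet v w) := by
  rw [planeDet_map, sign_mul, sign_pos (χ.orientation p hp), one_mul]

theorem fderiv_ne_zero {p : Plane} (hp : p ∈ χ.toHomeo.source) {v : Plane} (hv : v ≠ 0) :
    fderiv ℝ χ.toHomeo p v ≠ 0 := by
  intro h
  -- If the image of `v` were zero, `v` would be in the radical of the determinant form, which is
  -- trivial.
  have key : ∀ w, planeDet v w = 0 := fun w => by
    have := planeDet_map (fderiv ℝ χ.toHomeo p) v w
    rw [h] at this
    simpa [planeDet, (χ.orientation p hp).ne'] using this
  apply hv
  have h0 := key (EuclideanSpace.single 0 1)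
  have h1 := key (EuclideanSpace.single 1 1)
  simp [planeDet] at h0 h1
  exact plane_ext (by simpa using h1) (by simpa using h0)

end DiskChart

/-! ### The standard strands -/

/-- The standard strands are the graphs of these functions. -/
def modelFun (ε : ℝ) : Fin 3 → ℝ → ℝ := ![fun x => x, fun x => -x, fun x => ε * (1 - x ^ 2) / 2]

/-- The slopes of the standard strands. -/
def modelSlope (ε : ℝ) : Fin 3 → ℝ → ℝ := ![fun _ => 1, fun _ => -1, fun x => -ε * x]

/-- The first coordinate of the right end of a standard strand. -/
def modelEnd : Fin 3 → ℝ := ![√2 / 2, √2 / 2, 1]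

/-- The first coordinate of the crossing of two standard strands. -/
def modelCross (ε : ℝ) : Fin 3 → Fin 3 → ℝ :=
  ![![0, 0, ε * (√2 - 1)], ![0, 0, -ε * (√2 - 1)], ![ε * (√2 - 1), -ε * (√2 - 1), 0]]

/-- The sign of a crossing of two standard strands directed from left to right. -/
def modelSign : Fin 3 → Fin 3 → ℤ := ![![0, -1, -1], ![1, 0, 1], ![1, -1, 0]]

/-- The position of the crossings on a standard strand: `modelOrder m = 1` if in the picture with
`ε = 1` the crossing with the strand `m - 1` is to the left of the crossing with `m + 1`. -/
def modelOrder : Fin 3 → ℤ := ![-1, -1, 1]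

theorem mem_standardStrand {ε : ℝ} {m : Fin 3} {p : Plane} :
    p ∈ standardStrand ε m ↔ p ∈ Metric.closedBall (0 : Plane) 1 ∧ p 1 = modelFun ε m (p 0) := by
  fin_cases m <;> rfl

theorem hasDerivAt_modelFun (ε : ℝ) (m : Fin 3) (x : ℝ) :
    HasDerivAt (modelFun ε m) (modelSlope ε m x) x := by
  fin_cases m
  · exact hasDerivAt_id x
  · exact (hasDerivAt_id x).neg
  · have := ((((hasDerivAt_id x).pow 2).const_sub 1).const_mul ε).div_const 2
    refine this.congr_deriv ?_
    simp [modelSlope]; ring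

theorem sqrt_two_bounds : 1.4 < √2 ∧ √2 < 1.5 ∧ √2 ^ 2 = 2 :=
  ⟨Real.lt_sqrt_of_sq_lt (by norm_num), (Real.sqrt_lt' (by norm_num)).2 (by norm_num),
    Real.sq_sqrt (by norm_num)⟩

theorem modelEnd_pos (m : Fin 3) : 0 < modelEnd m := by
  fin_cases m <;> simp [modelEnd]

/-- For the arc, put `u = 1 - x ^ 2`: the condition `u ^ 2 / 4 ≤ u` means `0 ≤ u`, since `u ≤ 1`. -/
theorem model_mem_iff {ε : ℝ} (hε : ε ^ 2 = 1) (m : Fin 3) (x : ℝ) :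
    x ^ 2 + modelFun ε m x ^ 2 ≤ 1 ↔ x ∈ Icc (-modelEnd m) (modelEnd m) := by
  obtain ⟨h1, h2, h3⟩ := sqrt_two_bounds
  rw [mem_Icc, ← abs_le, ← sq_le_sq₀ (abs_nonneg x) (modelEnd_pos m).le, sq_abs]
  fin_cases m <;> simp [modelFun, modelEnd, div_pow, mul_pow, hε, h3]
  · constructor <;> intro h <;> linarith
  · constructor <;> intro h <;> linarith
  · rw [abs_le_one_iff_mul_self_le_one]
    constructor <;> intro h
    · nlinarith [sq_nonneg (1 - x ^ 2)]
    · nlinarith [sq_nonneg (1 - x ^ 2), sq_nonneg x]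

theorem model_norm_end {ε : ℝ} (hε : ε ^ 2 = 1) (m : Fin 3) (x : ℝ) (hx : x ^ 2 = modelEnd m ^ 2) :
    x ^ 2 + modelFun ε m x ^ 2 = 1 := by
  obtain ⟨h1, h2, h3⟩ := sqrt_two_bounds
  fin_cases m <;> simp [modelFun, modelEnd, div_pow, mul_pow, hε, h3] at hx ⊢
  · linarith
  · linarith
  · rcases hx with rfl | rfl <;> norm_num

theorem modelCross_comm (ε : ℝ) (m n : Fin 3) : modelCross ε m n = modelCross ε n m := by
  fin_cases m <;> fin_cases n <;> rfl

theorem modelCross_mem {ε : ℝ} (hε : ε ^ 2 = 1) (m n : Fin 3) :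
    modelCross ε m n ∈ Ioo (-modelEnd m) (modelEnd m) := by
  obtain ⟨h1, h2, h3⟩ := sqrt_two_bounds
  rcases sq_eq_one_iff.1 hε with rfl | rfl <;> fin_cases m <;> fin_cases n <;>
    simp [modelCross, modelEnd] <;> first | linarith | constructor <;> linarith

theorem modelFun_eq_iff {ε : ℝ} (hε : ε ^ 2 = 1) {m n : Fin 3} (hmn : m ≠ n) {x : ℝ}
    (hm : x ∈ Icc (-modelEnd m) (modelEnd m)) :
    modelFun ε m x = modelFun ε n x ↔ x = modelCross ε m n := by
  obtain ⟨h1, h2, h3⟩ := sqrt_two_bounds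
  -- The other root `-√2 - 1` lies outside the disk. The remaining crossings with the arc reduce to
  -- this one by `x ↦ -x`.
  have key : ∀ y : ℝ, y ∈ Icc (-1 : ℝ) 1 → (y = (1 - y ^ 2) / 2 ↔ y = √2 - 1) := by
    intro y hy
    constructor
    · intro h
      have h0 : (y - (√2 - 1)) * (y + √2 + 1) = 0 := by linear_combination 2 * h - h3
      rcases mul_eq_zero.1 h0 with h' | h'
      · linarith
      · linarith [hy.1]
    · rintro rfl
      linear_combination h3 / 2
  have hx : x ∈ Icc (-1 : ℝ) 1 := by
    refine Icc_subset_Icc ?_ ?_ hm <;> fin_cases m <;> simp [modelEnd] <;> linarith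
  have hx' : -x ∈ Icc (-1 : ℝ) 1 := ⟨by linarith [hx.2], by linarith [hx.1]⟩
  have k1 := key x hx
  have k2 := key (-x) hx'
  rcases sq_eq_one_iff.1 hε with rfl | rfl <;> fin_cases m <;> fin_cases n <;>
    first
    | exact absurd rfl hmn
    | (simp [modelCross, modelFun] at k1 k2 ⊢; grind)

/-- At a crossing with a diameter the factor `ε` in the slope of the arc meets the `ε` in the
abscissa and disappears. So the signs of the crossings survive the move. -/
theorem sign_modelSlope {ε : ℝ} (hε : ε ^ 2 = 1) {m n : Fin 3} (hmn : m ≠ n) :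
    (SignType.sign (modelSlope ε n (modelCross ε m n) - modelSlope ε m (modelCross ε m n)) : ℤ) =
      modelSign m n := by
  obtain ⟨h1, h2, h3⟩ := sqrt_two_bounds
  have hp : ∀ x : ℝ, 0 < x → (SignType.sign x : ℤ) = 1 := fun x hx => by rw [sign_pos hx]; rfl
  have hn : ∀ x : ℝ, x < 0 → (SignType.sign x : ℤ) = -1 := fun x hx => by rw [sign_neg hx]; rfl
  rcases sq_eq_one_iff.1 hε with rfl | rfl <;> fin_cases m <;> fin_cases n <;>
    first
    | exact absurd rfl hmn
    | (refine hp _ ?_; simp [modelSlope, modelCross])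
    | (refine hn _ ?_; simp [modelSlope, modelCross])

/-- In contrast to the signs, the order of the crossings along a strand is reversed by `ε ↦ -ε`. -/
theorem sign_modelCross {ε : ℝ} (hε : ε ^ 2 = 1) (m : Fin 3) :
    (SignType.sign (ε * (modelCross ε m (m + 1) - modelCross ε m (m - 1))) : ℤ) =
      modelOrder m := by
  obtain ⟨h1, h2, h3⟩ := sqrt_two_bounds
  have hp : ∀ x : ℝ, 0 < x → (SignType.sign x : ℤ) = 1 := fun x hx => by rw [sign_pos hx]; rfl
  have hn : ∀ x : ℝ, x < 0 → (SignType.sign x : ℤ) = -1 := fun x hx => by rw [sign_neg hx]; rfl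
  rcases sq_eq_one_iff.1 hε with rfl | rfl <;> fin_cases m <;>
    first
    | (refine hp _ ?_; simp [modelCross]; linarith)
    | (refine hn _ ?_; simp [modelCross]; linarith)

/-! ### The strands inside the changing disk -/

namespace ThreeStrands

variable {k : KnotDiagram} {C : Set Plane} {ε : ℝ} (T : ThreeStrands k C ε)

/-- The knot diagram in the coordinates given by the chart. -/
def pic (t : ℝ) : Plane := T.chart.toHomeo (k.path t)

/-- The velocity of the knot diagram in the coordinates given by the chart. -/
def picVel (t : ℝ) : Plane := fderiv ℝ T.chart.toHomeo (k.path t) (deriv k.path t)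

/-- The direction of a strand: `1` if it runs from left to right and `-1` otherwise. -/
def dir (i : Fin 3) : ℤ := if 0 < T.picVel (T.start i) 0 then 1 else -1

/-- The parameter on the strand `i` of the crossing with the strand `j`. -/
def cross (i j : Fin 3) : ℝ :=
  Function.invFunOn (fun t => T.pic t 0) (T.inside i) (modelCross ε (T.model i) (T.model j))

/-- This is `1` if the strands are passed in the cyclic order of the standard strands, and `-1`
otherwise. -/
def parity : ℤ := if T.model 1 = T.model 0 + 1 then 1 else -1

theorem start_mem (i : Fin 3) : T.start i ∈ T.inside i := left_mem_Icc.2 (T.start_lt_finish i).le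

theorem finish_mem (i : Fin 3) : T.finish i ∈ T.inside i :=
  right_mem_Icc.2 (T.start_lt_finish i).le

theorem dir_eq (i : Fin 3) : T.dir i = 1 ∨ T.dir i = -1 := by
  unfold dir; split_ifs <;> simp

theorem dir_sq (i : Fin 3) : (T.dir i : ℝ) * T.dir i = 1 := by
  rcases T.dir_eq i with h | h <;> rw [h] <;> norm_num

variable {i j : Fin 3} {s t : ℝ}

theorem path_mem (ht : t ∈ T.inside i) : k.path t ∈ C :=
  ((T.image_strand i).subset (mem_image_of_mem _ ht)).1

theorem pic_mem (ht : t ∈ T.inside i) : T.pic t ∈ standardStrand ε (T.model i) :=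
  ((T.image_strand i).subset (mem_image_of_mem _ ht)).2

theorem pic_one (ht : t ∈ T.inside i) : T.pic t 1 = modelFun ε (T.model i) (T.pic t 0) :=
  (mem_standardStrand.1 (T.pic_mem ht)).2

theorem exists_pic_eq {p : Plane} (hp : p ∈ standardStrand ε (T.model i)) :
    ∃ t ∈ T.inside i, T.pic t = p := by
  have hb := (mem_standardStrand.1 hp).1
  have e := T.chart.toHomeo.right_inv (T.chart.closedBall_subset_target hb)
  have h : T.chart.toHomeo.symm p ∈ k.path '' T.inside i := by
    unfold inside
    rw [T.image_strand i]
    refine ⟨T.chart.symm_mem hb, ?_⟩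
    rw [mem_preimage, e]
    exact hp
  obtain ⟨t, ht, h⟩ := h
  exact ⟨t, ht, by rw [pic, h, e]⟩

theorem hasDerivAt_pic (h : k.path t ∈ C) : HasDerivAt T.pic (T.picVel t) t :=
  (T.chart.hasFDerivAt (T.chart.subset_source h)).comp_hasDerivAt t (k.hasDerivAt_path t)

theorem hasDerivAt_pic_apply (h : k.path t ∈ C) (n : Fin 2) :
    HasDerivAt (fun t => T.pic t n) (T.picVel t n) t :=
  (EuclideanSpace.proj (𝕜 := ℝ) n).hasFDerivAt.comp_hasDerivAt t (T.hasDerivAt_pic h)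

theorem uniqueDiffWithinAt (ht : t ∈ T.inside i) : UniqueDiffWithinAt ℝ (T.inside i) t :=
  uniqueDiffOn_Icc (T.start_lt_finish i) t ht

/-- Differentiate the equation of the graph within the closed interval, so that the ends of the
strand are covered too. -/
theorem picVel_one (ht : t ∈ T.inside i) :
    T.picVel t 1 = modelSlope ε (T.model i) (T.pic t 0) * T.picVel t 0 := by
  have h1 := (T.hasDerivAt_pic_apply (T.path_mem ht) 1).hasDerivWithinAt (s := T.inside i)
  have h2 := ((hasDerivAt_modelFun ε (T.model i) (T.pic t 0)).comp t
    (T.hasDerivAt_pic_apply (T.path_mem ht) 0)).hasDerivWithinAt (s := T.inside i)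
  exact (T.uniqueDiffWithinAt ht).eq_deriv _ h1
    (h2.congr (fun u hu => T.pic_one hu) (T.pic_one ht))

/-- On a graph, a vertical component comes only with a horizontal one; an immersion has no zero
velocity. -/
theorem picVel_zero_ne (ht : t ∈ T.inside i) : T.picVel t 0 ≠ 0 := by
  intro h
  refine T.chart.fderiv_ne_zero (T.chart.subset_source (T.path_mem ht)) (k.deriv_path_ne_zero t) ?_
  exact plane_ext h (by rw [← picVel, T.picVel_one ht, h]; simp)

/-- By Darboux, a derivative without zeros on an interval has constant sign. Thus a strand runs
monotonically along its standard arc, and `dir` describes it completely up to parametrization. -/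
theorem dir_mul_picVel_pos (ht : t ∈ T.inside i) : 0 < T.dir i * T.picVel t 0 := by
  have h := hasDerivWithinAt_forall_lt_or_forall_gt_of_forall_ne (convex_Icc (T.start i) (T.finish i))
    (fun u hu => (T.hasDerivAt_pic_apply (T.path_mem (i := i) hu) 0).hasDerivWithinAt)
    (fun u hu => T.picVel_zero_ne (i := i) hu)
  unfold dir
  rcases h with h | h
  · have h1 := h _ (T.start_mem i)
    have h2 := h _ ht
    rw [if_neg h1.le.not_gt]; push_cast; linarith
  · have h1 := h _ (T.start_mem i)
    have h2 := h _ ht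
    rw [if_pos h1]; push_cast; linarith

theorem strictMonoOn_pic (i : Fin 3) :
    StrictMonoOn (fun t => T.dir i * T.pic t 0) (T.inside i) := by
  refine strictMonoOn_of_deriv_pos (convex_Icc _ _) (fun u hu => ?_) fun u hu => ?_
  · exact ((T.hasDerivAt_pic_apply (T.path_mem (i := i) hu) 0).const_mul
      (T.dir i : ℝ)).continuousAt.continuousWithinAt
  · have hu' : u ∈ T.inside i := interior_subset hu
    rw [((T.hasDerivAt_pic_apply (T.path_mem hu') 0).const_mul (T.dir i : ℝ)).deriv]
    exact T.dir_mul_picVel_pos hu'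

theorem injOn_pic_zero (i : Fin 3) : Set.InjOn (fun t => T.pic t 0) (T.inside i) :=
  fun s hs t ht h => (T.strictMonoOn_pic i).injOn hs ht (by simpa using Or.inl h)

theorem injOn_path (i : Fin 3) : Set.InjOn k.path (T.inside i) :=
  fun s hs t ht h => T.injOn_pic_zero i hs ht (by simp only [pic]; rw [h])

theorem path_eq_iff_pic (hs : s ∈ T.inside i) (ht : t ∈ T.inside j) :
    k.path s = k.path t ↔ T.pic s = T.pic t :=
  (T.chart.injOn.eq_iff (T.path_mem hs) (T.path_mem ht)).symm

theorem pic_sq_le (ht : t ∈ T.inside i) : T.pic t 0 ^ 2 + T.pic t 1 ^ 2 ≤ 1 :=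
  plane_mem_closedBall.1 (mem_standardStrand.1 (T.pic_mem ht)).1

theorem pic_zero_mem (hε : ε ^ 2 = 1) (ht : t ∈ T.inside i) :
    T.pic t 0 ∈ Icc (-modelEnd (T.model i)) (modelEnd (T.model i)) := by
  rw [← model_mem_iff hε, ← T.pic_one ht]
  exact T.pic_sq_le ht

theorem exists_pic_zero_eq (hε : ε ^ 2 = 1) {x : ℝ}
    (hx : x ∈ Icc (-modelEnd (T.model i)) (modelEnd (T.model i))) :
    ∃ t ∈ T.inside i, T.pic t 0 = x := by
  have hp : !₂[x, modelFun ε (T.model i) x] ∈ standardStrand ε (T.model i) := by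
    rw [mem_standardStrand, plane_mem_closedBall]
    exact ⟨(model_mem_iff hε _ _).2 hx, rfl⟩
  obtain ⟨t, ht, h⟩ := T.exists_pic_eq hp
  exact ⟨t, ht, by rw [h]; rfl⟩

theorem cross_spec (hε : ε ^ 2 = 1) (i j : Fin 3) : T.cross i j ∈ T.inside i ∧
    T.pic (T.cross i j) 0 = modelCross ε (T.model i) (T.model j) :=
  Function.invFunOn_pos (T.exists_pic_zero_eq hε (Ioo_subset_Icc_self (modelCross_mem hε _ _)))

theorem cross_mem (hε : ε ^ 2 = 1) (i j : Fin 3) : T.cross i j ∈ T.inside i := (T.cross_spec hε i j).1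

theorem pic_cross_zero (hε : ε ^ 2 = 1) (i j : Fin 3) :
    T.pic (T.cross i j) 0 = modelCross ε (T.model i) (T.model j) := (T.cross_spec hε i j).2

/-- Two standard graphs meet over a single abscissa in the disk, and each strand passes each
abscissa once. -/
theorem path_eq_iff (hε : ε ^ 2 = 1) (hij : i ≠ j) (hs : s ∈ T.inside i) (ht : t ∈ T.inside j) :
    k.path s = k.path t ↔ s = T.cross i j ∧ t = T.cross j i := by
  have hm : T.model i ≠ T.model j := T.model.injective.ne hij
  rw [T.path_eq_iff_pic hs ht]
  constructor
  · intro h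
    have h0 : T.pic s 0 = modelCross ε (T.model i) (T.model j) := by
      rw [← modelFun_eq_iff hε hm (T.pic_zero_mem hε hs), ← T.pic_one hs, h, ← T.pic_one ht]
    refine ⟨T.injOn_pic_zero i hs (T.cross_mem hε i j) ?_,
      T.injOn_pic_zero j ht (T.cross_mem hε j i) ?_⟩
    · exact h0.trans (T.pic_cross_zero hε i j).symm
    · change T.pic t 0 = T.pic (T.cross j i) 0
      rw [← h, h0, T.pic_cross_zero hε, modelCross_comm]
  · rintro ⟨rfl, rfl⟩
    have e : T.pic (T.cross j i) 0 = T.pic (T.cross i j) 0 := by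
      rw [T.pic_cross_zero hε, T.pic_cross_zero hε, modelCross_comm]
    refine plane_ext e.symm ?_
    rw [T.pic_one hs, T.pic_one ht, e, modelFun_eq_iff hε hm (T.pic_zero_mem hε hs),
      T.pic_cross_zero hε]

theorem path_cross (hε : ε ^ 2 = 1) (hij : i ≠ j) : k.path (T.cross i j) = k.path (T.cross j i) :=
  (T.path_eq_iff hε hij (T.cross_mem hε i j) (T.cross_mem hε j i)).2 ⟨rfl, rfl⟩

/-- The first coordinate is monotone and covers the whole range of the standard strand, so the start
is at an extreme abscissa. -/
theorem pic_start_zero (hε : ε ^ 2 = 1) (i : Fin 3) :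
    T.pic (T.start i) 0 = -(T.dir i * modelEnd (T.model i)) := by
  have hρ := (modelEnd_pos (T.model i))
  have h1 := T.pic_zero_mem hε (T.start_mem i)
  rcases T.dir_eq i with h | h
  · obtain ⟨t, ht, e⟩ := T.exists_pic_zero_eq (i := i) hε (left_mem_Icc.2 (by linarith))
    have := (T.strictMonoOn_pic i).monotoneOn (T.start_mem i) ht ht.1
    simp only [h, e] at this ⊢
    push_cast at this ⊢
    linarith [h1.1]
  · obtain ⟨t, ht, e⟩ := T.exists_pic_zero_eq (i := i) hε (right_mem_Icc.2 (by linarith))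
    have := (T.strictMonoOn_pic i).monotoneOn (T.start_mem i) ht ht.1
    simp only [h, e] at this ⊢
    push_cast at this ⊢
    linarith [h1.2]

theorem pic_finish_zero (hε : ε ^ 2 = 1) (i : Fin 3) :
    T.pic (T.finish i) 0 = T.dir i * modelEnd (T.model i) := by
  have hρ := (modelEnd_pos (T.model i))
  have h1 := T.pic_zero_mem hε (T.finish_mem i)
  rcases T.dir_eq i with h | h
  · obtain ⟨t, ht, e⟩ := T.exists_pic_zero_eq (i := i) hε (right_mem_Icc.2 (by linarith))
    have := (T.strictMonoOn_pic i).monotoneOn ht (T.finish_mem i) ht.2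
    simp only [h, e] at this ⊢
    push_cast at this ⊢
    linarith [h1.2]
  · obtain ⟨t, ht, e⟩ := T.exists_pic_zero_eq (i := i) hε (left_mem_Icc.2 (by linarith))
    have := (T.strictMonoOn_pic i).monotoneOn ht (T.finish_mem i) ht.2
    simp only [h, e] at this ⊢
    push_cast at this ⊢
    linarith [h1.1]

theorem norm_pic_of_end (hε : ε ^ 2 = 1) (ht : t = T.start i ∨ t = T.finish i) :
    T.pic t 0 ^ 2 + T.pic t 1 ^ 2 = 1 := by
  have hm : t ∈ T.inside i := by
    rcases ht with rfl | rfl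
    exacts [T.start_mem i, T.finish_mem i]
  rw [T.pic_one hm]
  apply model_norm_end hε
  have := T.dir_sq i
  rcases ht with rfl | rfl
  · rw [T.pic_start_zero hε]; linear_combination modelEnd (T.model i) ^ 2 * this
  · rw [T.pic_finish_zero hε]; linear_combination modelEnd (T.model i) ^ 2 * this

theorem cross_ne_end (hε : ε ^ 2 = 1) (i j : Fin 3) :
    T.cross i j ≠ T.start i ∧ T.cross i j ≠ T.finish i := by
  have h := modelCross_mem hε (T.model i) (T.model j)
  rw [← T.pic_cross_zero hε] at h
  constructor <;> intro e <;> rw [e] at h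
  · rw [T.pic_start_zero hε] at h
    rcases T.dir_eq i with h' | h' <;> rw [h'] at h <;> push_cast at h <;> linarith [h.1, h.2]
  · rw [T.pic_finish_zero hε] at h
    rcases T.dir_eq i with h' | h' <;> rw [h'] at h <;> push_cast at h <;> linarith [h.1, h.2]

/-- In the chart each velocity is a multiple of `(1, slope)` whose factor has the sign `dir`, so the
determinant is the product of these factors and the difference of the slopes. -/
theorem sign_planeDet_cross (hε : ε ^ 2 = 1) (hij : i ≠ j) :
    (SignType.sign (planeDet (deriv k.path (T.cross i j)) (deriv k.path (T.cross j i))) : ℤ) =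
      T.dir i * T.dir j * modelSign (T.model i) (T.model j) := by
  have hp := T.path_cross hε hij
  have hi := T.cross_mem hε i j
  have hj := T.cross_mem hε j i
  have h1 := T.picVel_one hi
  have h2 := T.picVel_one hj
  rw [T.pic_cross_zero hε] at h1 h2
  rw [modelCross_comm] at h2
  rw [← T.chart.sign_planeDet_fderiv (T.chart.subset_source (T.path_mem hi))]
  change (SignType.sign (planeDet (T.picVel _) (fderiv ℝ T.chart.toHomeo (k.path (T.cross i j)) _)) : ℤ)
    = _
  rw [hp, ← picVel, ← sign_modelSlope hε (T.model.injective.ne hij)]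
  have hd : ∀ (i : Fin 3) (t : ℝ), t ∈ T.inside i → (SignType.sign (T.picVel t 0) : ℤ) = T.dir i := by
    intro i t ht
    have := T.dir_mul_picVel_pos ht
    rcases T.dir_eq i with h | h <;> rw [h] at this ⊢ <;> push_cast at this
    · rw [sign_pos (by linarith)]; rfl
    · rw [sign_neg (by linarith)]; rfl
  rw [← hd i _ hi, ← hd j _ hj, ← SignType.coe_mul, ← SignType.coe_mul, ← sign_mul, ← sign_mul]
  congr 2
  rw [planeDet, h1, h2]
  ring

/-- A permutation of three elements either commutes with the cyclic shift or inverts it. -/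
theorem model_add_sub (i : Fin 3) :
    (T.parity = 1 ∧ T.model (i + 1) = T.model i + 1 ∧ T.model (i - 1) = T.model i - 1) ∨
    (T.parity = -1 ∧ T.model (i + 1) = T.model i - 1 ∧ T.model (i - 1) = T.model i + 1) := by
  unfold parity
  generalize T.model = e
  revert e i
  decide

/-- The sign of an edge of the triangle, which for `ε = 1` tells whether its two orientations
coincide. -/
def edgeSign (i : Fin 3) : ℤ := T.dir i * T.parity * modelOrder (T.model i)

theorem edgeSign_eq (i : Fin 3) : T.edgeSign i = 1 ∨ T.edgeSign i = -1 := by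
  have h : ∀ m : Fin 3, modelOrder m = 1 ∨ modelOrder m = -1 := by decide
  have h' : T.parity = 1 ∨ T.parity = -1 := by unfold parity; split_ifs <;> simp
  unfold edgeSign
  rcases T.dir_eq i with h1 | h1 <;> rcases h' with h2 | h2 <;>
    rcases h (T.model i) with h3 | h3 <;> rw [h1, h2, h3] <;> simp

/-- Equality would force the value 0 for `modelOrder`, which is always a sign. -/
theorem cross_ne_cross (hε : ε ^ 2 = 1) (i : Fin 3) : T.cross i (i - 1) ≠ T.cross i (i + 1) := by
  intro h
  have e : modelCross ε (T.model i) (T.model i + 1) = modelCross ε (T.model i) (T.model i - 1) := by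
    have h0 : T.pic (T.cross i (i - 1)) 0 = T.pic (T.cross i (i + 1)) 0 := by rw [h]
    rw [T.pic_cross_zero hε, T.pic_cross_zero hε] at h0
    rcases T.model_add_sub i with ⟨-, h2, h3⟩ | ⟨-, h2, h3⟩ <;> rw [h2, h3] at h0
    exacts [h0.symm, h0]
  have key := sign_modelCross hε (T.model i)
  rw [e, sub_self, mul_zero, sign_zero] at key
  revert key
  generalize T.model i = n
  revert n; decide

/-- Three things can reverse the order seen in the standard picture: the direction of the strand,
the cyclic order in which the strands are numbered, and the move itself. -/
theorem cross_lt_cross_iff (hε : ε ^ 2 = 1) (i : Fin 3) :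
    T.cross i (i - 1) < T.cross i (i + 1) ↔
      0 < ε * T.edgeSign i := by
  rw [edgeSign]
  rw [← (T.strictMonoOn_pic i).lt_iff_lt (T.cross_mem hε _ _) (T.cross_mem hε _ _)]
  simp only [T.pic_cross_zero hε]
  have key := sign_modelCross hε (T.model i)
  rw [← key]
  clear key
  rcases T.model_add_sub i with ⟨h1, h2, h3⟩ | ⟨h1, h2, h3⟩ <;> rw [h1, h2, h3] <;>
    generalize modelCross ε (T.model i) (T.model i + 1) = x <;>
    generalize modelCross ε (T.model i) (T.model i - 1) = y <;>
    rcases T.dir_eq i with h | h <;> rw [h] <;>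
    rcases sq_eq_one_iff.1 hε with rfl | rfl <;>
    rcases lt_trichotomy x y with hxy | hxy | hxy <;>
    simp [sign_pos, sign_neg, hxy, hxy.not_gt]

/-- The parameters in `EdgeCoincides` are unique, because two strands cross only once in `C`. -/
theorem edgeCoincides_iff (hε : ε ^ 2 = 1) (i : Fin 3) :
    T.EdgeCoincides i ↔ T.cross i (i - 1) < T.cross i (i + 1) := by
  have n1 : i ≠ i - 1 := by revert i; decide
  have n2 : i ≠ i + 1 := by revert i; decide
  constructor
  · rintro ⟨s, hs, t, ht, hst, ⟨s', hs', e1⟩, ⟨t', ht', e2⟩⟩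
    rw [← ((T.path_eq_iff hε n1 hs hs').1 e1.symm).1, ← ((T.path_eq_iff hε n2 ht ht').1 e2.symm).1]
    exact hst
  · intro h
    exact ⟨_, T.cross_mem hε _ _, _, T.cross_mem hε _ _, h,
      ⟨_, T.cross_mem hε _ _, (T.path_cross hε n1).symm⟩,
      ⟨_, T.cross_mem hε _ _, (T.path_cross hε n2).symm⟩⟩

theorem cross_lt_cross_iff_not (hε : ε ^ 2 = 1) (i : Fin 3) :
    T.cross i (i + 1) < T.cross i (i - 1) ↔ ¬ 0 < ε * T.edgeSign i := by
  rw [← T.cross_lt_cross_iff hε, not_lt, (T.cross_ne_cross hε i).symm.le_iff_lt]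

end ThreeStrands

/-! ### The division of the circle into six regions -/

/-- The region of the `i`-th strand inside the changing disk. -/
def inRegion : Fin 3 → Fin 6 := ![0, 2, 4]

/-- The region of the `i`-th exterior strand. -/
def exRegion : Fin 3 → Fin 6 := ![1, 3, 5]

theorem inRegion_ne_exRegion (i j : Fin 3) : inRegion i ≠ exRegion j := by
  revert i j; decide

theorem inRegion_injective : Function.Injective inRegion := by decide

theorem exRegion_injective : Function.Injective exRegion := by decide

theorem eq_inRegion_or_exRegion (n : Fin 6) : (∃ i, n = inRegion i) ∨ ∃ i, n = exRegion i := by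
  revert n; decide

theorem CyclicLe.of_lt {α β : Type*} [LinearOrder α] [Preorder β] {f : α → β} (hf : Monotone f)
    {a b c d : α} (h : CyclicLt a b c d) : CyclicLe (f a) (f b) (f c) (f d) := by
  rcases h with h | h | h | h
  · exact Or.inl ⟨hf h.1.le, hf h.2.1.le, hf h.2.2.le⟩
  · exact Or.inr (Or.inl ⟨hf h.1.le, hf h.2.1.le, hf h.2.2.le⟩)
  · exact Or.inr (Or.inr (Or.inl ⟨hf h.1.le, hf h.2.1.le, hf h.2.2.le⟩))
  · exact Or.inr (Or.inr (Or.inr ⟨hf h.1.le, hf h.2.1.le, hf h.2.2.le⟩))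

/-- Applied to the map from parameters to the six regions, this reduces the position of arrows to
finite checks in `Fin 6`. -/
theorem cyclicLt_iff_of_monotone {α β : Type*} [LinearOrder α] [LinearOrder β] {f : α → β}
    (hf : Monotone f) {a b c d : α} (hab : f a ≠ f b) (hbc : f b ≠ f c) (hcd : f c ≠ f d)
    (hda : f d ≠ f a) : CyclicLt a b c d ↔ CyclicLt (f a) (f b) (f c) (f d) := by
  have key : ∀ {x y : α}, f x ≠ f y → (x < y ↔ f x < f y) := fun h =>
    ⟨fun h' => (hf h'.le).lt_of_ne h, fun h' => hf.reflect_lt h'⟩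
  unfold CyclicLt
  rw [key hab, key hbc, key hcd, key hda]

theorem isCyclicTriple_iff {α : Type*} {R : α → α → Prop} (hR : ∀ x, ¬ R x x) {x y z : α}
    (hxy : x ≠ y) (hyz : y ≠ z) (hxz : x ≠ z) :
    IsCyclicTriple R {x, y, z} ↔ (R x y ∧ R y z ∧ R z x) ∨ (R y x ∧ R x z ∧ R z y) := by
  constructor
  · rintro ⟨u, v, w, h, h1, h2, h3⟩
    have hx : x ∈ ({u, v, w} : Set α) := h ▸ by simp
    have hy : y ∈ ({u, v, w} : Set α) := h ▸ by simp
    have hz : z ∈ ({u, v, w} : Set α) := h ▸ by simp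
    simp only [mem_insert_iff, mem_singleton_iff] at hx hy hz
    have hR' := hR
    grind
  · rintro (⟨h1, h2, h3⟩ | ⟨h1, h2, h3⟩)
    · exact ⟨x, y, z, rfl, h1, h2, h3⟩
    · exact ⟨y, x, z, insert_comm _ _ _, h1, h2, h3⟩

theorem not_cyclicLt_self {α : Type*} [Preorder α] (a b : α) : ¬ CyclicLt a a b b := by
  rintro (h | h | h | h)
  exacts [lt_irrefl _ h.1, lt_irrefl _ h.2.1, lt_irrefl _ h.1, lt_irrefl _ h.2.1]

theorem ClosedCurves.not_follows_self (a : ℝ) (x : Pt Unit × Pt Unit) : ¬ Follows a x x :=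
  not_cyclicLt_self _ _

namespace ThreeStrands

variable {k : KnotDiagram} {C : Set Plane} {ε : ℝ} (T : ThreeStrands k C ε)

/-- The region of a parameter in `[T.start 0, T.start 0 + 1)`. -/
def region (t : ℝ) : Fin 6 :=
  if t ≤ T.finish 0 then 0 else if t < T.start 1 then 1 else if t ≤ T.finish 1 then 2 else
    if t < T.start 2 then 3 else if t ≤ T.finish 2 then 4 else 5

theorem region_monotone : Monotone T.region := by
  have h1 := T.finish_zero_lt
  have h2 := T.start_lt_finish 1
  have h3 := T.finish_one_lt
  have h4 := T.start_lt_finish 2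
  intro s t hst
  unfold region
  split_ifs <;> first | decide | (exfalso; linarith)

/-- The region of a point of the circle. -/
def reg (p : Pt Unit) : Fin 6 := T.region (rep (T.start 0) p)

variable {i j : Fin 3} {s t : ℝ}

theorem nextStart_eq (i : Fin 3) : T.nextStart i = if i = 2 then T.start 0 + 1 else T.start (i + 1) := by
  fin_cases i <;> rfl

theorem inside_subset (i : Fin 3) : T.inside i ⊆ Ico (T.start 0) (T.start 0 + 1) := by
  have h0 := T.start_lt_finish 0
  have h1 := T.finish_zero_lt
  have h2 := T.start_lt_finish 1
  have h3 := T.finish_one_lt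
  have h4 := T.start_lt_finish 2
  have h5 := T.finish_two_lt
  intro t ht
  have hl := ht.1
  have hr := ht.2
  constructor <;> fin_cases i <;> simp at hl hr <;> linarith

theorem exterior_subset (i : Fin 3) :
    Ioo (T.finish i) (T.nextStart i) ⊆ Ico (T.start 0) (T.start 0 + 1) := by
  have h0 := T.start_lt_finish 0
  have h1 := T.finish_zero_lt
  have h2 := T.start_lt_finish 1
  have h3 := T.finish_one_lt
  have h4 := T.start_lt_finish 2
  have h5 := T.finish_two_lt
  intro t ht
  have hl := ht.1
  have hr := ht.2
  constructor <;> fin_cases i <;> simp [nextStart] at hl hr <;> linarith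

theorem finish_lt_nextStart (i : Fin 3) : T.finish i < T.nextStart i := by
  fin_cases i
  exacts [T.finish_zero_lt, T.finish_one_lt, T.finish_two_lt]

theorem region_eq_inRegion_iff (ht : t ∈ Ico (T.start 0) (T.start 0 + 1)) :
    T.region t = inRegion i ↔ t ∈ T.inside i := by
  have h0 := T.start_lt_finish 0
  have h1 := T.finish_zero_lt
  have h2 := T.start_lt_finish 1
  have h3 := T.finish_one_lt
  have h4 := T.start_lt_finish 2
  obtain ⟨h5, h6⟩ := ht
  unfold region inside
  rw [mem_Icc]
  fin_cases i <;> simp only [inRegion] <;> split_ifs <;> simp <;> grind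

theorem region_eq_exRegion_iff (ht : t ∈ Ico (T.start 0) (T.start 0 + 1)) :
    T.region t = exRegion i ↔ t ∈ Ioo (T.finish i) (T.nextStart i) := by
  have h0 := T.start_lt_finish 0
  have h1 := T.finish_zero_lt
  have h2 := T.start_lt_finish 1
  have h3 := T.finish_one_lt
  have h4 := T.start_lt_finish 2
  obtain ⟨h5, h6⟩ := ht
  unfold region nextStart
  rw [mem_Ioo]
  fin_cases i <;> simp only [exRegion] <;> split_ifs <;> simp <;> grind

theorem reg_pt_inside (ht : t ∈ T.inside i) : T.reg (pt () t) = inRegion i := by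
  have := T.inside_subset i ht
  rw [reg, rep_pt () this, T.region_eq_inRegion_iff this]
  exact ht

theorem reg_pt_exterior (ht : t ∈ Ioo (T.finish i) (T.nextStart i)) :
    T.reg (pt () t) = exRegion i := by
  have := T.exterior_subset i ht
  rw [reg, rep_pt () this, T.region_eq_exRegion_iff this]
  exact ht

theorem exists_of_reg_eq_inRegion {p : Pt Unit} (h : T.reg p = inRegion i) :
    ∃ t ∈ T.inside i, p = pt () t :=
  ⟨_, (T.region_eq_inRegion_iff (rep_mem _ p)).1 h, (pt_rep_unit _ p).symm⟩

theorem exists_of_reg_eq_exRegion {p : Pt Unit} (h : T.reg p = exRegion i) :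
    ∃ t ∈ Ioo (T.finish i) (T.nextStart i), p = pt () t :=
  ⟨_, (T.region_eq_exRegion_iff (rep_mem _ p)).1 h, (pt_rep_unit _ p).symm⟩

theorem path_notMem (ht : t ∈ Ioo (T.finish i) (T.nextStart i)) : k.path t ∉ C :=
  T.notMem_exterior i t ht

/-! ### The arrows inside the changing disk -/

/-- The preimage on the strand `i` of the crossing of the strands `i` and `j`. -/
def crossPt (i j : Fin 3) : Pt Unit := pt () (T.cross i j)

/-- The arrow from the strand `i` to the strand `j`. -/
def arrow (i j : Fin 3) : Pt Unit × Pt Unit := (T.crossPt i j, T.crossPt j i)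

theorem reg_crossPt (hε : ε ^ 2 = 1) (i j : Fin 3) : T.reg (T.crossPt i j) = inRegion i :=
  T.reg_pt_inside (T.cross_mem hε i j)

theorem rep_crossPt (hε : ε ^ 2 = 1) (i j : Fin 3) : rep (T.start 0) (T.crossPt i j) = T.cross i j :=
  rep_pt () (T.inside_subset i (T.cross_mem hε i j))

theorem crosses_crossPt (hε : ε ^ 2 = 1) (hij : i ≠ j) :
    k.Crosses (T.crossPt i j) (T.crossPt j i) := by
  refine k.crosses_iff.2 ⟨fun h => ?_, T.path_cross hε hij⟩
  exact hij (inRegion_injective (by rw [← T.reg_crossPt hε i j, ← T.reg_crossPt hε j i, crossPt, h]; rfl))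

theorem arrow_mem_iff (hε : ε ^ 2 = 1) (hij : i ≠ j) :
    T.arrow i j ∈ k.gaussDiagram.arrows ↔ T.height j < T.height i := by
  rw [k.mem_arrows, ← T.over_iff_height i j hij _ (T.cross_mem hε i j) _ (T.cross_mem hε j i)
    (T.path_cross hε hij)]
  exact and_iff_right (T.crosses_crossPt hε hij)

/-- The two preimages of a crossing are both on inner strands or both on exterior strands, since
only the inner strands meet `C`. -/
theorem crosses_cases (hε : ε ^ 2 = 1) {p q : Pt Unit} (h : k.Crosses p q) :
    (∃ i j, i ≠ j ∧ p = T.crossPt i j ∧ q = T.crossPt j i) ∨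
      (∃ i, T.reg p = exRegion i) ∧ ∃ j, T.reg q = exRegion j := by
  rcases eq_inRegion_or_exRegion (T.reg p) with ⟨i, hi⟩ | ⟨i, hi⟩
  · obtain ⟨s, hs, rfl⟩ := T.exists_of_reg_eq_inRegion hi
    rcases eq_inRegion_or_exRegion (T.reg q) with ⟨j, hj⟩ | ⟨j, hj⟩
    · obtain ⟨t, ht, rfl⟩ := T.exists_of_reg_eq_inRegion hj
      obtain ⟨h1, h2⟩ := k.crosses_iff.1 h
      have hij : i ≠ j := by
        rintro rfl
        exact h1 (congrArg _ (T.injOn_path i hs ht h2))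
      obtain ⟨rfl, rfl⟩ := (T.path_eq_iff hε hij hs ht).1 h2
      exact Or.inl ⟨i, j, hij, rfl, rfl⟩
    · obtain ⟨t, ht, rfl⟩ := T.exists_of_reg_eq_exRegion hj
      exact absurd ((k.crosses_iff.1 h).2 ▸ T.path_mem hs) (T.path_notMem ht)
  · obtain ⟨s, hs, rfl⟩ := T.exists_of_reg_eq_exRegion hi
    rcases eq_inRegion_or_exRegion (T.reg q) with ⟨j, hj⟩ | ⟨j, hj⟩
    · obtain ⟨t, ht, rfl⟩ := T.exists_of_reg_eq_inRegion hj
      exact absurd ((k.crosses_iff.1 h).2.symm ▸ T.path_mem ht) (T.path_notMem hs)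
    · exact Or.inr ⟨⟨i, hi⟩, ⟨j, hj⟩⟩

/-- The number of the top strand. -/
def top : Fin 3 := T.height.symm 2

/-- The number of the middle strand. -/
def mid : Fin 3 := T.height.symm 1

/-- The number of the bottom strand. -/
def bot : Fin 3 := T.height.symm 0

theorem top_ne_mid : T.top ≠ T.mid := T.height.symm.injective.ne (by decide)

theorem mid_ne_bot : T.mid ≠ T.bot := T.height.symm.injective.ne (by decide)

theorem top_ne_bot : T.top ≠ T.bot := T.height.symm.injective.ne (by decide)

theorem arrow_top_mid_mem (hε : ε ^ 2 = 1) : T.arrow T.top T.mid ∈ k.gaussDiagram.arrows :=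
  (T.arrow_mem_iff hε T.top_ne_mid).2 (by simp [top, mid])

theorem arrow_mid_bot_mem (hε : ε ^ 2 = 1) : T.arrow T.mid T.bot ∈ k.gaussDiagram.arrows :=
  (T.arrow_mem_iff hε T.mid_ne_bot).2 (by simp [mid, bot])

theorem arrow_top_bot_mem (hε : ε ^ 2 = 1) : T.arrow T.top T.bot ∈ k.gaussDiagram.arrows :=
  (T.arrow_mem_iff hε T.top_ne_bot).2 (by simp [top, bot])

/-- The tail and the head of the arrow `x` are on the exterior strands. -/
def IsExterior (x : Pt Unit × Pt Unit) : Prop :=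
  (∃ i, T.reg x.1 = exRegion i) ∧ ∃ j, T.reg x.2 = exRegion j

theorem mem_arrows_cases (hε : ε ^ 2 = 1) {x : Pt Unit × Pt Unit}
    (hx : x ∈ k.gaussDiagram.arrows) : x = T.arrow T.top T.mid ∨ x = T.arrow T.mid T.bot ∨
      x = T.arrow T.top T.bot ∨ T.IsExterior x := by
  rcases T.crosses_cases hε ((k.mem_arrows x).1 hx).1 with ⟨i, j, hij, h1, h2⟩ | h
  · obtain rfl : x = T.arrow i j := Prod.ext h1 h2
    have h := (T.arrow_mem_iff hε hij).1 hx
    have key : ∀ a b : Fin 3, a < b →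
        b = 2 ∧ a = 1 ∨ b = 1 ∧ a = 0 ∨ b = 2 ∧ a = 0 := by decide
    simp only [top, mid, bot]
    rcases key _ _ h with ⟨h1, h2⟩ | ⟨h1, h2⟩ | ⟨h1, h2⟩ <;> rw [← h1, ← h2] <;> simp
  · exact Or.inr (Or.inr (Or.inr h))

theorem not_isExterior_arrow (hε : ε ^ 2 = 1) (i j : Fin 3) : ¬ T.IsExterior (T.arrow i j) := by
  rintro ⟨⟨a, h⟩, -⟩
  exact inRegion_ne_exRegion i a ((T.reg_crossPt hε i j).symm.trans h)

theorem arrow_injective (hε : ε ^ 2 = 1) {i j i' j' : Fin 3} (h : T.arrow i j = T.arrow i' j') :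
    i = i' ∧ j = j' := by
  have h1 := congrArg (fun x => T.reg x.1) h
  have h2 := congrArg (fun x => T.reg x.2) h
  simp only [arrow, T.reg_crossPt hε] at h1 h2
  exact ⟨inRegion_injective h1, inRegion_injective h2⟩

theorem follows_cyclicLe {x y : Pt Unit × Pt Unit} (h : Follows (T.start 0) x y) :
    CyclicLe (T.reg x.1) (T.reg y.1) (T.reg x.2) (T.reg y.2) :=
  CyclicLe.of_lt T.region_monotone h

theorem follows_iff {x y : Pt Unit × Pt Unit} (h₁ : T.reg x.1 ≠ T.reg y.1)
    (h₂ : T.reg y.1 ≠ T.reg x.2) (h₃ : T.reg x.2 ≠ T.reg y.2) (h₄ : T.reg y.2 ≠ T.reg x.1) :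
    Follows (T.start 0) x y ↔ CyclicLt (T.reg x.1) (T.reg y.1) (T.reg x.2) (T.reg y.2) :=
  cyclicLt_iff_of_monotone T.region_monotone h₁ h₂ h₃ h₄

/-- The arrow top→bottom has its tail next to that of top→middle and its head next to that of
middle→bottom. An exterior arrow has no end on the common strand that could separate them, but heads
and tails must alternate. -/
theorem not_follows_top_bot (hε : ε ^ 2 = 1) {x y z : Pt Unit × Pt Unit} (hz : T.IsExterior z)
    (h : (x = T.arrow T.top T.mid ∨ x = T.arrow T.mid T.bot) ∧ y = T.arrow T.top T.bot ∨
      (y = T.arrow T.top T.mid ∨ y = T.arrow T.mid T.bot) ∧ x = T.arrow T.top T.bot)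
    (hyz : Follows (T.start 0) y z) (hzx : Follows (T.start 0) z x) : False := by
  obtain ⟨⟨a, ha⟩, ⟨b, hb⟩⟩ := hz
  have h1 := T.follows_cyclicLe hyz
  have h2 := T.follows_cyclicLe hzx
  rw [ha, hb] at h1 h2
  -- The weak cyclic orders of the regions are already contradictory. The four clauses are the two
  -- possible partners of top→bottom, each in both orders.
  have key : ∀ t m b : Fin 3, t ≠ m → m ≠ b → t ≠ b → ∀ u v : Fin 3,
      (¬ (CyclicLe (inRegion t) (exRegion u) (inRegion b) (exRegion v) ∧
        CyclicLe (exRegion u) (inRegion t) (exRegion v) (inRegion m))) ∧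
      (¬ (CyclicLe (inRegion t) (exRegion u) (inRegion b) (exRegion v) ∧
        CyclicLe (exRegion u) (inRegion m) (exRegion v) (inRegion b))) ∧
      (¬ (CyclicLe (inRegion t) (exRegion u) (inRegion m) (exRegion v) ∧
        CyclicLe (exRegion u) (inRegion t) (exRegion v) (inRegion b))) ∧
      (¬ (CyclicLe (inRegion m) (exRegion u) (inRegion b) (exRegion v) ∧
        CyclicLe (exRegion u) (inRegion t) (exRegion v) (inRegion b))) := by decide
  obtain ⟨k1, k2, k3, k4⟩ := key T.top T.mid T.bot T.top_ne_mid T.mid_ne_bot T.top_ne_bot a b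
  rcases h with ⟨rfl | rfl, rfl⟩ | ⟨rfl | rfl, rfl⟩ <;>
    simp only [arrow, T.reg_crossPt hε] at h1 h2
  exacts [k1 ⟨h1, h2⟩, k2 ⟨h1, h2⟩, k3 ⟨h1, h2⟩, k4 ⟨h1, h2⟩]

/-- Two tails lie side by side on the top strand, so heads and tails do not alternate. -/
theorem not_isCyclicTriple_inside (hε : ε ^ 2 = 1) : ¬ IsCyclicTriple (Follows (T.start 0))
    {T.arrow T.top T.mid, T.arrow T.mid T.bot, T.arrow T.top T.bot} := by
  have key : ∀ t m b : Fin 3, t ≠ m → m ≠ b → t ≠ b →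
      ¬ (CyclicLe (inRegion t) (inRegion m) (inRegion m) (inRegion b) ∧
        CyclicLe (inRegion m) (inRegion t) (inRegion b) (inRegion b) ∧
        CyclicLe (inRegion t) (inRegion t) (inRegion b) (inRegion m)) := by decide
  have key' : ∀ t m b : Fin 3, t ≠ m → m ≠ b → t ≠ b →
      ¬ (CyclicLe (inRegion m) (inRegion t) (inRegion b) (inRegion m) ∧
        CyclicLe (inRegion t) (inRegion t) (inRegion m) (inRegion b) ∧
        CyclicLe (inRegion t) (inRegion m) (inRegion b) (inRegion b)) := by decide
  have k1 := key T.top T.mid T.bot T.top_ne_mid T.mid_ne_bot T.top_ne_bot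
  have k2 := key' T.top T.mid T.bot T.top_ne_mid T.mid_ne_bot T.top_ne_bot
  rw [isCyclicTriple_iff (not_follows_self _)
    (fun h => T.top_ne_mid (T.arrow_injective hε h).1)
    (fun h => T.top_ne_mid (T.arrow_injective hε h).1.symm)
    (fun h => T.mid_ne_bot (T.arrow_injective hε h).2)]
  rintro (⟨h1, h2, h3⟩ | ⟨h1, h2, h3⟩) <;>
    replace h1 := T.follows_cyclicLe h1 <;>
    replace h2 := T.follows_cyclicLe h2 <;>
    replace h3 := T.follows_cyclicLe h3 <;>
    simp only [arrow, T.reg_crossPt hε] at h1 h2 h3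
  exacts [k1 ⟨h1, h2, h3⟩, k2 ⟨h1, h2, h3⟩]

/-! ### Triples containing top→middle and middle→bottom -/

theorem cross_lt_cross (hε : ε ^ 2 = 1) {i j : Fin 3} (hij : i < j) (i' j' : Fin 3) :
    T.cross i i' < T.cross j j' := by
  refine T.region_monotone.reflect_lt ?_
  rw [(T.region_eq_inRegion_iff (T.inside_subset i (T.cross_mem hε i i'))).2 (T.cross_mem hε i i'),
    (T.region_eq_inRegion_iff (T.inside_subset j (T.cross_mem hε j j'))).2 (T.cross_mem hε j j')]
  revert i j; decide

/-- The two arrows share the strand `b`, so regions alone do not decide their relation: the order of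
the head and the tail on `b` enters. This is where the effect of the move becomes visible. -/
theorem follows_arrow_iff (hε : ε ^ 2 = 1) {a b c : Fin 3} (hab : a ≠ b) (hbc : b ≠ c)
    (hac : a ≠ c) :
    (Follows (T.start 0) (T.arrow a b) (T.arrow b c) ↔ c = b + 1 ∧ T.cross b c < T.cross b a) ∧
    (Follows (T.start 0) (T.arrow b c) (T.arrow a b) ↔ a = b + 1 ∧ T.cross b a < T.cross b c) := by
  unfold Follows
  simp only [arrow, T.rep_crossPt hε]
  have h01 := fun i j => T.cross_lt_cross hε (i := 0) (j := 1) (by decide) i j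
  have h12 := fun i j => T.cross_lt_cross hε (i := 1) (j := 2) (by decide) i j
  have h02 := fun i j => T.cross_lt_cross hε (i := 0) (j := 2) (by decide) i j
  have n01 := fun i j => (h01 i j).not_gt
  have n12 := fun i j => (h12 i j).not_gt
  have n02 := fun i j => (h02 i j).not_gt
  unfold CyclicLt
  fin_cases a <;> fin_cases b <;> fin_cases c <;>
    first
    | exact absurd rfl hab
    | exact absurd rfl hbc
    | exact absurd rfl hac
    | simp [h01, h12, h02, n01, n12, n02]

/-- The number of the exterior strand `a`. -/
def numA : Fin 3 := if T.top = T.mid + 1 then T.mid else T.top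

/-- The number of the exterior strand `b`. -/
def numB : Fin 3 := if T.bot = T.mid + 1 then T.mid else T.bot

theorem isNumberOf_a_iff : T.IsNumberOf .a i ↔ i = T.numA := by
  change ({T.height i, T.height (i + 1)} : Set (Fin 3)) = {2, 1} ↔ _
  rw [Set.pair_eq_pair_iff]
  unfold numA top mid
  generalize T.height = e
  revert e i
  decide

theorem isNumberOf_b_iff : T.IsNumberOf .b i ↔ i = T.numB := by
  change ({T.height i, T.height (i + 1)} : Set (Fin 3)) = {1, 0} ↔ _
  rw [Set.pair_eq_pair_iff]
  unfold numB bot mid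
  generalize T.height = e
  revert e i
  decide

theorem numA_ne_numB : T.numA ≠ T.numB := by
  unfold numA numB top bot mid
  generalize T.height = e
  revert e
  decide

/-- In a copy of `w₃` the third arrow must start and end in prescribed gaps between the other two,
and these gaps are the exterior strands `b` and `a`. The condition on the middle strand reads the
same whether the top or the bottom strand comes next after it. -/
theorem isCyclicTriple_iff_of_isExterior (hε : ε ^ 2 = 1) {x : Pt Unit × Pt Unit}
    (hx : T.IsExterior x) :
    IsCyclicTriple (Follows (T.start 0)) {T.arrow T.top T.mid, T.arrow T.mid T.bot, x} ↔
      (T.reg x.1 = exRegion T.numB ∧ T.reg x.2 = exRegion T.numA) ∧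
        T.cross T.mid (T.mid + 1) < T.cross T.mid (T.mid - 1) := by
  have hne : ∀ i j, T.arrow i j ≠ x := by
    rintro i j rfl; exact T.not_isExterior_arrow hε i j hx
  rw [isCyclicTriple_iff (not_follows_self _)
    (fun h => T.top_ne_mid (T.arrow_injective hε h).1) (hne _ _) (hne _ _)]
  obtain ⟨⟨u, hu⟩, ⟨v, hv⟩⟩ := hx
  obtain ⟨f1, f2⟩ := T.follows_arrow_iff hε T.top_ne_mid T.mid_ne_bot T.top_ne_bot
  have n1 : ∀ i j, inRegion i ≠ exRegion j := inRegion_ne_exRegion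
  have n2 : ∀ i j, exRegion i ≠ inRegion j := fun i j => (inRegion_ne_exRegion j i).symm
  have g1 : ∀ i j, Follows (T.start 0) (T.arrow i j) x ↔
      CyclicLt (inRegion i) (exRegion u) (inRegion j) (exRegion v) := by
    intro i j
    rw [T.follows_iff, hu, hv] <;> simp only [hu, hv, arrow, T.reg_crossPt hε] <;>
      first | exact n1 _ _ | exact n2 _ _
  have g2 : ∀ i j, Follows (T.start 0) x (T.arrow i j) ↔
      CyclicLt (exRegion u) (inRegion i) (exRegion v) (inRegion j) := by
    intro i j
    rw [T.follows_iff, hu, hv] <;> simp only [hu, hv, arrow, T.reg_crossPt hε] <;>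
      first | exact n1 _ _ | exact n2 _ _
  rw [f1, f2, g1, g1, g2, g2, hu, hv, exRegion_injective.eq_iff, exRegion_injective.eq_iff]
  -- The two alternatives are the two cyclic orders of top, middle and bottom along the knot; each
  -- admits only one orientation of the cycle of arrows.
  have key : ∀ t m b : Fin 3, t ≠ m → m ≠ b → t ≠ b → ∀ u v : Fin 3,
      (b = m + 1 ∧ t = m - 1 ∧ t ≠ m + 1 ∧
        (CyclicLt (inRegion m) (exRegion u) (inRegion b) (exRegion v) ∧
          CyclicLt (exRegion u) (inRegion t) (exRegion v) (inRegion m) ↔ u = m ∧ v = t)) ∨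
      (b = m - 1 ∧ t = m + 1 ∧ b ≠ m + 1 ∧
        (CyclicLt (inRegion t) (exRegion u) (inRegion m) (exRegion v) ∧
          CyclicLt (exRegion u) (inRegion m) (exRegion v) (inRegion b) ↔ u = b ∧ v = m)) := by
    decide
  unfold numA numB
  rcases key T.top T.mid T.bot T.top_ne_mid T.mid_ne_bot T.top_ne_bot u v with
    ⟨h1, h2, h3, h4⟩ | ⟨h1, h2, h3, h4⟩
  · rw [if_pos h1, if_neg h3, h4, ← h1, ← h2]
    simp only [T.top_ne_bot, false_and, or_false, true_and, and_comm]
  · rw [if_pos h2, if_neg h3, h4, ← h1, ← h2]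
    simp only [T.top_ne_bot.symm, false_and, false_or, true_and, and_comm]

end ThreeStrands

/-! ### Comparison of the two Gauss diagrams -/

namespace Omega3Move

variable {k l : KnotDiagram} {C : Set Plane} (m : Omega3Move k l C)

theorem one_sq : (1 : ℝ) ^ 2 = 1 := one_pow 2

theorem neg_one_sq' : (-1 : ℝ) ^ 2 = 1 := by norm_num

theorem φ_strictMono : StrictMono m.φ := strictMono_of_deriv_pos m.φ_deriv_pos

theorem φ_nextStart (i : Fin 3) : m.φ (m.before.nextStart i) = m.after.nextStart i := by
  rw [m.before.nextStart_eq, m.after.nextStart_eq]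
  split_ifs
  · rw [m.φ_add_one, m.φ_start]
  · rw [m.φ_start]

/-- The start of a strand is the end of the preceding exterior strand, where the diagrams agree; for
strand 0 this needs a shift by the period. -/
theorem path_start (i : Fin 3) : l.path (m.after.start i) = k.path (m.before.start i) := by
  have key : ∀ j, l.path (m.after.nextStart j) = k.path (m.before.nextStart j) := fun j => by
    rw [← m.φ_nextStart j, m.path_exterior j _ (right_mem_Icc.2 (m.before.finish_lt_nextStart j).le)]
  have h0 := key 2
  have h1 := key 0
  have h2 := key 1
  simp only [ThreeStrands.nextStart_eq] at h0 h1 h2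
  fin_cases i
  · simpa [KnotDiagram.path_add_one] using h0
  · simpa using h1
  · simpa using h2

/-- The direction can be read off from the starting point, which is on the boundary of `C`, where
the two charts agree. -/
theorem dir_eq (i : Fin 3) : m.after.dir i = m.before.dir i := by
  have hs := m.before.start_mem i
  have hb : m.before.pic (m.before.start i) ∉ Metric.ball (0 : Plane) 1 := by
    rw [plane_mem_ball, m.before.norm_pic_of_end one_sq (Or.inl rfl)]
    exact lt_irrefl _
  have e : m.after.pic (m.after.start i) = m.before.pic (m.before.start i) := by
    rw [ThreeStrands.pic, m.path_start, ThreeStrands.pic]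
    exact (m.chart_eq _ (m.before.chart.mem_frontier (m.before.path_mem hs) hb)).symm
  have h0 := congrArg (fun p : Plane => p 0) e
  simp only [m.after.pic_start_zero neg_one_sq', m.before.pic_start_zero one_sq, m.model_eq] at h0
  have hρ := (modelEnd_pos (m.before.model i)).ne'
  have := mul_right_cancel₀ hρ (neg_inj.1 h0)
  exact_mod_cast this

theorem parity_eq : m.after.parity = m.before.parity := by
  unfold ThreeStrands.parity; rw [m.model_eq]

theorem top_eq : m.after.top = m.before.top := by
  unfold ThreeStrands.top; rw [m.height_eq]

theorem mid_eq : m.after.mid = m.before.mid := by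
  unfold ThreeStrands.mid; rw [m.height_eq]

theorem bot_eq : m.after.bot = m.before.bot := by
  unfold ThreeStrands.bot; rw [m.height_eq]

theorem numA_eq : m.after.numA = m.before.numA := by
  unfold ThreeStrands.numA; rw [m.top_eq, m.mid_eq]

theorem numB_eq : m.after.numB = m.before.numB := by
  unfold ThreeStrands.numB; rw [m.bot_eq, m.mid_eq]

variable {i j : Fin 3} {s t : ℝ}

theorem path_φ (ht : t ∈ Ioo (m.before.finish i) (m.before.nextStart i)) :
    l.path (m.φ t) = k.path t := m.path_exterior i t (Ioo_subset_Icc_self ht)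

theorem φ_mem_iff :
    m.φ t ∈ Ioo (m.after.finish i) (m.after.nextStart i) ↔
      t ∈ Ioo (m.before.finish i) (m.before.nextStart i) := by
  rw [mem_Ioo, ← m.φ_finish, ← m.φ_nextStart, m.φ_strictMono.lt_iff_lt, m.φ_strictMono.lt_iff_lt]
  rfl

theorem exists_φ_eq (ht : t ∈ Ioo (m.after.finish i) (m.after.nextStart i)) :
    ∃ s ∈ Ioo (m.before.finish i) (m.before.nextStart i), m.φ s = t := by
  have h := intermediate_value_Ioo (m.before.finish_lt_nextStart i).le
    m.φ_smooth.continuous.continuousOn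
  rw [m.φ_finish, m.φ_nextStart] at h
  exact h ht

theorem deriv_path_eq (ht : t ∈ Ioo (m.before.finish i) (m.before.nextStart i)) :
    deriv k.path t = deriv m.φ t • deriv l.path (m.φ t) := by
  have h1 : HasDerivAt m.φ (deriv m.φ t) t :=
    (m.φ_smooth.differentiable (by simp) t).hasDerivAt
  have h2 := (l.hasDerivAt_path (m.φ t)).scomp t h1
  refine (h2.congr_of_eventuallyEq ?_).deriv
  filter_upwards [isOpen_Ioo.mem_nhds ht] with u hu
  exact (m.path_φ hu).symm

theorem sign_planeDet_eq (hs : s ∈ Ioo (m.before.finish i) (m.before.nextStart i))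
    (ht : t ∈ Ioo (m.before.finish j) (m.before.nextStart j)) :
    SignType.sign (planeDet (deriv l.path (m.φ s)) (deriv l.path (m.φ t))) =
      SignType.sign (planeDet (deriv k.path s) (deriv k.path t)) := by
  rw [m.deriv_path_eq hs, m.deriv_path_eq ht, planeDet_smul_smul, sign_mul,
    sign_pos (mul_pos (m.φ_deriv_pos s) (m.φ_deriv_pos t)), one_mul]

/-- The map of the circle that is induced by the reparametrization. -/
def ptMap (p : Pt Unit) : Pt Unit := pt () (m.φ (rep (m.before.start 0) p))

theorem rep_ptMap (p : Pt Unit) :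
    rep (m.after.start 0) (m.ptMap p) = m.φ (rep (m.before.start 0) p) := by
  have h := rep_mem (m.before.start 0) p
  refine rep_pt () ⟨?_, ?_⟩
  · rw [← m.φ_start]; exact m.φ_strictMono.monotone h.1
  · rw [← m.φ_start, ← m.φ_add_one]; exact m.φ_strictMono h.2

theorem ptMap_pt (ht : t ∈ Ioo (m.before.finish i) (m.before.nextStart i)) :
    m.ptMap (pt () t) = pt () (m.φ t) := by
  rw [ptMap, rep_pt () (m.before.exterior_subset i ht)]

theorem ptMap_injective : Function.Injective m.ptMap := fun p q h => by
  have := congrArg (rep (m.after.start 0)) h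
  rw [rep_ptMap, rep_ptMap] at this
  exact rep_injective _ (m.φ_strictMono.injective this)

theorem reg_ptMap {p : Pt Unit} (h : m.before.reg p = exRegion i) :
    m.after.reg (m.ptMap p) = exRegion i := by
  obtain ⟨t, ht, rfl⟩ := m.before.exists_of_reg_eq_exRegion h
  rw [m.ptMap_pt ht]
  exact m.after.reg_pt_exterior (m.φ_mem_iff.2 ht)

theorem exists_ptMap_eq {p : Pt Unit} (h : m.after.reg p = exRegion i) :
    ∃ q, m.before.reg q = exRegion i ∧ m.ptMap q = p := by
  obtain ⟨t, ht, rfl⟩ := m.after.exists_of_reg_eq_exRegion h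
  obtain ⟨s, hs, rfl⟩ := m.exists_φ_eq ht
  exact ⟨pt () s, m.before.reg_pt_exterior hs, m.ptMap_pt hs⟩

theorem ptMap_mem_arrows_iff {x : Pt Unit × Pt Unit} (hx : m.before.IsExterior x) :
    (m.ptMap x.1, m.ptMap x.2) ∈ l.gaussDiagram.arrows ↔ x ∈ k.gaussDiagram.arrows := by
  obtain ⟨p, q⟩ := x
  obtain ⟨⟨i, hi⟩, ⟨j, hj⟩⟩ := hx
  have hne : m.ptMap p ≠ m.ptMap q ↔ p ≠ q := m.ptMap_injective.ne_iff
  obtain ⟨s, hs, rfl⟩ := m.before.exists_of_reg_eq_exRegion hi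
  obtain ⟨t, ht, rfl⟩ := m.before.exists_of_reg_eq_exRegion hj
  rw [LinkDiagram.mem_arrows, LinkDiagram.mem_arrows]
  simp only [m.ptMap_pt hs, m.ptMap_pt ht] at hne ⊢
  rw [KnotDiagram.crosses_iff, KnotDiagram.crosses_iff, hne, m.path_φ hs, m.path_φ ht]
  exact and_congr_right fun _ => m.over_exterior i s (Ioo_subset_Icc_self hs)

theorem sign_ptMap {x : Pt Unit × Pt Unit} (hx : m.before.IsExterior x) :
    l.gaussDiagram.sign (m.ptMap x.1, m.ptMap x.2) = k.gaussDiagram.sign x := by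
  obtain ⟨p, q⟩ := x
  obtain ⟨⟨i, hi⟩, ⟨j, hj⟩⟩ := hx
  obtain ⟨s, hs, rfl⟩ := m.before.exists_of_reg_eq_exRegion hi
  obtain ⟨t, ht, rfl⟩ := m.before.exists_of_reg_eq_exRegion hj
  simp only [LinkDiagram.gaussDiagram, m.ptMap_pt hs, m.ptMap_pt ht, KnotDiagram.velocity_eq,
    m.sign_planeDet_eq hs ht]

theorem sign_arrow (hij : i ≠ j) :
    l.gaussDiagram.sign (m.after.arrow i j) = k.gaussDiagram.sign (m.before.arrow i j) := by
  simp only [LinkDiagram.gaussDiagram, ThreeStrands.arrow, ThreeStrands.crossPt,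
    KnotDiagram.velocity_eq]
  rw [m.after.sign_planeDet_cross neg_one_sq' hij, m.before.sign_planeDet_cross one_sq hij,
    m.dir_eq, m.dir_eq, m.model_eq]

open Classical in
/-- The bijection between the arrows of the two Gauss diagrams. -/
def arrowMap (x : Pt Unit × Pt Unit) : Pt Unit × Pt Unit :=
  if m.before.IsExterior x then (m.ptMap x.1, m.ptMap x.2) else
    if x = m.before.arrow m.before.top m.before.mid then
      m.after.arrow m.before.top m.before.mid else
    if x = m.before.arrow m.before.mid m.before.bot then
      m.after.arrow m.before.mid m.before.bot else m.after.arrow m.before.top m.before.bot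

theorem arrowMap_of_isExterior {x : Pt Unit × Pt Unit} (hx : m.before.IsExterior x) :
    m.arrowMap x = (m.ptMap x.1, m.ptMap x.2) := if_pos hx

theorem arrowMap_top_mid : m.arrowMap (m.before.arrow m.before.top m.before.mid) =
    m.after.arrow m.before.top m.before.mid := by
  rw [arrowMap, if_neg (m.before.not_isExterior_arrow one_sq _ _), if_pos rfl]

theorem arrowMap_mid_bot : m.arrowMap (m.before.arrow m.before.mid m.before.bot) =
    m.after.arrow m.before.mid m.before.bot := by
  rw [arrowMap, if_neg (m.before.not_isExterior_arrow one_sq _ _), if_neg, if_pos rfl]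
  exact fun h => m.before.top_ne_mid (m.before.arrow_injective one_sq h).1.symm

theorem arrowMap_top_bot : m.arrowMap (m.before.arrow m.before.top m.before.bot) =
    m.after.arrow m.before.top m.before.bot := by
  rw [arrowMap, if_neg (m.before.not_isExterior_arrow one_sq _ _), if_neg, if_neg]
  · exact fun h => m.before.top_ne_mid (m.before.arrow_injective one_sq h).1
  · exact fun h => m.before.mid_ne_bot (m.before.arrow_injective one_sq h).2.symm

theorem arrow_cases {x : Pt Unit × Pt Unit} (hx : x ∈ k.gaussDiagram.arrows) :
    (∃ i j, i ≠ j ∧ x = m.before.arrow i j ∧ m.arrowMap x = m.after.arrow i j) ∨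
      m.before.IsExterior x ∧ m.arrowMap x = (m.ptMap x.1, m.ptMap x.2) := by
  rcases m.before.mem_arrows_cases one_sq hx with rfl | rfl | rfl | h
  · exact Or.inl ⟨_, _, m.before.top_ne_mid, rfl, m.arrowMap_top_mid⟩
  · exact Or.inl ⟨_, _, m.before.mid_ne_bot, rfl, m.arrowMap_mid_bot⟩
  · exact Or.inl ⟨_, _, m.before.top_ne_bot, rfl, m.arrowMap_top_bot⟩
  · exact Or.inr ⟨h, m.arrowMap_of_isExterior h⟩

theorem reg_arrowMap {x : Pt Unit × Pt Unit} (hx : x ∈ k.gaussDiagram.arrows) :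
    m.after.reg (m.arrowMap x).1 = m.before.reg x.1 ∧
      m.after.reg (m.arrowMap x).2 = m.before.reg x.2 := by
  rcases m.arrow_cases hx with ⟨i, j, -, h1, h2⟩ | ⟨⟨⟨i, hi⟩, ⟨j, hj⟩⟩, h2⟩
  · rw [h2, h1]
    simp only [ThreeStrands.arrow, m.before.reg_crossPt one_sq, m.after.reg_crossPt neg_one_sq',
      and_self]
  · rw [h2, hi, hj]
    exact ⟨m.reg_ptMap hi, m.reg_ptMap hj⟩

theorem isExterior_arrowMap {x : Pt Unit × Pt Unit} (hx : x ∈ k.gaussDiagram.arrows) :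
    m.after.IsExterior (m.arrowMap x) ↔ m.before.IsExterior x := by
  unfold ThreeStrands.IsExterior
  rw [(m.reg_arrowMap hx).1, (m.reg_arrowMap hx).2]

theorem injOn_arrowMap : Set.InjOn m.arrowMap k.gaussDiagram.arrows := by
  intro x hx y hy h
  have e : m.before.IsExterior x ↔ m.before.IsExterior y := by
    rw [← m.isExterior_arrowMap hx, h, m.isExterior_arrowMap hy]
  rcases m.arrow_cases hx with ⟨i, j, -, h1, h2⟩ | ⟨h1, h2⟩ <;>
    rcases m.arrow_cases hy with ⟨i', j', -, h1', h2'⟩ | ⟨h1', h2'⟩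
  · rw [h2, h2'] at h
    obtain ⟨rfl, rfl⟩ := m.after.arrow_injective neg_one_sq' h
    rw [h1, h1']
  · exact absurd (h1 ▸ e.2 h1') (m.before.not_isExterior_arrow one_sq _ _)
  · exact absurd (h1' ▸ e.1 h1) (m.before.not_isExterior_arrow one_sq _ _)
  · rw [h2, h2', Prod.mk.injEq] at h
    exact Prod.ext (m.ptMap_injective h.1) (m.ptMap_injective h.2)

theorem arrows_eq [DecidableEq (Pt Unit × Pt Unit)] :
    l.gaussDiagram.arrows = k.gaussDiagram.arrows.image m.arrowMap := by
  ext y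
  rw [Finset.mem_image]
  constructor
  · intro hy
    rcases m.after.mem_arrows_cases neg_one_sq' hy with h | h | h | ⟨⟨i, hi⟩, ⟨j, hj⟩⟩
    · exact ⟨_, m.before.arrow_top_mid_mem one_sq,
        by rw [m.arrowMap_top_mid, h, m.top_eq, m.mid_eq]⟩
    · exact ⟨_, m.before.arrow_mid_bot_mem one_sq,
        by rw [m.arrowMap_mid_bot, h, m.mid_eq, m.bot_eq]⟩
    · exact ⟨_, m.before.arrow_top_bot_mem one_sq,
        by rw [m.arrowMap_top_bot, h, m.top_eq, m.bot_eq]⟩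
    · obtain ⟨p, hp, hp'⟩ := m.exists_ptMap_eq hi
      obtain ⟨q, hq, hq'⟩ := m.exists_ptMap_eq hj
      have hx : m.before.IsExterior (p, q) := ⟨⟨i, hp⟩, ⟨j, hq⟩⟩
      have e : (m.ptMap p, m.ptMap q) = y := Prod.ext hp' hq'
      exact ⟨(p, q), (m.ptMap_mem_arrows_iff hx).1 (e ▸ hy),
        (m.arrowMap_of_isExterior hx).trans e⟩
  · rintro ⟨x, hx, rfl⟩
    rcases m.arrow_cases hx with ⟨i, j, hij, h1, h2⟩ | ⟨h1, h2⟩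
    · rw [h2, m.after.arrow_mem_iff neg_one_sq' hij, m.height_eq,
        ← m.before.arrow_mem_iff one_sq hij, ← h1]
      exact hx
    · rw [h2, m.ptMap_mem_arrows_iff h1]
      exact hx

theorem sign_arrowMap {x : Pt Unit × Pt Unit} (hx : x ∈ k.gaussDiagram.arrows) :
    l.gaussDiagram.sign (m.arrowMap x) = k.gaussDiagram.sign x := by
  rcases m.arrow_cases hx with ⟨i, j, hij, h1, h2⟩ | ⟨h1, h2⟩
  · rw [h2, h1, m.sign_arrow hij]
  · rw [h2, m.sign_ptMap h1]

/-- For two exterior arrows the monotone map `φ` preserves the order. For an exterior and an inner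
arrow the regions decide, and these are preserved. Only pairs of inner arrows can change. -/
theorem follows_arrowMap {x y : Pt Unit × Pt Unit} (hx : x ∈ k.gaussDiagram.arrows)
    (hy : y ∈ k.gaussDiagram.arrows) (hxy : m.before.IsExterior x ∨ m.before.IsExterior y) :
    Follows (m.after.start 0) (m.arrowMap x) (m.arrowMap y) ↔ Follows (m.before.start 0) x y := by
  have n1 : ∀ i j, inRegion i ≠ exRegion j := inRegion_ne_exRegion
  have n2 : ∀ i j, exRegion i ≠ inRegion j := fun i j => (inRegion_ne_exRegion j i).symm
  have key : m.before.reg x.1 ≠ m.before.reg y.1 → m.before.reg y.1 ≠ m.before.reg x.2 →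
      m.before.reg x.2 ≠ m.before.reg y.2 → m.before.reg y.2 ≠ m.before.reg x.1 →
      (Follows (m.after.start 0) (m.arrowMap x) (m.arrowMap y) ↔
        Follows (m.before.start 0) x y) := by
    intro h1 h2 h3 h4
    rw [m.before.follows_iff h1 h2 h3 h4, m.after.follows_iff] <;>
      simp only [(m.reg_arrowMap hx).1, (m.reg_arrowMap hx).2, (m.reg_arrowMap hy).1,
        (m.reg_arrowMap hy).2] <;> assumption
  rcases m.arrow_cases hx with ⟨i, j, -, h1, h2⟩ | ⟨h1, h2⟩ <;>
    rcases m.arrow_cases hy with ⟨i', j', -, h1', h2'⟩ | ⟨h1', h2'⟩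
  · rcases hxy with h | h
    · exact absurd (h1 ▸ h) (m.before.not_isExterior_arrow one_sq _ _)
    · exact absurd (h1' ▸ h) (m.before.not_isExterior_arrow one_sq _ _)
  · obtain ⟨⟨u, hu⟩, ⟨v, hv⟩⟩ := h1'
    apply key <;>
      simp only [h1, hu, hv, ThreeStrands.arrow, m.before.reg_crossPt one_sq] <;>
      first | exact n1 _ _ | exact n2 _ _
  · obtain ⟨⟨u, hu⟩, ⟨v, hv⟩⟩ := h1
    apply key <;>
      simp only [h1', hu, hv, ThreeStrands.arrow, m.before.reg_crossPt one_sq] <;>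
      first | exact n1 _ _ | exact n2 _ _
  · rw [h2, h2']
    unfold Follows CyclicLt
    simp only [m.rep_ptMap, m.φ_strictMono.lt_iff_lt]

/-- If `x` and `y` were both inner, one of them would be top→bottom by `hS`, and `z` would be
exterior; `not_follows_top_bot` excludes this. -/
theorem isExterior_of_follows {ε : ℝ} {k : KnotDiagram} (T : ThreeStrands k C ε) (hε : ε ^ 2 = 1)
    {x y z : Pt Unit × Pt Unit} (hx : x ∈ k.gaussDiagram.arrows) (hy : y ∈ k.gaussDiagram.arrows)
    (hz : z ∈ k.gaussDiagram.arrows)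
    (hS : ¬ (T.arrow T.top T.mid ∈ ({x, y, z} : Set (Pt Unit × Pt Unit)) ∧
      T.arrow T.mid T.bot ∈ ({x, y, z} : Set (Pt Unit × Pt Unit))))
    (hxy : Follows (T.start 0) x y) (hyz : Follows (T.start 0) y z)
    (hzx : Follows (T.start 0) z x) : T.IsExterior x ∨ T.IsExterior y := by
  by_contra hcon
  rw [not_or] at hcon
  have nxy : x ≠ y := by rintro rfl; exact not_follows_self _ _ hxy
  have nyz : y ≠ z := by rintro rfl; exact not_follows_self _ _ hyz
  have nzx : z ≠ x := by rintro rfl; exact not_follows_self _ _ hzx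
  have hx' := T.mem_arrows_cases hε hx
  have hy' := T.mem_arrows_cases hε hy
  have hz' := T.mem_arrows_cases hε hz
  simp only [mem_insert_iff, mem_singleton_iff] at hS
  have hne : T.IsExterior z := by grind
  refine T.not_follows_top_bot hε hne (x := x) (y := y) ?_ hyz hzx
  grind

/-- Each of the three relations in such a triple involves an exterior arrow, hence survives the move
in both directions. -/
theorem isCyclicTriple_arrowMap_iff {S : Finset (Pt Unit × Pt Unit)}
    (hS : S ⊆ k.gaussDiagram.arrows)
    (h : ¬ (m.before.arrow m.before.top m.before.mid ∈ S ∧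
      m.before.arrow m.before.mid m.before.bot ∈ S)) :
    IsCyclicTriple (fun x y => Follows (m.after.start 0) (m.arrowMap x) (m.arrowMap y))
      (S : Set (Pt Unit × Pt Unit)) ↔
      IsCyclicTriple (Follows (m.before.start 0)) (S : Set (Pt Unit × Pt Unit)) := by
  have hmem : ∀ {x y z}, (S : Set (Pt Unit × Pt Unit)) = {x, y, z} →
      x ∈ k.gaussDiagram.arrows ∧ y ∈ k.gaussDiagram.arrows ∧ z ∈ k.gaussDiagram.arrows := by
    intro x y z e
    have hS' : ∀ w ∈ ({x, y, z} : Set (Pt Unit × Pt Unit)), w ∈ k.gaussDiagram.arrows :=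
      fun w hw => hS (by rw [← e] at hw; exact_mod_cast hw)
    exact ⟨hS' _ (by simp), hS' _ (by simp), hS' _ (by simp)⟩
  have hrot : ∀ x y z : Pt Unit × Pt Unit, ({x, y, z} : Set (Pt Unit × Pt Unit)) = {y, z, x} := by
    intro x y z; grind
  constructor
  · rintro ⟨x, y, z, e, h1, h2, h3⟩
    obtain ⟨hx, hy, hz⟩ := hmem e
    classical
    have hA : ∀ w ∈ k.gaussDiagram.arrows, m.arrowMap w ∈ l.gaussDiagram.arrows := fun w hw => by
      rw [m.arrows_eq]; exact Finset.mem_image_of_mem _ hw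
    have hSet : ¬ (m.after.arrow m.after.top m.after.mid ∈
          ({m.arrowMap x, m.arrowMap y, m.arrowMap z} : Set (Pt Unit × Pt Unit)) ∧
        m.after.arrow m.after.mid m.after.bot ∈
          ({m.arrowMap x, m.arrowMap y, m.arrowMap z} : Set (Pt Unit × Pt Unit))) := by
      rw [m.top_eq, m.mid_eq, m.bot_eq, ← m.arrowMap_top_mid, ← m.arrowMap_mid_bot]
      have hback : ∀ w ∈ k.gaussDiagram.arrows, m.arrowMap w ∈
          ({m.arrowMap x, m.arrowMap y, m.arrowMap z} : Set (Pt Unit × Pt Unit)) → w ∈ S := by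
        intro w hw hw'
        rw [← Finset.mem_coe, e]
        simpa only [mem_insert_iff, mem_singleton_iff, m.injOn_arrowMap.eq_iff hw hx,
          m.injOn_arrowMap.eq_iff hw hy, m.injOn_arrowMap.eq_iff hw hz] using hw'
      exact fun hc => h ⟨hback _ (m.before.arrow_top_mid_mem one_sq) hc.1,
        hback _ (m.before.arrow_mid_bot_mem one_sq) hc.2⟩
    have e1 := isExterior_of_follows m.after neg_one_sq' (hA x hx) (hA y hy) (hA z hz) hSet h1 h2 h3
    have e2 := isExterior_of_follows m.after neg_one_sq' (hA y hy) (hA z hz) (hA x hx)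
      (hrot _ _ _ ▸ hSet) h2 h3 h1
    have e3 := isExterior_of_follows m.after neg_one_sq' (hA z hz) (hA x hx) (hA y hy)
      (hrot _ _ _ ▸ hrot _ _ _ ▸ hSet) h3 h1 h2
    rw [m.isExterior_arrowMap hx, m.isExterior_arrowMap hy] at e1
    rw [m.isExterior_arrowMap hy, m.isExterior_arrowMap hz] at e2
    rw [m.isExterior_arrowMap hz, m.isExterior_arrowMap hx] at e3
    exact ⟨x, y, z, e, (m.follows_arrowMap hx hy e1).1 h1, (m.follows_arrowMap hy hz e2).1 h2,
      (m.follows_arrowMap hz hx e3).1 h3⟩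
  · rintro ⟨x, y, z, e, h1, h2, h3⟩
    obtain ⟨hx, hy, hz⟩ := hmem e
    have hSet : ¬ (m.before.arrow m.before.top m.before.mid ∈
          ({x, y, z} : Set (Pt Unit × Pt Unit)) ∧
        m.before.arrow m.before.mid m.before.bot ∈ ({x, y, z} : Set (Pt Unit × Pt Unit))) := by
      rw [← e]; exact_mod_cast h
    have e1 := isExterior_of_follows m.before one_sq hx hy hz hSet h1 h2 h3
    have e2 := isExterior_of_follows m.before one_sq hy hz hx (hrot _ _ _ ▸ hSet) h2 h3 h1
    have e3 := isExterior_of_follows m.before one_sq hz hx hy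
      (hrot _ _ _ ▸ hrot _ _ _ ▸ hSet) h3 h1 h2
    exact ⟨x, y, z, e, (m.follows_arrowMap hx hy e1).2 h1, (m.follows_arrowMap hy hz e2).2 h2,
      (m.follows_arrowMap hz hx e3).2 h3⟩

theorem isCyclicTriple_arrowMap_iff_image (x : Pt Unit × Pt Unit) (hx : x ∈ k.gaussDiagram.arrows)
    (h₁ : m.before.arrow m.before.top m.before.mid ≠ x)
    (h₂ : m.before.arrow m.before.mid m.before.bot ≠ x) :
    IsCyclicTriple (fun x y => Follows (m.after.start 0) (m.arrowMap x) (m.arrowMap y))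
      {m.before.arrow m.before.top m.before.mid, m.before.arrow m.before.mid m.before.bot, x} ↔
    IsCyclicTriple (Follows (m.after.start 0))
      {m.after.arrow m.after.top m.after.mid, m.after.arrow m.after.mid m.after.bot,
        m.arrowMap x} := by
  have h1 := m.before.arrow_top_mid_mem one_sq
  have h2 := m.before.arrow_mid_bot_mem one_sq
  have hne : m.before.arrow m.before.top m.before.mid ≠ m.before.arrow m.before.mid m.before.bot :=
    fun h => m.before.top_ne_mid (m.before.arrow_injective one_sq h).1
  rw [isCyclicTriple_iff (R := fun x y => Follows (m.after.start 0) (m.arrowMap x) (m.arrowMap y))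
    (fun _ => not_follows_self _ _) hne h₂ h₁, m.top_eq, m.mid_eq, m.bot_eq,
    ← m.arrowMap_top_mid, ← m.arrowMap_mid_bot, isCyclicTriple_iff (not_follows_self _)
    (m.injOn_arrowMap.ne h1 h2 hne) (m.injOn_arrowMap.ne h2 hx h₂) (m.injOn_arrowMap.ne h1 hx h₁)]

theorem edgeSign_eq (i : Fin 3) : m.after.edgeSign i = m.before.edgeSign i := by
  unfold ThreeStrands.edgeSign
  rw [m.dir_eq, m.parity_eq, m.model_eq]

theorem isCyclicTriple_before_iff {x : Pt Unit × Pt Unit} (hx : m.before.IsExterior x) :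
    IsCyclicTriple (Follows (m.before.start 0))
      {m.before.arrow m.before.top m.before.mid, m.before.arrow m.before.mid m.before.bot, x} ↔
    (m.before.reg x.1 = exRegion m.before.numB ∧ m.before.reg x.2 = exRegion m.before.numA) ∧
      m.before.edgeSign m.before.mid = -1 := by
  rw [m.before.isCyclicTriple_iff_of_isExterior one_sq hx, m.before.cross_lt_cross_iff_not one_sq]
  refine and_congr_right fun _ => ?_
  rcases m.before.edgeSign_eq m.before.mid with h | h <;> rw [h] <;> norm_num

theorem isCyclicTriple_after_iff {x : Pt Unit × Pt Unit} (hx : m.before.IsExterior x)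
    (hxA : x ∈ k.gaussDiagram.arrows) :
    IsCyclicTriple (fun x y => Follows (m.after.start 0) (m.arrowMap x) (m.arrowMap y))
      {m.before.arrow m.before.top m.before.mid, m.before.arrow m.before.mid m.before.bot, x} ↔
    (m.before.reg x.1 = exRegion m.before.numB ∧ m.before.reg x.2 = exRegion m.before.numA) ∧
      m.before.edgeSign m.before.mid = 1 := by
  have hne : ∀ i j, m.before.arrow i j ≠ x := by
    rintro i j rfl; exact m.before.not_isExterior_arrow one_sq i j hx
  rw [m.isCyclicTriple_arrowMap_iff_image x hxA (hne _ _) (hne _ _),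
    m.after.isCyclicTriple_iff_of_isExterior neg_one_sq' ((m.isExterior_arrowMap hxA).2 hx),
    m.after.cross_lt_cross_iff_not neg_one_sq', (m.reg_arrowMap hxA).1, (m.reg_arrowMap hxA).2,
    m.numA_eq, m.numB_eq, m.edgeSign_eq, m.mid_eq]
  refine and_congr_right fun _ => ?_
  rcases m.before.edgeSign_eq m.before.mid with h | h <;> rw [h] <;> norm_num

theorem not_isCyclicTriple_top_bot :
    ¬ IsCyclicTriple (fun x y => Follows (m.after.start 0) (m.arrowMap x) (m.arrowMap y))
      {m.before.arrow m.before.top m.before.mid, m.before.arrow m.before.mid m.before.bot,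
        m.before.arrow m.before.top m.before.bot} := by
  rw [m.isCyclicTriple_arrowMap_iff_image _ (m.before.arrow_top_bot_mem one_sq)
    (fun h => m.before.mid_ne_bot (m.before.arrow_injective one_sq h).2)
    (fun h => m.before.top_ne_mid (m.before.arrow_injective one_sq h).1.symm), m.arrowMap_top_bot,
    ← m.top_eq, ← m.bot_eq]
  exact m.after.not_isCyclicTriple_inside neg_one_sq'

open Classical in
/-- The arrows from the exterior strand `b` to the exterior strand `a`. -/
def exteriorArrows {ε : ℝ} (T : ThreeStrands k C ε) : Finset (Pt Unit × Pt Unit) :=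
  {x ∈ k.gaussDiagram.arrows | T.reg x.1 = exRegion T.numB ∧ T.reg x.2 = exRegion T.numA}

theorem mem_exteriorArrows {ε : ℝ} (T : ThreeStrands k C ε) (x : Pt Unit × Pt Unit) :
    x ∈ exteriorArrows T ↔ x ∈ k.gaussDiagram.arrows ∧
      T.reg x.1 = exRegion T.numB ∧ T.reg x.2 = exRegion T.numA := by
  simp [exteriorArrows]

/-- The edge sign of the middle strand tells on which side of the move the triples with an arrow
from `b` to `a` are cyclic, and so plays the role of `c` in `cyclicTripleSum_sub`. -/
theorem weirdness_sub : l.weirdness - k.weirdness = m.before.edgeSign m.before.mid *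
    (k.gaussDiagram.sign (m.before.arrow m.before.top m.before.mid) *
      k.gaussDiagram.sign (m.before.arrow m.before.mid m.before.bot)) *
    ∑ x ∈ exteriorArrows m.before, k.gaussDiagram.sign x := by
  classical
  have hext : ∀ x ∈ exteriorArrows m.before, m.before.IsExterior x := fun x hx =>
    ⟨⟨_, ((mem_exteriorArrows _ _).1 hx).2.1⟩, ⟨_, ((mem_exteriorArrows _ _).1 hx).2.2⟩⟩
  unfold KnotDiagram.weirdness
  rw [l.gaussDiagram.w3_eq (m.after.start 0), k.gaussDiagram.w3_eq (m.before.start 0), m.arrows_eq,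
    cyclicTripleSum_image m.injOn_arrowMap]
  have hsign : cyclicTripleSum k.gaussDiagram.arrows
      (fun x y => Follows (m.after.start 0) (m.arrowMap x) (m.arrowMap y))
      (fun x => l.gaussDiagram.sign (m.arrowMap x)) = cyclicTripleSum k.gaussDiagram.arrows
      (fun x y => Follows (m.after.start 0) (m.arrowMap x) (m.arrowMap y)) k.gaussDiagram.sign := by
    refine Finset.sum_congr rfl fun S hS => Finset.prod_congr rfl fun x hx => m.sign_arrowMap ?_
    exact Finset.mem_powerset.1 (Finset.mem_filter.1 hS).1 hx
  rw [hsign]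
  refine cyclicTripleSum_sub _ (m.before.arrow_top_mid_mem one_sq)
    (m.before.arrow_mid_bot_mem one_sq)
    (fun h => m.before.top_ne_mid (m.before.arrow_injective one_sq h).1) (not_follows_self _)
    (fun _ => not_follows_self _ _) (fun S hS h => m.isCyclicTriple_arrowMap_iff hS h)
    (Finset.filter_subset _ _) (fun h => m.before.not_isExterior_arrow one_sq _ _ (hext _ h))
    (fun h => m.before.not_isExterior_arrow one_sq _ _ (hext _ h)) (fun x hx => ?_)
    fun x hx hxB => ?_
  · have hx' := (mem_exteriorArrows _ _).1 hx
    rw [m.isCyclicTriple_after_iff (hext x hx) hx'.1, m.isCyclicTriple_before_iff (hext x hx)]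
    rcases m.before.edgeSign_eq m.before.mid with h | h <;> rw [h] <;> simp [hx'.2]
  -- If `x` is one of the two distinguished arrows, the set has fewer than three elements and cannot
  -- be a cyclic triple.
  · have key : ∀ {Q : Pt Unit × Pt Unit → Pt Unit × Pt Unit → Prop} {e e' : Pt Unit × Pt Unit},
        (∀ w, ¬ Q w w) → (x = e ∨ x = e') → ¬ IsCyclicTriple Q {e, e', x} := by
      rintro Q e e' hQ h ⟨u, v, w, hS, h1, h2, h3⟩
      have n1 : u ≠ v := by rintro rfl; exact hQ _ h1
      have n2 : v ≠ w := by rintro rfl; exact hQ _ h2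
      have n3 : w ≠ u := by rintro rfl; exact hQ _ h3
      have hu : u ∈ ({e, e', x} : Set (Pt Unit × Pt Unit)) := hS ▸ by simp
      have hv : v ∈ ({e, e', x} : Set (Pt Unit × Pt Unit)) := hS ▸ by simp
      have hw : w ∈ ({e, e', x} : Set (Pt Unit × Pt Unit)) := hS ▸ by simp
      simp only [mem_insert_iff, mem_singleton_iff] at hu hv hw
      grind
    rcases m.before.mem_arrows_cases one_sq hx with h | h | h | h
    · exact ⟨key (fun _ => not_follows_self _ _) (Or.inl h),
        key (not_follows_self _) (Or.inl h)⟩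
    · exact ⟨key (fun _ => not_follows_self _ _) (Or.inr h),
        key (not_follows_self _) (Or.inr h)⟩
    · rw [h]
      exact ⟨m.not_isCyclicTriple_top_bot, m.before.not_isCyclicTriple_inside one_sq⟩
    · have h' := fun h => hxB ((mem_exteriorArrows _ _).2 ⟨hx, h⟩)
      rw [m.isCyclicTriple_after_iff h hx, m.isCyclicTriple_before_iff h]
      exact ⟨fun hc => h' hc.1, fun hc => h' hc.1⟩

/-! ### Signs of edges and crossings for a positive move -/

theorem prod_edgeSign_of_isPositive (hm : m.IsPositive) : ∏ i, m.before.edgeSign i = 1 := by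
  classical
  have hq := hm.1
  -- With three edges, the three minus signs give `q = -∏ edgeSign` before the move.
  have h : ∀ i, (if m.before.EdgeCoincides i then (-1 : ℤ) else 1) = -m.before.edgeSign i := by
    intro i
    rw [m.before.edgeCoincides_iff one_sq, m.before.cross_lt_cross_iff one_sq]
    rcases m.before.edgeSign_eq i with h | h <;> rw [h] <;> norm_num
  have e : m.before.q = ∏ i, (if m.before.EdgeCoincides i then (-1 : ℤ) else 1) := by
    unfold ThreeStrands.q
    rw [Finset.prod_ite, Finset.prod_const, Finset.prod_const_one, mul_one]
  rw [e, Finset.prod_congr rfl fun i _ => h i, Fin.prod_univ_three] at hq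
  rw [Fin.prod_univ_three]
  linarith

/-- In terms of directions, parity and the standard picture, the left side contains the direction of
the middle strand three times and the other two once. Since signs square to 1, it equals the product
of all edge signs. -/
theorem edgeSign_mul_sign (hm : m.IsPositive) : m.before.edgeSign m.before.mid *
    (k.gaussDiagram.sign (m.before.arrow m.before.top m.before.mid) *
      k.gaussDiagram.sign (m.before.arrow m.before.mid m.before.bot)) = 1 := by
  have hprod := m.prod_edgeSign_of_isPositive hm
  have hs : ∀ {i j}, i ≠ j → k.gaussDiagram.sign (m.before.arrow i j) =
      m.before.dir i * m.before.dir j * modelSign (m.before.model i) (m.before.model j) := by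
    intro i j hij
    rw [← m.before.sign_planeDet_cross one_sq hij]
    simp only [LinkDiagram.gaussDiagram, ThreeStrands.arrow, ThreeStrands.crossPt,
      KnotDiagram.velocity_eq]
  rw [hs m.before.top_ne_mid, hs m.before.mid_ne_bot]
  have hperm : ∀ f : Fin 3 → ℤ, f m.before.top * f m.before.mid * f m.before.bot = ∏ i, f i := by
    intro f
    rw [← Equiv.prod_comp m.before.height.symm f, Fin.prod_univ_three, ThreeStrands.top,
      ThreeStrands.mid, ThreeStrands.bot]
    ring
  have horder : ∀ e : Equiv.Perm (Fin 3), ∏ i, modelOrder (e i) = 1 := by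
    intro e
    rw [Equiv.prod_comp e modelOrder]
    decide
  have hpar : m.before.parity * m.before.parity = 1 := by
    unfold ThreeStrands.parity; split_ifs <;> rfl
  have hmid : m.before.dir m.before.mid * m.before.dir m.before.mid = 1 := by
    rcases m.before.dir_eq m.before.mid with h | h <;> rw [h] <;> rfl
  -- The contribution of the standard picture is 1 whichever of its strands are top, middle and
  -- bottom.
  have hmodel : ∀ a b c : Fin 3, a ≠ b → b ≠ c → a ≠ c →
      modelOrder b * (modelSign a b * modelSign b c) = 1 := by decide
  have hmodel' := hmodel _ _ _ (m.before.model.injective.ne m.before.top_ne_mid)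
    (m.before.model.injective.ne m.before.mid_ne_bot)
    (m.before.model.injective.ne m.before.top_ne_bot)
  have hd := hperm m.before.dir
  have ho := horder m.before.model
  simp only [ThreeStrands.edgeSign] at hprod ⊢
  rw [Finset.prod_mul_distrib, Finset.prod_mul_distrib, ho, ← hd, Fin.prod_univ_three] at hprod
  generalize m.before.dir m.before.top = dt at *
  generalize m.before.dir m.before.bot = db at *
  generalize m.before.dir m.before.mid = dm at *
  generalize m.before.parity = p at *
  linear_combination dt * dm * db * p * dm ^ 2 * hmodel' + dt * dm * db * p * hmid -
    dt * dm * db * p * hpar + hprod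

theorem weirdness_sub_of_isPositive (hm : m.IsPositive) :
    l.weirdness - k.weirdness = ∑ x ∈ exteriorArrows m.before, k.gaussDiagram.sign x := by
  rw [m.weirdness_sub, m.edgeSign_mul_sign hm, one_mul]

end Omega3Move

/-! ### The exterior strands and the local link -/

theorem ClosedCurves.crosses_pt_iff {ι : Type} (L : ClosedCurves ι) {c d : ι} {u v : ℝ} :
    L.Crosses (pt c u) (pt d v) ↔ pt c u ≠ pt d v ∧ L.curve c u = L.curve d v := by
  rw [Crosses, eval_pt, eval_pt]

namespace ThreeStrands

variable {k : KnotDiagram} {C : Set Plane} {ε : ℝ} (T : ThreeStrands k C ε)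
variable {i j : Fin 3} {s t u v : ℝ}

theorem path_nextStart (i : Fin 3) : k.path (T.nextStart i) = k.path (T.start (i + 1)) := by
  rw [T.nextStart_eq]
  split_ifs with h
  · subst h; exact k.path_add_one _
  · rfl

theorem path_start_ne_path_finish (hε : ε ^ 2 = 1) (i j : Fin 3) :
    k.path (T.start i) ≠ k.path (T.finish j) := by
  intro h
  by_cases hij : i = j
  · subst hij
    exact (T.start_lt_finish i).ne (T.injOn_path i (T.start_mem i) (T.finish_mem i) h)
  · exact (T.cross_ne_end hε i j).1 ((T.path_eq_iff hε hij (T.start_mem i) (T.finish_mem j)).1 h).1.symm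

theorem path_start_injective (hε : ε ^ 2 = 1) : Function.Injective fun i => k.path (T.start i) := by
  intro i j h
  by_contra hij
  exact (T.cross_ne_end hε i j).1 ((T.path_eq_iff hε hij (T.start_mem i) (T.start_mem j)).1 h).1.symm

theorem path_finish_injective (hε : ε ^ 2 = 1) :
    Function.Injective fun i => k.path (T.finish i) := by
  intro i j h
  by_contra hij
  exact (T.cross_ne_end hε i j).2
    ((T.path_eq_iff hε hij (T.finish_mem i) (T.finish_mem j)).1 h).1.symm

theorem end_notMem_interior (hε : ε ^ 2 = 1) (ht : t = T.start i ∨ t = T.finish i) :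
    k.path t ∉ interior C := by
  intro h
  have h' := (T.chart.mem_interior_iff (interior_subset h)).1 h
  rw [plane_mem_ball] at h'
  exact h'.ne (T.norm_pic_of_end hε ht)

theorem exterior_cases (ht : t ∈ Icc (T.finish i) (T.nextStart i)) :
    t ∈ Ioo (T.finish i) (T.nextStart i) ∨ t = T.finish i ∨ t = T.nextStart i := by
  rcases eq_or_lt_of_le ht.1 with h | h
  · exact Or.inr (Or.inl h.symm)
  · rcases eq_or_lt_of_le ht.2 with h' | h'
    · exact Or.inr (Or.inr h')
    · exact Or.inl ⟨h, h'⟩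

theorem exterior_notMem_interior (hε : ε ^ 2 = 1) (ht : t ∈ Icc (T.finish i) (T.nextStart i)) :
    k.path t ∉ interior C := by
  rcases T.exterior_cases ht with h | rfl | rfl
  · exact fun h' => T.path_notMem h (interior_subset h')
  · exact T.end_notMem_interior hε (Or.inr rfl)
  · rw [T.path_nextStart]
    exact T.end_notMem_interior hε (Or.inl rfl)

/-- The ends of exterior strands lie in `C`, their open parts do not, and the six ends are distinct
points. So exterior strands never cross at their ends. -/
theorem exterior_path_eq (hε : ε ^ 2 = 1) (hs : s ∈ Icc (T.finish i) (T.nextStart i))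
    (ht : t ∈ Icc (T.finish j) (T.nextStart j)) (h : k.path s = k.path t) :
    (s ∈ Ioo (T.finish i) (T.nextStart i) ∧ t ∈ Ioo (T.finish j) (T.nextStart j)) ∨
      i = j ∧ s = t := by
  have hf : ∀ i, k.path (T.finish i) ∈ C := fun i => T.path_mem (T.finish_mem i)
  have hn : ∀ i, k.path (T.nextStart i) ∈ C := fun i => by
    rw [T.path_nextStart]; exact T.path_mem (T.start_mem _)
  rcases T.exterior_cases hs with hs | rfl | rfl <;> rcases T.exterior_cases ht with ht | rfl | rfl
  · exact Or.inl ⟨hs, ht⟩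
  · exact absurd (h ▸ hf _) (T.path_notMem hs)
  · exact absurd (h ▸ hn _) (T.path_notMem hs)
  · exact absurd (h ▸ hf _) (T.path_notMem ht)
  · obtain rfl := T.path_finish_injective hε h
    exact Or.inr ⟨rfl, rfl⟩
  · rw [T.path_nextStart] at h
    exact absurd h.symm (T.path_start_ne_path_finish hε _ _)
  · exact absurd (h ▸ hn _) (T.path_notMem ht)
  · rw [T.path_nextStart] at h
    exact absurd h (T.path_start_ne_path_finish hε _ _)
  · rw [T.path_nextStart, T.path_nextStart] at h
    obtain rfl := add_right_cancel (T.path_start_injective hε h)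
    exact Or.inr ⟨rfl, rfl⟩

/-- The number of an exterior strand. -/
def num : ExteriorStrand → Fin 3
  | .a => T.numA
  | .b => T.numB

theorem isNumberOf_iff {c : ExteriorStrand} : T.IsNumberOf c i ↔ i = T.num c := by
  cases c
  exacts [T.isNumberOf_a_iff, T.isNumberOf_b_iff]

theorem num_injective : Function.Injective T.num := by
  intro c d h
  cases c <;> cases d
  exacts [rfl, absurd h T.numA_ne_numB, absurd h.symm T.numA_ne_numB, rfl]

theorem exteriorParam_eq (i : Fin 3) (u : ℝ) :
    T.exteriorParam i u = T.finish i + 2 * (T.nextStart i - T.finish i) * u := by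
  rw [exteriorParam, AffineMap.lineMap_apply_ring']; ring

theorem exteriorParam_strictMono (i : Fin 3) : StrictMono (T.exteriorParam i) := by
  intro u v huv
  rw [exteriorParam_eq, exteriorParam_eq]
  have := T.finish_lt_nextStart i
  nlinarith

theorem exteriorParam_zero (i : Fin 3) : T.exteriorParam i 0 = T.finish i := by
  rw [exteriorParam_eq]; ring

theorem exteriorParam_half (i : Fin 3) : T.exteriorParam i (1 / 2) = T.nextStart i := by
  rw [exteriorParam_eq]; ring

theorem exteriorParam_mem_Icc (hu : u ∈ Icc (0 : ℝ) (1 / 2)) :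
    T.exteriorParam i u ∈ Icc (T.finish i) (T.nextStart i) := by
  rw [← T.exteriorParam_zero, ← T.exteriorParam_half]
  exact ⟨(T.exteriorParam_strictMono i).monotone hu.1, (T.exteriorParam_strictMono i).monotone hu.2⟩

theorem exteriorParam_mem_Ioo_iff :
    T.exteriorParam i u ∈ Ioo (T.finish i) (T.nextStart i) ↔ u ∈ Ioo (0 : ℝ) (1 / 2) := by
  rw [← T.exteriorParam_zero, ← T.exteriorParam_half, mem_Ioo,
    (T.exteriorParam_strictMono i).lt_iff_lt, (T.exteriorParam_strictMono i).lt_iff_lt, mem_Ioo]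

theorem exists_exteriorParam_eq (ht : t ∈ Ioo (T.finish i) (T.nextStart i)) :
    ∃ u ∈ Ioo (0 : ℝ) (1 / 2), T.exteriorParam i u = t := by
  have h := T.finish_lt_nextStart i
  have e : T.exteriorParam i ((t - T.finish i) / (2 * (T.nextStart i - T.finish i))) = t := by
    rw [exteriorParam_eq]
    have : T.nextStart i - T.finish i ≠ 0 := by linarith
    field_simp
    ring
  exact ⟨_, T.exteriorParam_mem_Ioo_iff.1 (e.symm ▸ ht), e⟩

theorem hasDerivAt_exteriorParam (i : Fin 3) (u : ℝ) :
    HasDerivAt (T.exteriorParam i) (2 * (T.nextStart i - T.finish i)) u := by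
  have h : HasDerivAt (fun u : ℝ => T.finish i + 2 * (T.nextStart i - T.finish i) * u)
      (2 * (T.nextStart i - T.finish i)) u := by
    simpa using ((hasDerivAt_id u).const_mul (2 * (T.nextStart i - T.finish i))).const_add
      (T.finish i)
  exact h.congr_of_eventuallyEq (Filter.Eventually.of_forall fun v => T.exteriorParam_eq i v)

theorem hasDerivAt_path_exteriorParam (i : Fin 3) (u : ℝ) :
    HasDerivAt (fun u => k.path (T.exteriorParam i u))
      ((2 * (T.nextStart i - T.finish i)) • deriv k.path (T.exteriorParam i u)) u :=
  (k.hasDerivAt_path _).scomp u (T.hasDerivAt_exteriorParam i u)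

theorem pt_exteriorParam_eq_iff (hu : u ∈ Ioo (0 : ℝ) (1 / 2)) (hv : v ∈ Ioo (0 : ℝ) (1 / 2)) :
    pt () (T.exteriorParam i u) = pt () (T.exteriorParam j v) ↔ i = j ∧ u = v := by
  constructor
  · intro h
    have h' := congrArg T.reg h
    rw [T.reg_pt_exterior (T.exteriorParam_mem_Ioo_iff.2 hu),
      T.reg_pt_exterior (T.exteriorParam_mem_Ioo_iff.2 hv)] at h'
    obtain rfl := exRegion_injective h'
    rw [pt_eq_iff_of_mem (T.exterior_subset i (T.exteriorParam_mem_Ioo_iff.2 hu))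
      (T.exterior_subset i (T.exteriorParam_mem_Ioo_iff.2 hv))] at h
    exact ⟨rfl, (T.exteriorParam_strictMono i).injective h.2⟩
  · rintro ⟨rfl, rfl⟩; rfl

/-! ### The linking number of a local link -/

theorem IsLocalLink.curve_eq {L : LinkDiagram ExteriorStrand} (hL : T.IsLocalLink L)
    (c : ExteriorStrand) (hu : u ∈ Icc (0 : ℝ) (1 / 2)) :
    L.curve c u = k.path (T.exteriorParam (T.num c) u) :=
  hL.exterior c _ (T.isNumberOf_iff.2 rfl) u hu

theorem IsLocalLink.velocity_eq {L : LinkDiagram ExteriorStrand} (hL : T.IsLocalLink L)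
    (c : ExteriorStrand) (hu : u ∈ Ioo (0 : ℝ) (1 / 2)) :
    L.velocity (pt c u) = (2 * (T.nextStart (T.num c) - T.finish (T.num c))) •
      deriv k.path (T.exteriorParam (T.num c) u) := by
  rw [velocity_pt]
  refine ((T.hasDerivAt_path_exteriorParam (T.num c) u).congr_of_eventuallyEq ?_).deriv
  filter_upwards [isOpen_Ioo.mem_nhds hu] with v hv
  exact hL.curve_eq T c (Ioo_subset_Icc_self hv)

theorem IsLocalLink.crosses_iff {L : LinkDiagram ExteriorStrand} (hL : T.IsLocalLink L)
    {c d : ExteriorStrand} (hu : u ∈ Ioo (0 : ℝ) (1 / 2)) (hv : v ∈ Ioo (0 : ℝ) (1 / 2)) :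
    L.Crosses (pt c u) (pt d v) ↔ k.Crosses (pt () (T.exteriorParam (T.num c) u))
      (pt () (T.exteriorParam (T.num d) v)) := by
  rw [crosses_pt_iff, k.crosses_iff, hL.curve_eq T c (Ioo_subset_Icc_self hu),
    hL.curve_eq T d (Ioo_subset_Icc_self hv)]
  refine and_congr_left fun _ => not_congr ?_
  rw [T.pt_exteriorParam_eq_iff hu hv, T.num_injective.eq_iff]
  refine pt_eq_iff_of_mem (a := 0) ?_ ?_ <;> constructor <;> linarith [hu.1, hu.2, hv.1, hv.2]

/-- A closing strand cannot meet an exterior one, because the interior of `C` separates them;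
crossings of the two closing strands are excluded by `closing_not_over`. -/
theorem IsLocalLink.exists_of_mem_arrows {L : LinkDiagram ExteriorStrand} (hε : ε ^ 2 = 1)
    (hL : T.IsLocalLink L) {x : Pt ExteriorStrand × Pt ExteriorStrand}
    (hx : x ∈ L.gaussDiagram.arrows) (hb : x.1.1 = .b) (ha : x.2.1 = .a) :
    ∃ u ∈ Ioo (0 : ℝ) (1 / 2), ∃ v ∈ Ioo (0 : ℝ) (1 / 2), x = (pt .b u, pt .a v) := by
  obtain ⟨p, q⟩ := x
  obtain ⟨hc, ho⟩ := (L.mem_arrows _).1 hx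
  dsimp only at hb ha hc ho
  have hu := rep_mem 0 p
  have hv := rep_mem 0 q
  have ep := pt_rep 0 p
  have eq := pt_rep 0 q
  rw [hb] at ep
  rw [ha] at eq
  generalize rep 0 p = u at *
  generalize rep 0 q = v at *
  subst ep eq
  rw [zero_add] at hu hv
  have hcur := (L.crosses_pt_iff.1 hc).2
  rcases le_or_gt u (1 / 2) with h1 | h1 <;> rcases le_or_gt v (1 / 2) with h2 | h2
  · have h3 : u ∈ Icc (0 : ℝ) (1 / 2) := ⟨hu.1, h1⟩
    have h4 : v ∈ Icc (0 : ℝ) (1 / 2) := ⟨hv.1, h2⟩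
    rw [hL.curve_eq T _ h3, hL.curve_eq T _ h4] at hcur
    rcases T.exterior_path_eq hε (T.exteriorParam_mem_Icc h3) (T.exteriorParam_mem_Icc h4) hcur with
      ⟨h5, h6⟩ | ⟨h5, -⟩
    · exact ⟨u, T.exteriorParam_mem_Ioo_iff.1 h5, v, T.exteriorParam_mem_Ioo_iff.1 h6, rfl⟩
    · exact absurd (T.num_injective h5) (by simp)
  · have h3 : u ∈ Icc (0 : ℝ) (1 / 2) := ⟨hu.1, h1⟩
    rw [hL.curve_eq T _ h3] at hcur
    exact absurd (hcur ▸ hL.closing .a v ⟨h2, hv.2⟩)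
      (T.exterior_notMem_interior hε (T.exteriorParam_mem_Icc h3))
  · have h4 : v ∈ Icc (0 : ℝ) (1 / 2) := ⟨hv.1, h2⟩
    rw [hL.curve_eq T _ h4] at hcur
    exact absurd (hcur ▸ hL.closing .b u ⟨h1, hu.2⟩)
      (T.exterior_notMem_interior hε (T.exteriorParam_mem_Icc h4))
  · exact absurd ho (hL.closing_not_over u ⟨h1, hu.2⟩ v ⟨h2, hv.2⟩ hcur)

theorem IsLocalLink.mem_arrows_iff {L : LinkDiagram ExteriorStrand} (hL : T.IsLocalLink L)
    {c d : ExteriorStrand} (hu : u ∈ Ioo (0 : ℝ) (1 / 2)) (hv : v ∈ Ioo (0 : ℝ) (1 / 2)) :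
    (pt c u, pt d v) ∈ L.gaussDiagram.arrows ↔ (pt () (T.exteriorParam (T.num c) u),
      pt () (T.exteriorParam (T.num d) v)) ∈ k.gaussDiagram.arrows := by
  rw [LinkDiagram.mem_arrows, LinkDiagram.mem_arrows, ← hL.crosses_iff T hu hv]
  refine and_congr_right fun h => ?_
  exact hL.over_exterior c _ (T.isNumberOf_iff.2 rfl) u (Ioo_subset_Icc_self hu) ⟨_, h⟩

theorem IsLocalLink.sign_eq {L : LinkDiagram ExteriorStrand} (hL : T.IsLocalLink L)
    {c d : ExteriorStrand} (hu : u ∈ Ioo (0 : ℝ) (1 / 2)) (hv : v ∈ Ioo (0 : ℝ) (1 / 2)) :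
    L.gaussDiagram.sign (pt c u, pt d v) = k.gaussDiagram.sign
      (pt () (T.exteriorParam (T.num c) u), pt () (T.exteriorParam (T.num d) v)) := by
  have h1 := T.finish_lt_nextStart (T.num c)
  have h2 := T.finish_lt_nextStart (T.num d)
  simp only [LinkDiagram.gaussDiagram, hL.velocity_eq T c hu, hL.velocity_eq T d hv,
    KnotDiagram.velocity_eq]
  rw [planeDet_smul_smul, sign_mul, sign_pos (mul_pos (by linarith) (by linarith)), one_mul]

theorem IsLocalLink.linkingNumber_eq {L : LinkDiagram ExteriorStrand} (hε : ε ^ 2 = 1)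
    (hL : T.IsLocalLink L) : L.linkingNumber .b .a =
      ∑ x ∈ Omega3Move.exteriorArrows T, k.gaussDiagram.sign x := by
  classical
  unfold LinkDiagram.linkingNumber
  refine Finset.sum_bij (fun x _ => (pt () (T.exteriorParam T.numB (rep 0 x.1)),
    pt () (T.exteriorParam T.numA (rep 0 x.2)))) ?_ ?_ ?_ ?_
  all_goals
    have hrep : ∀ (c : ExteriorStrand) {u : ℝ}, u ∈ Ioo (0 : ℝ) (1 / 2) → rep 0 (pt c u) = u :=
      fun c u hu => rep_pt c ⟨hu.1.le, by linarith [hu.2]⟩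
  · intro x hx
    obtain ⟨hx, hb, ha⟩ := Finset.mem_filter.1 hx
    obtain ⟨u, hu, v, hv, rfl⟩ := hL.exists_of_mem_arrows T hε hx hb ha
    rw [Omega3Move.mem_exteriorArrows]
    dsimp only
    rw [hrep _ hu, hrep _ hv]
    exact ⟨(hL.mem_arrows_iff T (c := .b) (d := .a) hu hv).1 hx,
      T.reg_pt_exterior (T.exteriorParam_mem_Ioo_iff.2 hu),
      T.reg_pt_exterior (T.exteriorParam_mem_Ioo_iff.2 hv)⟩
  · intro x hx y hy h
    obtain ⟨hx, hb, ha⟩ := Finset.mem_filter.1 hx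
    obtain ⟨u, hu, v, hv, rfl⟩ := hL.exists_of_mem_arrows T hε hx hb ha
    obtain ⟨hy, hb', ha'⟩ := Finset.mem_filter.1 hy
    obtain ⟨u', hu', v', hv', rfl⟩ := hL.exists_of_mem_arrows T hε hy hb' ha'
    dsimp only at h
    rw [hrep _ hu, hrep _ hv, hrep _ hu', hrep _ hv', Prod.mk.injEq,
      T.pt_exteriorParam_eq_iff hu hu', T.pt_exteriorParam_eq_iff hv hv'] at h
    rw [h.1.2, h.2.2]
  · intro y hy
    obtain ⟨hy, h1, h2⟩ := (Omega3Move.mem_exteriorArrows _ _).1 hy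
    obtain ⟨p, q⟩ := y
    obtain ⟨s, hs, rfl⟩ := T.exists_of_reg_eq_exRegion h1
    obtain ⟨t, ht, rfl⟩ := T.exists_of_reg_eq_exRegion h2
    obtain ⟨u, hu, rfl⟩ := T.exists_exteriorParam_eq hs
    obtain ⟨v, hv, rfl⟩ := T.exists_exteriorParam_eq ht
    refine ⟨(pt .b u, pt .a v), Finset.mem_filter.2
      ⟨(hL.mem_arrows_iff T (c := .b) (d := .a) hu hv).2 hy, rfl, rfl⟩, ?_⟩
    dsimp only
    rw [hrep _ hu, hrep _ hv]
  · intro x hx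
    obtain ⟨hx, hb, ha⟩ := Finset.mem_filter.1 hx
    obtain ⟨u, hu, v, hv, rfl⟩ := hL.exists_of_mem_arrows T hε hx hb ha
    dsimp only
    rw [hrep _ hu, hrep _ hv]
    exact hL.sign_eq T (c := .b) (d := .a) hu hv

end ThreeStrands

/-! ### Chords of the unit circle -/

theorem lineMap_plane_apply (p q : Plane) (w : ℝ) (i : Fin 2) :
    (AffineMap.lineMap p q w : Plane) i = p i + w * (q i - p i) := by
  simp [AffineMap.lineMap_apply]; ring

/-- The deficit `w * (1 - w) * |q - p| ^ 2` is positive strictly between the ends, so chords run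
inside the open disk. -/
theorem chord_norm {p q : Plane} (hp : p 0 ^ 2 + p 1 ^ 2 = 1) (hq : q 0 ^ 2 + q 1 ^ 2 = 1) (w : ℝ) :
    (AffineMap.lineMap p q w : Plane) 0 ^ 2 + (AffineMap.lineMap p q w : Plane) 1 ^ 2 =
      1 - w * (1 - w) * ((q 0 - p 0) ^ 2 + (q 1 - p 1) ^ 2) := by
  rw [lineMap_plane_apply, lineMap_plane_apply]
  linear_combination (1 - w) * hp + w * hq

theorem plane_dist_pos {p q : Plane} (h : p ≠ q) : 0 < (q 0 - p 0) ^ 2 + (q 1 - p 1) ^ 2 := by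
  by_contra hcon
  have h0 : (q 0 - p 0) ^ 2 = 0 := by nlinarith [sq_nonneg (q 0 - p 0), sq_nonneg (q 1 - p 1)]
  have h1 : (q 1 - p 1) ^ 2 = 0 := by nlinarith [sq_nonneg (q 0 - p 0), sq_nonneg (q 1 - p 1)]
  exact h (plane_ext (by linarith [pow_eq_zero_iff (two_ne_zero) |>.1 h0])
    (by linarith [pow_eq_zero_iff (two_ne_zero) |>.1 h1]))

theorem chord_mem_closedBall {p q : Plane} (hp : p 0 ^ 2 + p 1 ^ 2 = 1)
    (hq : q 0 ^ 2 + q 1 ^ 2 = 1) {w : ℝ} (hw : w ∈ Icc (0 : ℝ) 1) :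
    (AffineMap.lineMap p q w : Plane) ∈ Metric.closedBall (0 : Plane) 1 := by
  rw [plane_mem_closedBall, chord_norm hp hq]
  have : 0 ≤ w * (1 - w) := mul_nonneg hw.1 (by linarith [hw.2])
  nlinarith [sq_nonneg (q 0 - p 0), sq_nonneg (q 1 - p 1)]

theorem chord_mem_ball {p q : Plane} (hp : p 0 ^ 2 + p 1 ^ 2 = 1)
    (hq : q 0 ^ 2 + q 1 ^ 2 = 1) (hpq : p ≠ q) {w : ℝ} (hw : w ∈ Ioo (0 : ℝ) 1) :
    (AffineMap.lineMap p q w : Plane) ∈ Metric.ball (0 : Plane) 1 := by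
  rw [plane_mem_ball, chord_norm hp hq]
  have := mul_pos (mul_pos hw.1 (by linarith [hw.2] : 0 < 1 - w)) (plane_dist_pos hpq)
  linarith

/-- If the chords meet and are parallel, `p'` is on the line through `p` and `q`. This line meets
the circle only in `p` and `q`. -/
theorem planeDet_chords_ne_zero {p q p' q' : Plane} (hp : p 0 ^ 2 + p 1 ^ 2 = 1)
    (hq : q 0 ^ 2 + q 1 ^ 2 = 1) (hp' : p' 0 ^ 2 + p' 1 ^ 2 = 1) (hpq : p ≠ q) (h₁ : p' ≠ p)
    (h₂ : p' ≠ q) {s t : ℝ} (h : (AffineMap.lineMap p q s : Plane) = AffineMap.lineMap p' q' t) :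
    planeDet (q - p) (q' - p') ≠ 0 := by
  intro hdet
  have hD := plane_dist_pos hpq
  have e0 := congrArg (fun x : Plane => x 0) h
  have e1 := congrArg (fun x : Plane => x 1) h
  simp only [lineMap_plane_apply] at e0 e1
  simp only [planeDet, PiLp.sub_apply] at hdet
  set D := (q 0 - p 0) ^ 2 + (q 1 - p 1) ^ 2 with hDdef
  -- The coefficient of the orthogonal projection of `q' - p'` to `q - p`; for parallel vectors it
  -- is the factor of proportionality.
  obtain ⟨c, hc⟩ : ∃ c, c = ((q 0 - p 0) * (q' 0 - p' 0) + (q 1 - p 1) * (q' 1 - p' 1)) / D :=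
    ⟨_, rfl⟩
  have hcD : c * D = (q 0 - p 0) * (q' 0 - p' 0) + (q 1 - p 1) * (q' 1 - p' 1) := by
    rw [hc]; field_simp
  have c0 : q' 0 - p' 0 = c * (q 0 - p 0) := by
    apply mul_right_cancel₀ hD.ne'
    rw [mul_right_comm, hcD, hDdef]
    linear_combination (-(q 1 - p 1)) * hdet
  have c1 : q' 1 - p' 1 = c * (q 1 - p 1) := by
    apply mul_right_cancel₀ hD.ne'
    rw [mul_right_comm, hcD, hDdef]
    linear_combination (q 0 - p 0) * hdet
  rw [c0] at e0
  rw [c1] at e1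
  obtain ⟨r, hr⟩ : ∃ r, r = s - t * c := ⟨_, rfl⟩
  have f0 : p' 0 = p 0 + r * (q 0 - p 0) := by rw [hr]; linear_combination -e0
  have f1 : p' 1 = p 1 + r * (q 1 - p 1) := by rw [hr]; linear_combination -e1
  have hn : r * (1 - r) * D = 0 := by
    rw [f0, f1] at hp'
    rw [hDdef]
    linear_combination (1 - r) * hp + r * hq - hp'
  rcases mul_eq_zero.1 hn with hn | hn
  · rcases mul_eq_zero.1 hn with hn | hn
    · exact h₁ (plane_ext (by rw [f0, hn]; ring) (by rw [f1, hn]; ring))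
    · have : r = 1 := by linarith
      exact h₂ (plane_ext (by rw [f0, this]; ring) (by rw [f1, this]; ring))
  · exact hD.ne' hn

theorem chords_meet_unique {p q p' q' : Plane} (hdet : planeDet (q - p) (q' - p') ≠ 0)
    {s t s' t' : ℝ} (h : (AffineMap.lineMap p q s : Plane) = AffineMap.lineMap p' q' t)
    (h' : (AffineMap.lineMap p q s' : Plane) = AffineMap.lineMap p' q' t') : s = s' ∧ t = t' := by
  have e0 := congrArg (fun x : Plane => x 0) h
  have e1 := congrArg (fun x : Plane => x 1) h
  have f0 := congrArg (fun x : Plane => x 0) h'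
  have f1 := congrArg (fun x : Plane => x 1) h'
  simp only [lineMap_plane_apply] at e0 e1 f0 f1
  simp only [planeDet, PiLp.sub_apply] at hdet
  have k1 : (s - s') * ((q 0 - p 0) * (q' 1 - p' 1) - (q 1 - p 1) * (q' 0 - p' 0)) = 0 := by
    linear_combination (q' 1 - p' 1) * (e0 - f0) - (q' 0 - p' 0) * (e1 - f1)
  have k2 : (t - t') * ((q 0 - p 0) * (q' 1 - p' 1) - (q 1 - p 1) * (q' 0 - p' 0)) = 0 := by
    linear_combination (q 1 - p 1) * (e0 - f0) - (q 0 - p 0) * (e1 - f1)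
  exact ⟨sub_eq_zero.1 ((mul_eq_zero.1 k1).resolve_right hdet),
    sub_eq_zero.1 ((mul_eq_zero.1 k2).resolve_right hdet)⟩

/-! ### Closed curves that consist of two pieces -/

/-- The closed curve that consists of the restrictions of `g₁` and `g₂` to `[0, 1/2]` and
`[1/2, 1]`. -/
def glue (g₁ g₂ : ℝ → Plane) (t : ℝ) : Plane :=
  if Int.fract t ≤ 1 / 2 then g₁ (Int.fract t) else g₂ (Int.fract t)

theorem glue_periodic (g₁ g₂ : ℝ → Plane) : Function.Periodic (glue g₁ g₂) 1 := by
  intro t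
  unfold glue
  rw [Int.fract_add_one]

theorem glue_left (g₁ g₂ : ℝ → Plane) {t : ℝ} {n : ℤ} (ht : t ∈ Icc (n : ℝ) (n + 1 / 2)) :
    glue g₁ g₂ t = g₁ (t - n) := by
  have e : Int.fract t = t - n := by
    rw [Int.fract_eq_iff]
    exact ⟨by linarith [ht.1], by linarith [ht.2], n, by ring⟩
  rw [glue, e, if_pos (by linarith [ht.2])]

/-- By definition `glue` takes the value of `g₁` at both junctions, so the closed second interval
needs the matching conditions. -/
theorem glue_right {g₁ g₂ : ℝ → Plane} (h : g₁ (1 / 2) = g₂ (1 / 2)) (h' : g₂ 1 = g₁ 0) {t : ℝ}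
    {n : ℤ} (ht : t ∈ Icc ((n : ℝ) + 1 / 2) (n + 1)) : glue g₁ g₂ t = g₂ (t - n) := by
  rcases eq_or_lt_of_le ht.1 with h1 | h1
  · rw [glue_left g₁ g₂ (n := n) ⟨by linarith, by linarith⟩, ← h1, add_sub_cancel_left, h]
  · rcases eq_or_lt_of_le ht.2 with h2 | h2
    · rw [glue_left g₁ g₂ (n := n + 1) ⟨by push_cast; linarith, by push_cast; linarith⟩, h2]
      push_cast
      rw [sub_self, add_sub_cancel_left, h']
    · have e : Int.fract t = t - n := by
        rw [Int.fract_eq_iff]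
        exact ⟨by linarith, by linarith, n, by ring⟩
      rw [glue, e, if_neg (by linarith)]

/-- On each side of any parameter, a short interval lies in one smooth piece; this yields one-sided
regularity also at the corners. -/
theorem exists_pieces (t : ℝ) : ∃ δ > 0,
    ((∃ n : ℤ, Icc (t - δ) t ⊆ Icc (n : ℝ) (n + 1 / 2)) ∨
      ∃ n : ℤ, Icc (t - δ) t ⊆ Icc ((n : ℝ) + 1 / 2) (n + 1)) ∧
    ((∃ n : ℤ, Icc t (t + δ) ⊆ Icc (n : ℝ) (n + 1 / 2)) ∨
      ∃ n : ℤ, Icc t (t + δ) ⊆ Icc ((n : ℝ) + 1 / 2) (n + 1)) := by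
  have h0 := Int.floor_le t
  have h1 := Int.lt_floor_add_one t
  set n := ⌊t⌋
  rcases eq_or_lt_of_le h0 with h | h
  · refine ⟨1 / 2, by norm_num, Or.inr ⟨n - 1, Icc_subset_Icc ?_ ?_⟩,
      Or.inl ⟨n, Icc_subset_Icc ?_ ?_⟩⟩ <;> push_cast <;> linarith
  · rcases lt_trichotomy t (n + 1 / 2) with h2 | h2 | h2
    · refine ⟨min (t - n) (n + 1 / 2 - t), lt_min (by linarith) (by linarith),
        Or.inl ⟨n, Icc_subset_Icc ?_ ?_⟩, Or.inl ⟨n, Icc_subset_Icc ?_ ?_⟩⟩ <;>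
        linarith [min_le_left (t - n) (n + 1 / 2 - t), min_le_right (t - n) (n + 1 / 2 - t)]
    · refine ⟨1 / 2, by norm_num, Or.inl ⟨n, Icc_subset_Icc ?_ ?_⟩,
        Or.inr ⟨n, Icc_subset_Icc ?_ ?_⟩⟩ <;> linarith
    · refine ⟨min (t - (n + 1 / 2)) (n + 1 - t), lt_min (by linarith) (by linarith),
        Or.inr ⟨n, Icc_subset_Icc ?_ ?_⟩, Or.inr ⟨n, Icc_subset_Icc ?_ ?_⟩⟩ <;>
        linarith [min_le_left (t - (n + 1 / 2)) (n + 1 - t),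
          min_le_right (t - (n + 1 / 2)) (n + 1 - t)]

theorem ClosedCurves.regularOn_of_eqOn {ι : Type} {L : ClosedCurves ι} {i : ι} {s t : ℝ}
    (hst : s < t) {g : ℝ → Plane} (h : EqOn (L.curve i) g (Icc s t))
    (hg : ∀ u ∈ Icc s t, ContDiffAt ℝ ∞ g u ∧ deriv g u ≠ 0) : L.RegularOn i s t := by
  constructor
  · exact ContDiffOn.congr (fun u hu => (hg u hu).1.contDiffWithinAt) h
  · intro u hu
    rw [derivWithin_congr h (h hu),
      ((hg u hu).1.differentiableAt (by simp)).derivWithin (uniqueDiffOn_Icc hst u hu)]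
    exact (hg u hu).2

theorem ClosedCurves.piecewise_regular_of_glue {ι : Type} {L : ClosedCurves ι} {i : ι}
    {g₁ g₂ : ℝ → Plane} (hL : L.curve i = glue g₁ g₂) (h : g₁ (1 / 2) = g₂ (1 / 2))
    (h' : g₂ 1 = g₁ 0) (hg₁ : ∀ u ∈ Icc (0 : ℝ) (1 / 2), ContDiffAt ℝ ∞ g₁ u ∧ deriv g₁ u ≠ 0)
    (hg₂ : ∀ u ∈ Icc (1 / 2 : ℝ) 1, ContDiffAt ℝ ∞ g₂ u ∧ deriv g₂ u ≠ 0) (t : ℝ) :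
    ∃ δ > 0, L.RegularOn i (t - δ) t ∧ L.RegularOn i t (t + δ) := by
  have hshift : ∀ (g : ℝ → Plane) (n : ℤ) (u : ℝ), ContDiffAt ℝ ∞ g (u - n) ∧ deriv g (u - n) ≠ 0 →
      ContDiffAt ℝ ∞ (fun u => g (u - n)) u ∧ deriv (fun u => g (u - n)) u ≠ 0 := by
    intro g n u hu
    rw [deriv_comp_sub_const]
    exact ⟨hu.1.comp u (contDiffAt_id.sub contDiffAt_const), hu.2⟩
  have key : ∀ a b : ℝ, a < b → ((∃ n : ℤ, Icc a b ⊆ Icc (n : ℝ) (n + 1 / 2)) ∨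
      ∃ n : ℤ, Icc a b ⊆ Icc ((n : ℝ) + 1 / 2) (n + 1)) → L.RegularOn i a b := by
    rintro a b hab (⟨n, hn⟩ | ⟨n, hn⟩)
    · refine regularOn_of_eqOn hab (g := fun u => g₁ (u - n)) (fun u hu => ?_) fun u hu => ?_
      · rw [hL]; exact glue_left g₁ g₂ (hn hu)
      · refine hshift _ _ _ (hg₁ _ ?_)
        have := hn hu
        constructor <;> linarith [this.1, this.2]
    · refine regularOn_of_eqOn hab (g := fun u => g₂ (u - n)) (fun u hu => ?_) fun u hu => ?_
      · rw [hL]; exact glue_right h h' (hn hu)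
      · refine hshift _ _ _ (hg₂ _ ?_)
        have := hn hu
        constructor <;> linarith [this.1, this.2]
  obtain ⟨δ, hδ, h1, h2⟩ := exists_pieces t
  exact ⟨δ, hδ, key _ _ (by linarith) h1, key _ _ (by linarith) h2⟩

/-! ### Existence of the local link -/

namespace ThreeStrands

variable {k : KnotDiagram} {C : Set Plane} {ε : ℝ} (T : ThreeStrands k C ε)
variable {u v : ℝ} {c d : ExteriorStrand}

/-- The point of the unit circle where the chord that closes an exterior strand starts. -/
def chordStart (c : ExteriorStrand) : Plane := T.pic (T.nextStart (T.num c))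

/-- The point of the unit circle where the chord that closes an exterior strand ends. -/
def chordEnd (c : ExteriorStrand) : Plane := T.pic (T.finish (T.num c))

/-- The chord that closes an exterior strand. -/
def chord (c : ExteriorStrand) (u : ℝ) : Plane :=
  AffineMap.lineMap (T.chordStart c) (T.chordEnd c) (2 * u - 1)

/-- The strand inside the changing disk that closes an exterior strand. -/
def closing (c : ExteriorStrand) (u : ℝ) : Plane := T.chart.toHomeo.symm (T.chord c u)

theorem chordStart_eq (c : ExteriorStrand) : T.chordStart c = T.pic (T.start (T.num c + 1)) := by
  rw [chordStart, pic, T.path_nextStart]; rfl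

theorem norm_chordStart (hε : ε ^ 2 = 1) (c : ExteriorStrand) :
    T.chordStart c 0 ^ 2 + T.chordStart c 1 ^ 2 = 1 := by
  rw [chordStart_eq]; exact T.norm_pic_of_end hε (Or.inl rfl)

theorem norm_chordEnd (hε : ε ^ 2 = 1) (c : ExteriorStrand) :
    T.chordEnd c 0 ^ 2 + T.chordEnd c 1 ^ 2 = 1 := T.norm_pic_of_end hε (Or.inr rfl)

theorem chordStart_ne_chordEnd (hε : ε ^ 2 = 1) (c d : ExteriorStrand) :
    T.chordStart c ≠ T.chordEnd d := by
  rw [chordStart_eq, chordEnd, Ne, ← T.path_eq_iff_pic (T.start_mem _) (T.finish_mem _)]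
  exact T.path_start_ne_path_finish hε _ _

theorem chordStart_injective (hε : ε ^ 2 = 1) : Function.Injective T.chordStart := by
  intro c d h
  rw [chordStart_eq, chordStart_eq, ← T.path_eq_iff_pic (T.start_mem _) (T.start_mem _)] at h
  exact T.num_injective (add_right_cancel (T.path_start_injective hε h))

theorem chord_mem_closedBall (hε : ε ^ 2 = 1) (c : ExteriorStrand) (hu : u ∈ Icc (1 / 2 : ℝ) 1) :
    T.chord c u ∈ Metric.closedBall (0 : Plane) 1 :=
  _root_.chord_mem_closedBall (T.norm_chordStart hε c) (T.norm_chordEnd hε c)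
    ⟨by linarith [hu.1], by linarith [hu.2]⟩

theorem chord_mem_target (hε : ε ^ 2 = 1) (c : ExteriorStrand) (hu : u ∈ Icc (1 / 2 : ℝ) 1) :
    T.chord c u ∈ T.chart.toHomeo.target :=
  T.chart.closedBall_subset_target (T.chord_mem_closedBall hε c hu)

theorem chart_closing (hε : ε ^ 2 = 1) (c : ExteriorStrand) (hu : u ∈ Icc (1 / 2 : ℝ) 1) :
    T.chart.toHomeo (T.closing c u) = T.chord c u :=
  T.chart.toHomeo.right_inv (T.chord_mem_target hε c hu)

theorem closing_mem_interior (hε : ε ^ 2 = 1) (c : ExteriorStrand) (hu : u ∈ Ioo (1 / 2 : ℝ) 1) :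
    T.closing c u ∈ interior C := by
  have hu' := Ioo_subset_Icc_self hu
  rw [closing, T.chart.mem_interior_iff (T.chart.symm_mem (T.chord_mem_closedBall hε c hu')),
    ← closing, T.chart_closing hε c hu']
  exact chord_mem_ball (T.norm_chordStart hε c) (T.norm_chordEnd hε c)
    (T.chordStart_ne_chordEnd hε c c) ⟨by linarith [hu.1], by linarith [hu.2]⟩

theorem closing_eq_iff (hε : ε ^ 2 = 1) (hu : u ∈ Icc (1 / 2 : ℝ) 1) (hv : v ∈ Icc (1 / 2 : ℝ) 1) :
    T.closing c u = T.closing d v ↔ T.chord c u = T.chord d v :=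
  T.chart.toHomeo.symm.injOn.eq_iff (T.chord_mem_target hε c hu) (T.chord_mem_target hε d hv)

theorem chord_injective (hε : ε ^ 2 = 1) (c : ExteriorStrand) : Function.Injective (T.chord c) := by
  intro u v h
  have := AffineMap.lineMap_injective ℝ (T.chordStart_ne_chordEnd hε c c) h
  linarith

theorem planeDet_chord_ne_zero (hε : ε ^ 2 = 1) (hcd : c ≠ d) (h : T.chord c u = T.chord d v) :
    planeDet (T.chordEnd c - T.chordStart c) (T.chordEnd d - T.chordStart d) ≠ 0 :=
  planeDet_chords_ne_zero (T.norm_chordStart hε c) (T.norm_chordEnd hε c) (T.norm_chordStart hε d)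
    (T.chordStart_ne_chordEnd hε c c) ((T.chordStart_injective hε).ne hcd.symm)
    (T.chordStart_ne_chordEnd hε d c) h

theorem hasDerivAt_chord (c : ExteriorStrand) (u : ℝ) :
    HasDerivAt (T.chord c) ((2 : ℝ) • (T.chordEnd c - T.chordStart c)) u := by
  have h : HasDerivAt (fun u : ℝ => 2 * u - 1) 2 u := by
    simpa using ((hasDerivAt_id u).const_mul 2).sub_const 1
  exact (AffineMap.hasDerivAt_lineMap (a := T.chordStart c) (b := T.chordEnd c)).scomp u h

theorem contDiff_chord (c : ExteriorStrand) : ContDiff ℝ ∞ (T.chord c) := by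
  have : T.chord c = fun u : ℝ => (2 * u - 1) • (T.chordEnd c - T.chordStart c) + T.chordStart c := by
    funext u; rw [chord, AffineMap.lineMap_apply]; rfl
  rw [this]
  fun_prop

theorem hasDerivAt_closing (hε : ε ^ 2 = 1) (c : ExteriorStrand) (hu : u ∈ Icc (1 / 2 : ℝ) 1) :
    HasDerivAt (T.closing c) (fderiv ℝ T.chart.toHomeo.symm (T.chord c u)
      ((2 : ℝ) • (T.chordEnd c - T.chordStart c))) u :=
  (T.chart.hasFDerivAt_symm (T.chord_mem_target hε c hu)).comp_hasDerivAt u (T.hasDerivAt_chord c u)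

theorem regular_closing (hε : ε ^ 2 = 1) (c : ExteriorStrand) (hu : u ∈ Icc (1 / 2 : ℝ) 1) :
    ContDiffAt ℝ ∞ (T.closing c) u ∧ deriv (T.closing c) u ≠ 0 := by
  constructor
  · exact (T.chart.contDiffAt_symm (T.chord_mem_target hε c hu)).comp u
      (T.contDiff_chord c).contDiffAt
  · rw [(T.hasDerivAt_closing hε c hu).deriv]
    intro h
    have h' := T.chart.fderiv_fderiv_symm (T.chord_mem_target hε c hu)
      ((2 : ℝ) • (T.chordEnd c - T.chordStart c))
    rw [h, map_zero] at h'
    have h2 := (smul_eq_zero.1 h'.symm).resolve_left two_ne_zero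
    exact T.chordStart_ne_chordEnd hε c c (sub_eq_zero.1 h2).symm

theorem regular_exterior (i : Fin 3) (u : ℝ) :
    ContDiffAt ℝ ∞ (fun u => k.path (T.exteriorParam i u)) u ∧
      deriv (fun u => k.path (T.exteriorParam i u)) u ≠ 0 := by
  constructor
  · have h : ContDiff ℝ ∞ (T.exteriorParam i) := by
      have : T.exteriorParam i =
          fun u => T.finish i + 2 * (T.nextStart i - T.finish i) * u :=
        funext fun u => T.exteriorParam_eq i u
      rw [this]; fun_prop
    exact (k.regular _).1.comp u h.contDiffAt
  · rw [(T.hasDerivAt_path_exteriorParam i u).deriv]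
    have := T.finish_lt_nextStart i
    exact smul_ne_zero (by linarith) (k.deriv_path_ne_zero _)

/-- The exterior strands `a` and `b`, closed by chords. -/
def localCurves : ClosedCurves ExteriorStrand where
  curve c := glue (fun u => k.path (T.exteriorParam (T.num c) u)) (T.closing c)
  periodic _ := glue_periodic _ _

theorem closing_half (c : ExteriorStrand) :
    k.path (T.exteriorParam (T.num c) (1 / 2)) = T.closing c (1 / 2) := by
  have e : T.chord c (1 / 2) = T.pic (T.nextStart (T.num c)) := by
    rw [chord, show (2 : ℝ) * (1 / 2) - 1 = 0 by norm_num, AffineMap.lineMap_apply_zero]; rfl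
  rw [T.exteriorParam_half, closing, e, pic, T.chart.toHomeo.left_inv]
  apply T.chart.subset_source
  rw [T.path_nextStart]
  exact T.path_mem (T.start_mem _)

theorem closing_one (c : ExteriorStrand) :
    T.closing c 1 = k.path (T.exteriorParam (T.num c) 0) := by
  have e : T.chord c 1 = T.pic (T.finish (T.num c)) := by
    rw [chord, show (2 : ℝ) * 1 - 1 = 1 by norm_num, AffineMap.lineMap_apply_one]; rfl
  rw [T.exteriorParam_zero, closing, e, pic, T.chart.toHomeo.left_inv]
  exact T.chart.subset_source (T.path_mem (T.finish_mem _))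

theorem localCurves_exterior (c : ExteriorStrand) (hu : u ∈ Icc (0 : ℝ) (1 / 2)) :
    T.localCurves.curve c u = k.path (T.exteriorParam (T.num c) u) := by
  have := glue_left (fun u => k.path (T.exteriorParam (T.num c) u)) (T.closing c) (t := u) (n := 0)
    (by simpa using hu)
  rw [Int.cast_zero, sub_zero] at this
  exact this

theorem localCurves_closing (c : ExteriorStrand) (hu : u ∈ Icc (1 / 2 : ℝ) 1) :
    T.localCurves.curve c u = T.closing c u := by
  have := glue_right (g₁ := fun u => k.path (T.exteriorParam (T.num c) u)) (g₂ := T.closing c)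
    (T.closing_half c) (T.closing_one c) (t := u) (n := 0) (by simpa using hu)
  rw [Int.cast_zero, sub_zero] at this
  exact this

theorem localCurves_eventuallyEq_exterior (c : ExteriorStrand) (hu : u ∈ Ioo (0 : ℝ) (1 / 2)) :
    T.localCurves.curve c =ᶠ[nhds u] fun u => k.path (T.exteriorParam (T.num c) u) := by
  filter_upwards [isOpen_Ioo.mem_nhds hu] with v hv
  exact T.localCurves_exterior c (Ioo_subset_Icc_self hv)

theorem localCurves_eventuallyEq_closing (c : ExteriorStrand) (hu : u ∈ Ioo (1 / 2 : ℝ) 1) :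
    T.localCurves.curve c =ᶠ[nhds u] T.closing c := by
  filter_upwards [isOpen_Ioo.mem_nhds hu] with v hv
  exact T.localCurves_closing c (Ioo_subset_Icc_self hv)

theorem pt_link_eq_iff (hu : u ∈ Ico (0 : ℝ) 1) (hv : v ∈ Ico (0 : ℝ) 1) :
    pt c u = pt d v ↔ c = d ∧ u = v :=
  pt_eq_iff_of_mem (a := 0) (by simpa using hu) (by simpa using hv)

theorem mem_Ico_of_exterior (hu : u ∈ Ioo (0 : ℝ) (1 / 2)) : u ∈ Ico (0 : ℝ) 1 :=
  ⟨hu.1.le, by linarith [hu.2]⟩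

theorem mem_Ico_of_closing (hu : u ∈ Ioo (1 / 2 : ℝ) 1) : u ∈ Ico (0 : ℝ) 1 :=
  ⟨by linarith [hu.1], hu.2⟩

theorem localCurves_crosses_exterior (hu : u ∈ Ioo (0 : ℝ) (1 / 2))
    (hv : v ∈ Ioo (0 : ℝ) (1 / 2)) :
    T.localCurves.Crosses (pt c u) (pt d v) ↔ k.Crosses (pt () (T.exteriorParam (T.num c) u))
      (pt () (T.exteriorParam (T.num d) v)) := by
  rw [crosses_pt_iff, k.crosses_iff, T.localCurves_exterior c (Ioo_subset_Icc_self hu),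
    T.localCurves_exterior d (Ioo_subset_Icc_self hv)]
  refine and_congr_left fun _ => not_congr ?_
  rw [T.pt_exteriorParam_eq_iff hu hv, T.num_injective.eq_iff]
  exact pt_link_eq_iff (mem_Ico_of_exterior hu) (mem_Ico_of_exterior hv)

theorem localCurves_crosses_closing (hε : ε ^ 2 = 1) (hu : u ∈ Ioo (1 / 2 : ℝ) 1)
    (hv : v ∈ Ioo (1 / 2 : ℝ) 1) :
    T.localCurves.Crosses (pt c u) (pt d v) ↔ c ≠ d ∧ T.chord c u = T.chord d v := by
  have hu' := Ioo_subset_Icc_self hu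
  have hv' := Ioo_subset_Icc_self hv
  rw [crosses_pt_iff, T.localCurves_closing c hu', T.localCurves_closing d hv',
    T.closing_eq_iff hε hu' hv']
  refine and_congr_left fun h => not_congr ?_
  rw [pt_link_eq_iff (mem_Ico_of_closing hu) (mem_Ico_of_closing hv)]
  refine ⟨fun h' => h'.1, fun h' => ⟨h', ?_⟩⟩
  subst h'
  exact T.chord_injective hε _ h

/-- No crossing is at a corner or between an exterior and a closing strand, so all diagram axioms
reduce to those of `k` or to statements about chords. -/
theorem localCurves_crosses_cases (hε : ε ^ 2 = 1) {p q : Pt ExteriorStrand}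
    (h : T.localCurves.Crosses p q) :
    (∃ c d, ∃ u ∈ Ioo (0 : ℝ) (1 / 2), ∃ v ∈ Ioo (0 : ℝ) (1 / 2), p = pt c u ∧ q = pt d v) ∨
      ∃ c d, ∃ u ∈ Ioo (1 / 2 : ℝ) 1, ∃ v ∈ Ioo (1 / 2 : ℝ) 1, p = pt c u ∧ q = pt d v := by
  have hu := rep_mem 0 p
  have hv := rep_mem 0 q
  have ep := pt_rep 0 p
  have eq := pt_rep 0 q
  generalize rep 0 p = u at *
  generalize rep 0 q = v at *
  generalize p.1 = c at *
  generalize q.1 = d at *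
  subst ep eq
  rw [zero_add] at hu hv
  obtain ⟨hne, hcur⟩ := T.localCurves.crosses_pt_iff.1 h
  rcases le_or_gt u (1 / 2) with h1 | h1 <;> rcases le_or_gt v (1 / 2) with h2 | h2
  · have h3 : u ∈ Icc (0 : ℝ) (1 / 2) := ⟨hu.1, h1⟩
    have h4 : v ∈ Icc (0 : ℝ) (1 / 2) := ⟨hv.1, h2⟩
    rw [T.localCurves_exterior _ h3, T.localCurves_exterior _ h4] at hcur
    rcases T.exterior_path_eq hε (T.exteriorParam_mem_Icc h3) (T.exteriorParam_mem_Icc h4) hcur with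
      ⟨h5, h6⟩ | ⟨h5, h6⟩
    · exact Or.inl ⟨c, d, u, T.exteriorParam_mem_Ioo_iff.1 h5, v, T.exteriorParam_mem_Ioo_iff.1 h6,
        rfl, rfl⟩
    · obtain rfl := T.num_injective h5
      exact absurd (congrArg _ ((T.exteriorParam_strictMono _).injective h6)) hne
  · have h3 : u ∈ Icc (0 : ℝ) (1 / 2) := ⟨hu.1, h1⟩
    have h4 : v ∈ Ioo (1 / 2 : ℝ) 1 := ⟨h2, hv.2⟩
    rw [T.localCurves_exterior _ h3, T.localCurves_closing _ (Ioo_subset_Icc_self h4)] at hcur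
    exact absurd (hcur ▸ T.closing_mem_interior hε d h4)
      (T.exterior_notMem_interior hε (T.exteriorParam_mem_Icc h3))
  · have h3 : u ∈ Ioo (1 / 2 : ℝ) 1 := ⟨h1, hu.2⟩
    have h4 : v ∈ Icc (0 : ℝ) (1 / 2) := ⟨hv.1, h2⟩
    rw [T.localCurves_exterior _ h4, T.localCurves_closing _ (Ioo_subset_Icc_self h3)] at hcur
    exact absurd (hcur ▸ T.closing_mem_interior hε c h3)
      (T.exterior_notMem_interior hε (T.exteriorParam_mem_Icc h4))
  · exact Or.inr ⟨c, d, u, ⟨h1, hu.2⟩, v, ⟨h2, hv.2⟩, rfl, rfl⟩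

/-- The preimages of crossing points on the overpassing strands of the local link: the strand that
closes `a` passes over the strand that closes `b`. -/
def localOverpass : Set (Pt ExteriorStrand) :=
  {p | (∃ q, T.localCurves.Crosses p q) ∧
    ((∃ c, ∃ u ∈ Ioo (0 : ℝ) (1 / 2), p = pt c u ∧ k.IsOver (T.exteriorParam (T.num c) u)) ∨
      ∃ u ∈ Ioo (1 / 2 : ℝ) 1, p = pt .a u)}

theorem mem_localOverpass_exterior (hu : u ∈ Ioo (0 : ℝ) (1 / 2))
    (h : ∃ q, T.localCurves.Crosses (pt c u) q) :
    pt c u ∈ T.localOverpass ↔ k.IsOver (T.exteriorParam (T.num c) u) := by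
  constructor
  · rintro ⟨-, ⟨d, v, hv, e, ho⟩ | ⟨v, hv, e⟩⟩
    · obtain ⟨rfl, rfl⟩ := (pt_link_eq_iff (mem_Ico_of_exterior hu) (mem_Ico_of_exterior hv)).1 e
      exact ho
    · obtain ⟨rfl, rfl⟩ := (pt_link_eq_iff (mem_Ico_of_exterior hu) (mem_Ico_of_closing hv)).1 e
      exact absurd hu.2 hv.1.not_gt
  · exact fun ho => ⟨h, Or.inl ⟨c, u, hu, rfl, ho⟩⟩

theorem mem_localOverpass_closing (hu : u ∈ Ioo (1 / 2 : ℝ) 1)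
    (h : ∃ q, T.localCurves.Crosses (pt c u) q) : pt c u ∈ T.localOverpass ↔ c = .a := by
  constructor
  · rintro ⟨-, ⟨d, v, hv, e, ho⟩ | ⟨v, hv, e⟩⟩
    · obtain ⟨rfl, rfl⟩ := (pt_link_eq_iff (mem_Ico_of_closing hu) (mem_Ico_of_exterior hv)).1 e
      exact absurd hv.2 hu.1.not_gt
    · exact ((pt_link_eq_iff (mem_Ico_of_closing hu) (mem_Ico_of_closing hv)).1 e).1
  · rintro rfl
    exact ⟨h, Or.inr ⟨u, hu, rfl⟩⟩

theorem localCurves_regularAt (hε : ε ^ 2 = 1) {q : Pt ExteriorStrand} {t : ℝ}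
    (h : T.localCurves.Crosses (pt c t) q) : T.localCurves.RegularAt c t := by
  have key : ∀ {g : ℝ → Plane} {u : ℝ}, T.localCurves.curve c =ᶠ[nhds u] g →
      ContDiffAt ℝ ∞ g u ∧ deriv g u ≠ 0 → T.localCurves.RegularAt c u := by
    intro g u hg hr
    exact ⟨hr.1.congr_of_eventuallyEq hg, by rw [hg.deriv_eq]; exact hr.2⟩
  -- The parameter `t` is any real number, while the description of the crossings uses
  -- representatives in the unit interval.
  have hshift : ∀ n : ℤ, T.localCurves.RegularAt c (t - n) → T.localCurves.RegularAt c t := by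
    intro n hn
    have e : T.localCurves.curve c = fun s => T.localCurves.curve c (s - n) := by
      funext s
      simpa using ((T.localCurves.periodic c).sub_int_mul_eq n (x := s)).symm
    constructor
    · rw [e]
      exact hn.1.comp t (contDiffAt_id.sub contDiffAt_const)
    · rw [e, deriv_comp_sub_const]
      exact hn.2
  rcases T.localCurves_crosses_cases hε h with ⟨c', d, u, hu, v, hv, h1, h2⟩ |
    ⟨c', d, u, hu, v, hv, h1, h2⟩
  · obtain ⟨rfl, n, rfl⟩ := pt_eq_iff.1 h1
    refine hshift n ?_
    rw [add_sub_cancel_right]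
    exact key (T.localCurves_eventuallyEq_exterior _ hu) (T.regular_exterior _ _)
  · obtain ⟨rfl, n, rfl⟩ := pt_eq_iff.1 h1
    refine hshift n ?_
    rw [add_sub_cancel_right]
    exact key (T.localCurves_eventuallyEq_closing _ hu)
      (T.regular_closing hε _ (Ioo_subset_Icc_self hu))

theorem localCurves_transversal (hε : ε ^ 2 = 1) {p q : Pt ExteriorStrand}
    (h : T.localCurves.Crosses p q) :
    planeDet (T.localCurves.velocity p) (T.localCurves.velocity q) ≠ 0 := by
  rcases T.localCurves_crosses_cases hε h with ⟨c, d, u, hu, v, hv, rfl, rfl⟩ |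
    ⟨c, d, u, hu, v, hv, rfl, rfl⟩
  · have hk := k.transversal _ _ ((T.localCurves_crosses_exterior hu hv).1 h)
    rw [k.velocity_eq, k.velocity_eq] at hk
    have h1 := T.finish_lt_nextStart (T.num c)
    have h2 := T.finish_lt_nextStart (T.num d)
    rw [velocity_pt, velocity_pt, (T.localCurves_eventuallyEq_exterior c hu).deriv_eq,
      (T.localCurves_eventuallyEq_exterior d hv).deriv_eq,
      (T.hasDerivAt_path_exteriorParam _ u).deriv, (T.hasDerivAt_path_exteriorParam _ v).deriv,
      planeDet_smul_smul]
    exact mul_ne_zero (mul_ne_zero (by linarith) (by linarith)) hk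
  · obtain ⟨hcd, he⟩ := (T.localCurves_crosses_closing hε hu hv).1 h
    have hu' := Ioo_subset_Icc_self hu
    have hv' := Ioo_subset_Icc_self hv
    have hdet := T.planeDet_chord_ne_zero hε hcd he
    rw [velocity_pt, velocity_pt, (T.localCurves_eventuallyEq_closing c hu).deriv_eq,
      (T.localCurves_eventuallyEq_closing d hv).deriv_eq,
      (T.hasDerivAt_closing hε c hu').deriv, (T.hasDerivAt_closing hε d hv').deriv, ← he]
    intro h0
    apply hdet
    -- The derivative of the chart takes the velocities of the closing strands back to twice the
    -- chord vectors, so parallel velocities would give parallel chords.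
    have h1 := planeDet_map (fderiv ℝ T.chart.toHomeo (T.chart.toHomeo.symm (T.chord c u)))
      (fderiv ℝ T.chart.toHomeo.symm (T.chord c u) ((2 : ℝ) • (T.chordEnd c - T.chordStart c)))
      (fderiv ℝ T.chart.toHomeo.symm (T.chord c u) ((2 : ℝ) • (T.chordEnd d - T.chordStart d)))
    rw [T.chart.fderiv_fderiv_symm (T.chord_mem_target hε c hu'),
      T.chart.fderiv_fderiv_symm (T.chord_mem_target hε c hu'), h0, mul_zero,
      planeDet_smul_smul] at h1
    linarith

theorem localCurves_no_triple (hε : ε ^ 2 = 1) {p q r : Pt ExteriorStrand}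
    (hpq : T.localCurves.Crosses p q) (hqr : T.localCurves.Crosses q r) : p = r := by
  rcases T.localCurves_crosses_cases hε hpq with ⟨c, d, u, hu, v, hv, rfl, rfl⟩ |
    ⟨c, d, u, hu, v, hv, rfl, rfl⟩ <;>
    rcases T.localCurves_crosses_cases hε hqr with ⟨d', e, v', hv', w, hw, h1, rfl⟩ |
      ⟨d', e, v', hv', w, hw, h1, rfl⟩
  · obtain ⟨rfl, rfl⟩ := (pt_link_eq_iff (mem_Ico_of_exterior hv) (mem_Ico_of_exterior hv')).1 h1
    have h := k.no_triple _ _ _ ((T.localCurves_crosses_exterior hu hv).1 hpq)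
      ((T.localCurves_crosses_exterior hv hw).1 hqr)
    obtain ⟨h2, h3⟩ := (T.pt_exteriorParam_eq_iff hu hw).1 h
    rw [T.num_injective h2, h3]
  · obtain ⟨rfl, rfl⟩ := (pt_link_eq_iff (mem_Ico_of_exterior hv) (mem_Ico_of_closing hv')).1 h1
    exact absurd hv.2 hv'.1.not_gt
  · obtain ⟨rfl, rfl⟩ := (pt_link_eq_iff (mem_Ico_of_closing hv) (mem_Ico_of_exterior hv')).1 h1
    exact absurd hv'.2 hv.1.not_gt
  · obtain ⟨rfl, rfl⟩ := (pt_link_eq_iff (mem_Ico_of_closing hv) (mem_Ico_of_closing hv')).1 h1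
    obtain ⟨n1, e1⟩ := (T.localCurves_crosses_closing hε hu hv).1 hpq
    obtain ⟨n2, e2⟩ := (T.localCurves_crosses_closing hε hv hw).1 hqr
    -- A chord does not cross itself and there are only two of them, so the third strand is again
    -- the first.
    obtain rfl : c = e := by
      cases c <;> cases d <;> cases e <;> first | rfl | exact absurd rfl n1 | exact absurd rfl n2
    rw [T.chord_injective hε c (e1.trans e2)]

theorem localCurves_finite (hε : ε ^ 2 = 1) :
    {x : Pt ExteriorStrand × Pt ExteriorStrand | T.localCurves.Crosses x.1 x.2}.Finite := by
  classical
  have hrep : ∀ (c : ExteriorStrand) {u : ℝ}, u ∈ Ioo (0 : ℝ) (1 / 2) → rep 0 (pt c u) = u :=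
    fun c u hu => rep_pt c (by simpa using mem_Ico_of_exterior hu)
  set E := {x : Pt ExteriorStrand × Pt ExteriorStrand | T.localCurves.Crosses x.1 x.2 ∧
    ∃ c d, ∃ u ∈ Ioo (0 : ℝ) (1 / 2), ∃ v ∈ Ioo (0 : ℝ) (1 / 2), x.1 = pt c u ∧ x.2 = pt d v}
    with hE
  set I := {x : Pt ExteriorStrand × Pt ExteriorStrand | T.localCurves.Crosses x.1 x.2 ∧
    ∃ c d, ∃ u ∈ Ioo (1 / 2 : ℝ) 1, ∃ v ∈ Ioo (1 / 2 : ℝ) 1, x.1 = pt c u ∧ x.2 = pt d v}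
    with hI
  have fE : E.Finite := by
    let f : Pt ExteriorStrand → Pt Unit := fun p => pt () (T.exteriorParam (T.num p.1) (rep 0 p))
    have hf : ∀ (c : ExteriorStrand) {u : ℝ}, u ∈ Ioo (0 : ℝ) (1 / 2) →
        f (pt c u) = pt () (T.exteriorParam (T.num c) u) := fun c u hu => by
      simp only [f, hrep c hu]; rfl
    have hinj : ∀ {c d : ExteriorStrand} {u v : ℝ}, u ∈ Ioo (0 : ℝ) (1 / 2) →
        v ∈ Ioo (0 : ℝ) (1 / 2) → f (pt c u) = f (pt d v) → pt c u = pt d v := by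
      intro c d u v hu hv h
      rw [hf c hu, hf d hv, T.pt_exteriorParam_eq_iff hu hv] at h
      rw [T.num_injective h.1, h.2]
    -- Crossings of exterior strands inject into those of `k`.
    refine Set.Finite.of_injOn (f := fun x => (f x.1, f x.2)) ?_ ?_ k.finite_crossings
    · rintro ⟨p, q⟩ ⟨h, c, d, u, hu, v, hv, h1, h2⟩
      dsimp only at h h1 h2
      subst h1 h2
      change k.Crosses (f _) (f _)
      rw [hf c hu, hf d hv]
      exact (T.localCurves_crosses_exterior hu hv).1 h
    · rintro ⟨p, q⟩ ⟨-, c, d, u, hu, v, hv, h1, h2⟩ ⟨p', q'⟩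
        ⟨-, c', d', u', hu', v', hv', h1', h2'⟩ he
      dsimp only at h1 h2 h1' h2'
      subst h1 h2 h1' h2'
      rw [Prod.mk.injEq] at he
      exact Prod.ext (hinj hu hu' he.1) (hinj hv hv' he.2)
  have fI : I.Finite := by
    have hfin : Finite ExteriorStrand := Finite.of_injective T.num T.num_injective
    -- Two chords meet at most once, so a crossing inside `C` is determined by its pair of
    -- components.
    refine Set.Finite.of_injOn (f := fun x => (x.1.1, x.2.1)) (mapsTo_univ _ _) ?_ finite_univ
    rintro ⟨p, q⟩ ⟨h, c, d, u, hu, v, hv, h1, h2⟩ ⟨p', q'⟩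
      ⟨h', c', d', u', hu', v', hv', h1', h2'⟩ he
    dsimp only at h h' h1 h2 h1' h2'
    subst h1 h2 h1' h2'
    obtain ⟨e1, e2⟩ := Prod.mk.injEq _ _ _ _ ▸ he
    change c = c' at e1
    change d = d' at e2
    subst e1 e2
    obtain ⟨hcd, k1⟩ := (T.localCurves_crosses_closing hε hu hv).1 h
    obtain ⟨-, k2⟩ := (T.localCurves_crosses_closing hε hu' hv').1 h'
    obtain ⟨k3, k4⟩ := chords_meet_unique (T.planeDet_chord_ne_zero hε hcd k1) k1 k2
    rw [show u = u' by linarith, show v = v' by linarith]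
  refine (fE.union fI).subset fun x hx => ?_
  rcases T.localCurves_crosses_cases hε hx with h | h
  · exact Or.inl ⟨hx, h⟩
  · exact Or.inr ⟨hx, h⟩

theorem localOverpass_iff (hε : ε ^ 2 = 1) {p q : Pt ExteriorStrand}
    (h : T.localCurves.Crosses p q) : p ∈ T.localOverpass ↔ q ∉ T.localOverpass := by
  rcases T.localCurves_crosses_cases hε h with ⟨c, d, u, hu, v, hv, rfl, rfl⟩ |
    ⟨c, d, u, hu, v, hv, rfl, rfl⟩
  · rw [T.mem_localOverpass_exterior hu ⟨_, h⟩, T.mem_localOverpass_exterior hv ⟨_, h.symm⟩]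
    exact k.overpass_iff _ _ ((T.localCurves_crosses_exterior hu hv).1 h)
  · rw [T.mem_localOverpass_closing hu ⟨_, h⟩, T.mem_localOverpass_closing hv ⟨_, h.symm⟩]
    obtain ⟨hcd, -⟩ := (T.localCurves_crosses_closing hε hu hv).1 h
    cases c <;> cases d <;> simp at hcd ⊢

/-- The local link that is obtained by closing the exterior strands by chords. -/
def localLink (hε : ε ^ 2 = 1) : LinkDiagram ExteriorStrand where
  toClosedCurves := T.localCurves
  piecewise_regular c t := piecewise_regular_of_glue rfl (T.closing_half c) (T.closing_one c)
    (fun u _ => T.regular_exterior _ u) (fun _ hu => T.regular_closing hε c hu) t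
  regular_of_crosses _ _ _ h := T.localCurves_regularAt hε h
  transversal _ _ h := T.localCurves_transversal hε h
  no_triple _ _ _ h h' := T.localCurves_no_triple hε h h'
  finite_crossings := T.localCurves_finite hε
  overpass := T.localOverpass
  crosses_of_mem_overpass _ h := h.1
  overpass_iff _ _ h := T.localOverpass_iff hε h

theorem isLocalLink_localLink (hε : ε ^ 2 = 1) : T.IsLocalLink (T.localLink hε) where
  exterior c i hi u hu := by
    rw [T.isNumberOf_iff] at hi
    subst hi
    exact T.localCurves_exterior c hu
  over_exterior c i hi u hu h := by
    rw [T.isNumberOf_iff] at hi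
    subst hi
    obtain ⟨q, hq⟩ := h
    have hu1 : u ∈ Ico (0 : ℝ) 1 := ⟨hu.1, by linarith [hu.2]⟩
    refine T.mem_localOverpass_exterior ?_ ⟨q, hq⟩
    -- The closed interval admits the corners `0` and `1 / 2`, but no crossing lies there.
    rcases T.localCurves_crosses_cases hε hq with ⟨c', d, u', hu', v, hv, h1, h2⟩ |
      ⟨c', d, u', hu', v, hv, h1, h2⟩
    · rw [((pt_link_eq_iff hu1 (mem_Ico_of_exterior hu')).1 h1).2]
      exact hu'
    · have := ((pt_link_eq_iff hu1 (mem_Ico_of_closing hu')).1 h1).2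
      linarith [hu.2, hu'.1]
  closing c u hu := by
    change T.localCurves.curve c u ∈ interior C
    rw [T.localCurves_closing c (Ioo_subset_Icc_self hu)]
    exact T.closing_mem_interior hε c hu
  closing_not_over u hu v hv h hover := by
    have := (T.mem_localOverpass_closing hu hover.1).1 hover
    simp at this

end ThreeStrands

end

theorem mainTheorem6 (k l : KnotDiagram) (C : Set Plane) (m : Omega3Move k l C)
    (hm : m.IsPositive) :
    (∃ L : LinkDiagram ExteriorStrand, m.before.IsLocalLink L) ∧
      ∀ L : LinkDiagram ExteriorStrand, m.before.IsLocalLink L →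
        l.weirdness - k.weirdness = L.linkingNumber .b .a :=
  ⟨⟨_, m.before.isLocalLink_localLink (one_pow 2)⟩, fun L hL => by
    rw [m.weirdness_sub_of_isPositive hm, hL.linkingNumber_eq m.before (one_pow 2)]⟩
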